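/- Let $B$ (blue) and $R$ (red) be finite sets of at most $n$ points each in $\mathbb{R}^2$ such that $B\cup R$ has at least three points and is in general position: $B\cap R=\emptyset$, no two points of $B\cup R$ have the same $x$-coordinate or the same $y$-coordinate, and no three are collinear. For a line $\ell$ let $\ell^+$ and $\ell^-$ be the closed halfplanes above and below $\ell$ (right and left of $\ell$ if $\ell$ is vertical). For two intersecting lines $\ell_1,\ell_2$, the North wedge is $\ell_1^+\cap\ell_2^+$ and the South wedge is $\ell_1^-\cap\ell_2^-$. The number $k_R$ of red outliers of a wedge $W$ is the number of points of $R$ in the interior of $W$. Then a wedge that contains all points of $B$ and has the minimum $k_R$ among all North and South wedges containing $B$ can be constructed in $O(n\log n)$ time; the same holds among the North wedges alone and among the South wedges alone. Precisely: in each of the three cases there is a single real RAM program (exact real arithmetic $+,-,\cdot,/$ and comparisons, rational constants, integer words of $O(\log n)$ bits, indirect addressing, unit cost per operation) and a constant $C$ such that for all $n$ and all such $B,R$, given as two lists of points in any order, the program halts after at most $C\,n\log n$ steps and outputs the kind of the wedge together with the slopes and intercepts of two (non-parallel, non-vertical) lines that define an optimal wedge. -/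

import Mathlib

/-! ### A real RAM

Memory consists of finitely many word arrays and finitely many real arrays (those whose number
occurs in the program).  Programs are finite terms: they do not depend on the input.  Every
expression node, every assignment and every test costs one step.  Words are natural numbers at
most `W`, reals are exact; there is no rounding and no conversion from reals to words. -/

namespace RealRAM

/-- Memory: `word a i` and `real a i` are the cells with index `i` of the `a`-th word array and
of the `a`-th real array. -/
structure State where
  word : ℕ → ℕ → ℕ
  real : ℕ → ℕ → ℝ

/-- Word expressions.  `read a i` is indirect addressing: the index is itself computed. -/
inductive WExp where
  | const (k : ℕ)
  | read (a : ℕ) (i : WExp)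
  | add (e f : WExp)
  | sub (e f : WExp)
  | mul (e f : WExp)
  | div (e f : WExp)

namespace WExp

/-- Value of a word expression (`sub` is truncated subtraction, `div` is integer division). -/
def eval (s : State) : WExp → ℕ
  | const k => k
  | read a i => s.word a (i.eval s)
  | add e f => e.eval s + f.eval s
  | sub e f => e.eval s - f.eval s
  | mul e f => e.eval s * f.eval s
  | div e f => e.eval s / f.eval s

/-- The evaluation neither overflows the word bound `W` nor divides by zero. -/
def Ok (W : ℕ) (s : State) : WExp → Prop
  | const k => k ≤ W
  | read _ i => i.Ok W s
  | add e f => e.Ok W s ∧ f.Ok W s ∧ e.eval s + f.eval s ≤ W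
  | sub e f => e.Ok W s ∧ f.Ok W s
  | mul e f => e.Ok W s ∧ f.Ok W s ∧ e.eval s * f.eval s ≤ W
  | div e f => e.Ok W s ∧ f.Ok W s ∧ f.eval s ≠ 0

/-- Number of steps of the evaluation. -/
def cost : WExp → ℕ
  | const _ => 1
  | read _ i => i.cost + 1
  | add e f => e.cost + f.cost + 1
  | sub e f => e.cost + f.cost + 1
  | mul e f => e.cost + f.cost + 1
  | div e f => e.cost + f.cost + 1

end WExp

/-- Real expressions; the constants are rational. -/
inductive RExp where
  | const (q : ℚ)
  | read (a : ℕ) (i : WExp)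
  | add (e f : RExp)
  | sub (e f : RExp)
  | mul (e f : RExp)
  | div (e f : RExp)

namespace RExp

/-- Value of a real expression. -/
noncomputable def eval (s : State) : RExp → ℝ
  | const q => (q : ℝ)
  | read a i => s.real a (i.eval s)
  | add e f => e.eval s + f.eval s
  | sub e f => e.eval s - f.eval s
  | mul e f => e.eval s * f.eval s
  | div e f => e.eval s / f.eval s

/-- All addresses are computed within the word bound and there is no division by zero. -/
def Ok (W : ℕ) (s : State) : RExp → Prop
  | const _ => True
  | read _ i => i.Ok W s
  | add e f => e.Ok W s ∧ f.Ok W s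
  | sub e f => e.Ok W s ∧ f.Ok W s
  | mul e f => e.Ok W s ∧ f.Ok W s
  | div e f => e.Ok W s ∧ f.Ok W s ∧ f.eval s ≠ 0

/-- Number of steps of the evaluation. -/
def cost : RExp → ℕ
  | const _ => 1
  | read _ i => i.cost + 1
  | add e f => e.cost + f.cost + 1
  | sub e f => e.cost + f.cost + 1
  | mul e f => e.cost + f.cost + 1
  | div e f => e.cost + f.cost + 1

end RExp

/-- Tests. -/
inductive BExp where
  | wlt (e f : WExp)
  | weq (e f : WExp)
  | rlt (e f : RExp)
  | not (b : BExp)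
  | and (b c : BExp)
  | or (b c : BExp)

namespace BExp

/-- Truth of a test. -/
def Holds (s : State) : BExp → Prop
  | wlt e f => e.eval s < f.eval s
  | weq e f => e.eval s = f.eval s
  | rlt e f => e.eval s < f.eval s
  | not b => ¬ b.Holds s
  | and b c => b.Holds s ∧ c.Holds s
  | or b c => b.Holds s ∨ c.Holds s

/-- All expressions in the test can be evaluated. -/
def Ok (W : ℕ) (s : State) : BExp → Prop
  | wlt e f => e.Ok W s ∧ f.Ok W s
  | weq e f => e.Ok W s ∧ f.Ok W s
  | rlt e f => e.Ok W s ∧ f.Ok W s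
  | not b => b.Ok W s
  | and b c => b.Ok W s ∧ c.Ok W s
  | or b c => b.Ok W s ∧ c.Ok W s

/-- Number of steps of the test. -/
def cost : BExp → ℕ
  | wlt e f => e.cost + f.cost + 1
  | weq e f => e.cost + f.cost + 1
  | rlt e f => e.cost + f.cost + 1
  | not b => b.cost + 1
  | and b c => b.cost + c.cost + 1
  | or b c => b.cost + c.cost + 1

end BExp

/-- Programs. -/
inductive Prog where
  | skip
  | setWord (a : ℕ) (i e : WExp)
  | setReal (a : ℕ) (i : WExp) (e : RExp)
  | seq (p q : Prog)
  | branch (b : BExp) (p q : Prog)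
  | loop (b : BExp) (p : Prog)

namespace State

/-- Overwrite one cell of a word array. -/
def writeWord (s : State) (a i v : ℕ) : State where
  word := Function.update s.word a (Function.update (s.word a) i v)
  real := s.real

/-- Overwrite one cell of a real array. -/
noncomputable def writeReal (s : State) (a i : ℕ) (v : ℝ) : State where
  word := s.word
  real := Function.update s.real a (Function.update (s.real a) i v)

end State

/-- `Exec W p s t s'`: with words bounded by `W`, the program `p` started in the state `s` halts
after exactly `t` steps in the state `s'`.  A program that overflows or divides by zero has no
such execution. -/
inductive Exec (W : ℕ) : Prog → State → ℕ → State → Prop where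
  | skip (s : State) : Exec W .skip s 1 s
  | setWord {s : State} {a : ℕ} {i e : WExp} (hi : i.Ok W s) (he : e.Ok W s) :
      Exec W (.setWord a i e) s (i.cost + e.cost + 1) (s.writeWord a (i.eval s) (e.eval s))
  | setReal {s : State} {a : ℕ} {i : WExp} {e : RExp} (hi : i.Ok W s) (he : e.Ok W s) :
      Exec W (.setReal a i e) s (i.cost + e.cost + 1) (s.writeReal a (i.eval s) (e.eval s))
  | seq {p q : Prog} {s s' s'' : State} {t u : ℕ}
      (hp : Exec W p s t s') (hq : Exec W q s' u s'') : Exec W (.seq p q) s (t + u) s''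
  | branchTrue {b : BExp} {p q : Prog} {s s' : State} {t : ℕ}
      (hb : b.Ok W s) (h : b.Holds s) (hp : Exec W p s t s') :
      Exec W (.branch b p q) s (b.cost + 1 + t) s'
  | branchFalse {b : BExp} {p q : Prog} {s s' : State} {t : ℕ}
      (hb : b.Ok W s) (h : ¬ b.Holds s) (hq : Exec W q s t s') :
      Exec W (.branch b p q) s (b.cost + 1 + t) s'
  | loopTrue {b : BExp} {p : Prog} {s s' s'' : State} {t u : ℕ}
      (hb : b.Ok W s) (h : b.Holds s) (hp : Exec W p s t s')
      (hl : Exec W (.loop b p) s' u s'') :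
      Exec W (.loop b p) s (b.cost + 1 + t + u) s''
  | loopFalse {b : BExp} {p : Prog} {s : State} (hb : b.Ok W s) (h : ¬ b.Holds s) :
      Exec W (.loop b p) s (b.cost + 1) s

end RealRAM

/-! ### Lines and wedges in the plane -/

/-- A line in the plane: `y = m * x + c`, or `x = a`. -/
inductive Line where
  | nonvertical (m c : ℝ)
  | vertical (a : ℝ)

namespace Line

/-- The closed halfplane `ℓ⁺` above the line (right of it if the line is vertical). -/
def upper : Line → Set (ℝ × ℝ)
  | nonvertical m c => {p | m * p.1 + c ≤ p.2}
  | vertical a => {p | a ≤ p.1}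

/-- The closed halfplane `ℓ⁻` below the line (left of it if the line is vertical). -/
def lower : Line → Set (ℝ × ℝ)
  | nonvertical m c => {p | p.2 ≤ m * p.1 + c}
  | vertical a => {p | p.1 ≤ a}

/-- The slope; a vertical line has slope `-∞` (being left of a line is the limit of being below
it as its slope tends to `-∞`). -/
def slope : Line → WithBot ℝ
  | nonvertical m _ => (m : WithBot ℝ)
  | vertical _ => ⊥

end Line

/-- The two kinds of wedges considered. -/
inductive WedgeKind where
  | north
  | south

/-- A North or South wedge, given by two intersecting lines in the order of their slopes. -/
structure Wedge where
  kind : WedgeKind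
  line₁ : Line
  line₂ : Line
  slope_lt : line₁.slope < line₂.slope

namespace Wedge

/-- `North(ℓ₁, ℓ₂) = ℓ₁⁺ ∩ ℓ₂⁺` and `South(ℓ₁, ℓ₂) = ℓ₁⁻ ∩ ℓ₂⁻`. -/
def region (w : Wedge) : Set (ℝ × ℝ) :=
  match w.kind with
  | .north => w.line₁.upper ∩ w.line₂.upper
  | .south => w.line₁.lower ∩ w.line₂.lower

/-- The number of red outliers: red points in the interior of the wedge. -/
noncomputable def redOutliers (w : Wedge) (R : Finset (ℝ × ℝ)) : ℕ :=
  ((R : Set (ℝ × ℝ)) ∩ interior w.region).ncard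

/-- Among all wedges of a kind in `T` that contain all points of `B`, the wedge `w` has the
fewest red outliers. -/
def IsOptimal (T : Set WedgeKind) (B R : Finset (ℝ × ℝ)) (w : Wedge) : Prop :=
  (w.kind ∈ T ∧ (B : Set (ℝ × ℝ)) ⊆ w.region) ∧
    ∀ w' : Wedge, w'.kind ∈ T → (B : Set (ℝ × ℝ)) ⊆ w'.region →
      w.redOutliers R ≤ w'.redOutliers R

end Wedge

/-- General position of the blue and red points: `B` and `R` share no point, no two of the points
have the same `x`-coordinate or the same `y`-coordinate, and no three are collinear. -/
def InGeneralPosition (B R : Finset (ℝ × ℝ)) : Prop :=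
  Disjoint B R ∧
  Set.InjOn Prod.fst ((B : Set (ℝ × ℝ)) ∪ R) ∧
  Set.InjOn Prod.snd ((B : Set (ℝ × ℝ)) ∪ R) ∧
  ∀ p ∈ (B : Set (ℝ × ℝ)) ∪ R, ∀ q ∈ (B : Set (ℝ × ℝ)) ∪ R, ∀ r ∈ (B : Set (ℝ × ℝ)) ∪ R,
    p ≠ q → p ≠ r → q ≠ r → ¬ Collinear ℝ {p, q, r}

/-! ### Input and output -/

namespace RealRAM

/-- The input: cells `0` and `1` of word array `0` hold the numbers of blue and of red points; the
real arrays `0`, `1` hold the `x`- and `y`-coordinates of the blue points and the real arrays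
`2`, `3` those of the red points.  All other cells are `0`. -/
noncomputable def inputState (bs rs : List (ℝ × ℝ)) : State where
  word := fun a i =>
    if a = 0 ∧ i = 0 then bs.length else if a = 0 ∧ i = 1 then rs.length else 0
  real := fun a i =>
    match a with
    | 0 => (bs.getD i (0, 0)).1
    | 1 => (bs.getD i (0, 0)).2
    | 2 => (rs.getD i (0, 0)).1
    | 3 => (rs.getD i (0, 0)).2
    | _ => 0

/-- The output: cell `0` of word array `1` is `0` for a North wedge and `1` for a South wedge;
cells `0, 1, 2, 3` of real array `4` are slope and intercept of the first line and slope and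
intercept of the second line. -/
def Outputs (s : State) (w : Wedge) : Prop :=
  ((w.kind = .north ∧ s.word 1 0 = 0) ∨ (w.kind = .south ∧ s.word 1 0 = 1)) ∧
  w.line₁ = .nonvertical (s.real 4 0) (s.real 4 1) ∧
  w.line₂ = .nonvertical (s.real 4 2) (s.real 4 3)

end RealRAM

/-!
An optimal wedge is found by stabbing intervals with two points.

*Geometry.*  The reflection `p ↦ -p` turns South wedges into North wedges, keeps slopes and changes
the signs of intercepts, so North wedges are enough; and a vertical boundary line can be replaced
by a steep one that has the same blue points and no new red points on its side
(`exists_steep_line`).  For a given slope it is best to move a line up until it meets a blue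
point.  A red point `q` is then not above the tight line of slope `m` exactly if the line of slope
`m` through `q` passes below all blue points.  These `m` form an interval: its left end is the
largest slope of a line through `q` and a blue point to the left of `q`, and its right end is the
smallest slope of a line through `q` and a blue point to the right (`IsSlopeInterval`; unbounded
intervals are cut off where nothing changes any more).  A red point is not an outlier of a tight
wedge if one of the two slopes lies in its interval, so the task is to choose two slopes that stab
as many intervals as possible (`northOptimal_of_stabbed`).  If there are no blue points, then the
lines are placed above all red points instead.

*Algorithm.*  The points are sorted by their abscissae with a tournament tree (`sort`).  A sweep
from left to right maintains the lower hull of the blue points seen so far as a stack; the left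
end of the interval of a red point is found by a binary search for the tangent (`tangents`).  The
right ends are obtained in the same way from the points `(-x, y)`.  The ends of the intervals are
sorted, left ends before right ends if they are equal.  Since the number of the intervals that are
stabbed changes only at ends, both points can be chosen among the gaps of this order.  The sweep
moves the gap `p` of the first point downwards.  The intervals to the right of `p` count for the
second point; the changes of their number as the second point moves upwards (`delta`) are the
leaves of a tree that carries sums and maximal prefix sums, so that the best second point can be
read off at its root (`sweep`).  All this takes `O(n log n)` steps.

*Program logic.*  `wp W p Q s` says that the program halts with a number of steps and a final state
that satisfy `Q`; it is computed by rules for the constructors, with an amortised rule for loops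
(`wp_for`).  Which arrays a program leaves alone is read off from its text (`Frame`).
-/

/-! ### The arrays of the program -/

-- Names that start with `w` stand for word arrays, and names that start with `r` for real arrays.
-- An array of which only cell `0` is used serves as a scalar variable.

-- The input and the output, as fixed by `RealRAM.inputState` and `RealRAM.Outputs`.
notation "wIn" => 0
notation "rBlueX" => 0
notation "rBlueY" => 1
notation "rRedX" => 2
notation "rRedY" => 3
notation "wKind" => 1
notation "rWedge" => 4

-- The coordinates of all points, the blue ones before the red ones.
notation "rX" => 20
notation "rY" => 21

-- The counter of `forLoop`.
notation "wI" => 15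

-- Sorting: the number of keys, the keys, the sorted order, the current position in a complete
-- binary tree, the nodes of that tree, and its number of leaves.
notation "wCount" => 10
notation "rKey" => 10
notation "wPerm" => 11
notation "wPos" => 12
notation "wNode" => 13
notation "wSize" => 14

-- Tangents: the hull as a stack with its height, the step of the sweep and the current point, the
-- scalars of the binary search, and the slopes of the tangents, with flags that tell whether there
-- is a tangent.
notation "wStack" => 20
notation "wTop" => 21
notation "wK" => 22
notation "wJ" => 23
notation "wLo" => 24
notation "wHi" => 25
notation "wMid" => 26
notation "wFlag" => 27
notation "rTan" => 5

-- Copies of the slopes and of the flags of the left tangents, and a bound for all slopes.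
notation "wLeft" => 32
notation "rLeft" => 22
notation "rBound" => 23

-- The sweep over the ends of the intervals: the ranks of the ends, the rank of the current end,
-- the weights of the intervals, the sums, the maximal prefix sums and the ends where these are
-- reached at the nodes of the tree, the weight at the current cut, and the best value.
notation "wRank" => 30
notation "wCut" => 31
notation "rWeight" => 12
notation "rSum" => 13
notation "rMax" => 14
notation "rArg" => 15
notation "rAcc" => 16
notation "rBest" => 17

-- The resulting lines and the number of outliers.
notation "rSlope₁" => 18
notation "rSlope₂" => 19
notation "rCut₁" => 24
notation "rCut₂" => 25
notation "wOutliers" => 33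

-- The arrays, both of words and of reals, that keep the results for the two kinds of wedges.
notation "aNorth" => 40
notation "aSouth" => 41

/-! ### A weakest-precondition calculus with costs -/

namespace RealRAM

instance : Add WExp := ⟨.add⟩
instance : Sub WExp := ⟨.sub⟩
instance : Mul WExp := ⟨.mul⟩
instance : Div WExp := ⟨.div⟩
instance : Add RExp := ⟨.add⟩
instance : Sub RExp := ⟨.sub⟩
instance : Mul RExp := ⟨.mul⟩
instance : Div RExp := ⟨.div⟩

/-- A word constant. -/
def wc (k : ℕ) : WExp := .const k

/-- A rational constant. -/
def rc (q : ℚ) : RExp := .const q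

/-- Cell `i` of the `a`-th word array. -/
def wat (a : ℕ) (i : WExp) : WExp := .read a i

/-- Cell `0` of the `a`-th word array, which is used as a scalar variable. -/
def wvar (a : ℕ) : WExp := .read a (.const 0)

/-- Cell `i` of the `a`-th real array. -/
def rat (a : ℕ) (i : WExp) : RExp := .read a i

/-- Cell `0` of the `a`-th real array, which is used as a scalar variable. -/
def rvar (a : ℕ) : RExp := .read a (.const 0)

section Expressions

variable (W : ℕ) (s : State) (a k : ℕ) (i e f : WExp) (x y : RExp)

@[simp] theorem eval_wc : (wc k).eval s = k := rfl
@[simp] theorem WExp.eval_add : (e + f).eval s = e.eval s + f.eval s := rfl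
@[simp] theorem WExp.eval_sub : (e - f).eval s = e.eval s - f.eval s := rfl
@[simp] theorem WExp.eval_mul : (e * f).eval s = e.eval s * f.eval s := rfl
@[simp] theorem WExp.eval_div : (e / f).eval s = e.eval s / f.eval s := rfl
@[simp] theorem eval_wat : (wat a i).eval s = s.word a (i.eval s) := rfl
@[simp] theorem eval_wvar : (wvar a).eval s = s.word a 0 := rfl

@[simp] theorem ok_wc : (wc k).Ok W s ↔ k ≤ W := Iff.rfl
@[simp] theorem WExp.ok_add :
    (e + f).Ok W s ↔ e.Ok W s ∧ f.Ok W s ∧ e.eval s + f.eval s ≤ W := Iff.rfl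
@[simp] theorem WExp.ok_sub : (e - f).Ok W s ↔ e.Ok W s ∧ f.Ok W s := Iff.rfl
@[simp] theorem WExp.ok_mul :
    (e * f).Ok W s ↔ e.Ok W s ∧ f.Ok W s ∧ e.eval s * f.eval s ≤ W := Iff.rfl
@[simp] theorem WExp.ok_div :
    (e / f).Ok W s ↔ e.Ok W s ∧ f.Ok W s ∧ f.eval s ≠ 0 := Iff.rfl
@[simp] theorem ok_wat : (wat a i).Ok W s ↔ i.Ok W s := Iff.rfl
@[simp] theorem ok_wvar : (wvar a).Ok W s := Nat.zero_le W

@[simp] theorem cost_wc : (wc k).cost = 1 := rfl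
@[simp] theorem WExp.cost_add : (e + f).cost = e.cost + f.cost + 1 := rfl
@[simp] theorem WExp.cost_sub : (e - f).cost = e.cost + f.cost + 1 := rfl
@[simp] theorem WExp.cost_mul : (e * f).cost = e.cost + f.cost + 1 := rfl
@[simp] theorem WExp.cost_div : (e / f).cost = e.cost + f.cost + 1 := rfl
@[simp] theorem cost_wat : (wat a i).cost = i.cost + 1 := rfl
@[simp] theorem cost_wvar : (wvar a).cost = 2 := rfl

@[simp] theorem eval_rc (q : ℚ) : (rc q).eval s = q := rfl
@[simp] theorem RExp.eval_add : (x + y).eval s = x.eval s + y.eval s := rfl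
@[simp] theorem RExp.eval_sub : (x - y).eval s = x.eval s - y.eval s := rfl
@[simp] theorem RExp.eval_mul : (x * y).eval s = x.eval s * y.eval s := rfl
@[simp] theorem RExp.eval_div : (x / y).eval s = x.eval s / y.eval s := rfl
@[simp] theorem eval_rat : (rat a i).eval s = s.real a (i.eval s) := rfl
@[simp] theorem eval_rvar : (rvar a).eval s = s.real a 0 := rfl

@[simp] theorem ok_rc (q : ℚ) : (rc q).Ok W s := trivial
@[simp] theorem RExp.ok_add : (x + y).Ok W s ↔ x.Ok W s ∧ y.Ok W s := Iff.rfl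
@[simp] theorem RExp.ok_sub : (x - y).Ok W s ↔ x.Ok W s ∧ y.Ok W s := Iff.rfl
@[simp] theorem RExp.ok_mul : (x * y).Ok W s ↔ x.Ok W s ∧ y.Ok W s := Iff.rfl
@[simp] theorem RExp.ok_div :
    (x / y).Ok W s ↔ x.Ok W s ∧ y.Ok W s ∧ y.eval s ≠ 0 := Iff.rfl
@[simp] theorem ok_rat : (rat a i).Ok W s ↔ i.Ok W s := Iff.rfl
@[simp] theorem ok_rvar : (rvar a).Ok W s := Nat.zero_le W

@[simp] theorem cost_rc (q : ℚ) : (rc q).cost = 1 := rfl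
@[simp] theorem RExp.cost_add : (x + y).cost = x.cost + y.cost + 1 := rfl
@[simp] theorem RExp.cost_sub : (x - y).cost = x.cost + y.cost + 1 := rfl
@[simp] theorem RExp.cost_mul : (x * y).cost = x.cost + y.cost + 1 := rfl
@[simp] theorem RExp.cost_div : (x / y).cost = x.cost + y.cost + 1 := rfl
@[simp] theorem cost_rat : (rat a i).cost = i.cost + 1 := rfl
@[simp] theorem cost_rvar : (rvar a).cost = 2 := rfl

end Expressions

attribute [simp] BExp.Holds BExp.Ok BExp.cost

section Writes

variable (s : State) (a b i v : ℕ) (x : ℝ)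

@[simp] theorem State.writeWord_word :
    (s.writeWord a i v).word b = if b = a then Function.update (s.word a) i v else s.word b := by
  simp only [State.writeWord, Function.update_apply]

@[simp] theorem State.writeWord_real : (s.writeWord a i v).real = s.real := rfl

@[simp] theorem State.writeReal_real :
    (s.writeReal a i x).real b = if b = a then Function.update (s.real a) i x else s.real b := by
  simp only [State.writeReal, Function.update_apply]

@[simp] theorem State.writeReal_word : (s.writeReal a i x).word = s.word := rfl

end Writes

/-- The program halts when started in `s`, and the number of steps and the final state
satisfy `Q`. -/
def wp (W : ℕ) (p : Prog) (Q : ℕ → State → Prop) (s : State) : Prop :=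
  ∃ t s', Exec W p s t s' ∧ Q t s'

section Rules

variable {W : ℕ} {p q : Prog} {Q Q' : ℕ → State → Prop} {s : State} {b : BExp}

theorem wp_mono (h : wp W p Q s) (hQ : ∀ t s', Q t s' → Q' t s') : wp W p Q' s := by
  obtain ⟨t, s', h, hq⟩ := h
  exact ⟨t, s', h, hQ _ _ hq⟩

@[simp] theorem wp_skip : wp W .skip Q s ↔ Q 1 s := by
  constructor
  · rintro ⟨t, s', ⟨⟩, hq⟩
    exact hq
  · exact fun h => ⟨_, _, .skip s, h⟩

@[simp] theorem wp_setWord {a : ℕ} {i e : WExp} :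
    wp W (.setWord a i e) Q s ↔ i.Ok W s ∧ e.Ok W s ∧
      Q (i.cost + e.cost + 1) (s.writeWord a (i.eval s) (e.eval s)) := by
  constructor
  · rintro ⟨t, s', h, hq⟩
    cases h with
    | setWord hi he => exact ⟨hi, he, hq⟩
  · exact fun h => ⟨_, _, .setWord h.1 h.2.1, h.2.2⟩

@[simp] theorem wp_setReal {a : ℕ} {i : WExp} {e : RExp} :
    wp W (.setReal a i e) Q s ↔ i.Ok W s ∧ e.Ok W s ∧
      Q (i.cost + e.cost + 1) (s.writeReal a (i.eval s) (e.eval s)) := by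
  constructor
  · rintro ⟨t, s', h, hq⟩
    cases h with
    | setReal hi he => exact ⟨hi, he, hq⟩
  · exact fun h => ⟨_, _, .setReal h.1 h.2.1, h.2.2⟩

@[simp] theorem wp_seq :
    wp W (.seq p q) Q s ↔ wp W p (fun t s' => wp W q (fun u s'' => Q (t + u) s'') s') s := by
  constructor
  · rintro ⟨t, s', h, hq⟩
    cases h with
    | seq hp hq' => exact ⟨_, _, hp, _, _, hq', hq⟩
  · rintro ⟨t, s', h, u, s'', h', hq⟩
    exact ⟨_, _, .seq h h', hq⟩

@[simp] theorem wp_branch :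
    wp W (.branch b p q) Q s ↔ b.Ok W s ∧
      (b.Holds s → wp W p (fun t s' => Q (b.cost + 1 + t) s') s) ∧
      (¬ b.Holds s → wp W q (fun t s' => Q (b.cost + 1 + t) s') s) := by
  constructor
  · rintro ⟨t, s', h, hq⟩
    cases h with
    | branchTrue hb h hp => exact ⟨hb, fun _ => ⟨_, _, hp, hq⟩, fun h' => absurd h h'⟩
    | branchFalse hb h hp => exact ⟨hb, fun h' => absurd h' h, fun _ => ⟨_, _, hp, hq⟩⟩
  · rintro ⟨hb, h1, h2⟩
    by_cases h : b.Holds s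
    · obtain ⟨t, s', hp, hq⟩ := h1 h
      exact ⟨_, _, .branchTrue hb h hp, hq⟩
    · obtain ⟨t, s', hp, hq⟩ := h2 h
      exact ⟨_, _, .branchFalse hb h hp, hq⟩

/-- The loop rule.  `I c s` is the loop invariant together with a budget `c` for the steps that
remain, except for the last evaluation of the test; so `c` serves also as the variant. -/
theorem wp_loop (I : ℕ → State → Prop)
    (h : ∀ c s, I c s → b.Ok W s ∧ (b.Holds s →
      wp W p (fun t s' => ∃ c', b.cost + 1 + t + c' ≤ c ∧ I c' s') s)) (c : ℕ) (hI : I c s) :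
    wp W (.loop b p)
      (fun t s' => (∃ c', t + c' ≤ c + (b.cost + 1) ∧ I c' s') ∧ ¬ b.Holds s') s := by
  induction c using Nat.strong_induction_on generalizing s with
  | _ c ih =>
    obtain ⟨hok, hstep⟩ := h c s hI
    by_cases hb : b.Holds s
    · obtain ⟨t, s', hp, c', hc, hI'⟩ := hstep hb
      obtain ⟨u, s'', hl, ⟨d, hu, hd⟩, hq⟩ := ih c' (by omega) hI'
      exact ⟨_, _, .loopTrue hok hb hp hl, ⟨d, by omega, hd⟩, hq⟩
    · exact ⟨_, _, .loopFalse hok hb, ⟨c, by omega, hI⟩, hb⟩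

end Rules

namespace Prog

/-- Whether the program contains an assignment to the `a`-th word array. -/
def setsWord (a : ℕ) : Prog → Bool
  | skip => false
  | setWord b _ _ => decide (a = b)
  | setReal _ _ _ => false
  | seq p q => p.setsWord a || q.setsWord a
  | branch _ p q => p.setsWord a || q.setsWord a
  | loop _ p => p.setsWord a

/-- Whether the program contains an assignment to the `a`-th real array. -/
def setsReal (a : ℕ) : Prog → Bool
  | skip => false
  | setWord _ _ _ => false
  | setReal b _ _ => decide (a = b)
  | seq p q => p.setsReal a || q.setsReal a
  | branch _ p q => p.setsReal a || q.setsReal a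
  | loop _ p => p.setsReal a

end Prog

theorem Exec.word_eq {W : ℕ} {p : Prog} {s s' : State} {t : ℕ} (h : Exec W p s t s') (a : ℕ)
    (ha : p.setsWord a = false) : s'.word a = s.word a := by
  induction h with
  | skip | setReal | loopFalse => rfl
  | setWord => simp_all [Prog.setsWord]
  | seq _ _ ih1 ih2 =>
    simp only [Prog.setsWord, Bool.or_eq_false_iff] at ha
    rw [ih2 ha.2, ih1 ha.1]
  | branchTrue _ _ _ ih =>
    simp only [Prog.setsWord, Bool.or_eq_false_iff] at ha
    exact ih ha.1
  | branchFalse _ _ _ ih =>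
    simp only [Prog.setsWord, Bool.or_eq_false_iff] at ha
    exact ih ha.2
  | loopTrue _ _ _ _ ih1 ih2 => rw [ih2 ha, ih1 ha]

theorem Exec.real_eq {W : ℕ} {p : Prog} {s s' : State} {t : ℕ} (h : Exec W p s t s') (a : ℕ)
    (ha : p.setsReal a = false) : s'.real a = s.real a := by
  induction h with
  | skip | setWord | loopFalse => rfl
  | setReal => simp_all [Prog.setsReal]
  | seq _ _ ih1 ih2 =>
    simp only [Prog.setsReal, Bool.or_eq_false_iff] at ha
    rw [ih2 ha.2, ih1 ha.1]
  | branchTrue _ _ _ ih =>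
    simp only [Prog.setsReal, Bool.or_eq_false_iff] at ha
    exact ih ha.1
  | branchFalse _ _ _ ih =>
    simp only [Prog.setsReal, Bool.or_eq_false_iff] at ha
    exact ih ha.2
  | loopTrue _ _ _ _ ih1 ih2 => rw [ih2 ha, ih1 ha]

/-- The arrays which the text of `p` does not assign to agree in the two states. -/
def Frame (p : Prog) (s s' : State) : Prop :=
  (∀ a, p.setsWord a = false → s'.word a = s.word a) ∧
    ∀ a, p.setsReal a = false → s'.real a = s.real a

theorem wp_frame {W : ℕ} {p : Prog} {Q : ℕ → State → Prop} {s : State} (h : wp W p Q s) :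
    wp W p (fun t s' => Q t s' ∧ Frame p s s') s := by
  obtain ⟨t, s', h, hq⟩ := h
  exact ⟨t, s', h, hq, h.word_eq, h.real_eq⟩

/-- The consequence rule, with the frame condition available for the new postcondition. -/
theorem wp_use {W : ℕ} {p : Prog} {Q Q' : ℕ → State → Prop} {s : State} (h : wp W p Q s)
    (hQ : ∀ t s', Q t s' → Frame p s s' → Q' t s') : wp W p Q' s :=
  wp_mono (wp_frame h) fun t s' h => hQ t s' h.1 h.2

/-- `for i := 0 to n - 1 do p`, where the variable `i` is a scalar. -/
def forLoop (i : ℕ) (n : WExp) (p : Prog) : Prog :=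
  .seq (.setWord i (wc 0) (wc 0))
    (.loop (.wlt (wvar i) n) (.seq p (.setWord i (wc 0) (wvar i + wc 1))))

/-- The rule for `forLoop`, with amortised costs: `K` bounds the cost of a round up to the change
of the potential `φ`. -/
theorem wp_for {W i n : ℕ} {m : WExp} {p : Prog} {s : State} (I : ℕ → State → Prop)
    (φ : State → ℕ) (K : ℕ) (hW : n < W) (hp : p.setsWord i = false)
    (h0 : I 0 (s.writeWord i 0 0)) (hφ : φ (s.writeWord i 0 0) = 0)
    (hm : ∀ k s, k ≤ n → I k s → m.Ok W s ∧ m.eval s = n)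
    (step : ∀ k s, k < n → I k s → s.word i 0 = k →
      wp W p (fun t s' => t + φ (s'.writeWord i 0 (k + 1)) ≤ K + φ s ∧
        I (k + 1) (s'.writeWord i 0 (k + 1))) s) :
    wp W (forLoop i m p)
      (fun t s' => t ≤ n * (K + m.cost + 10) + m.cost + 10 ∧ I n s') s := by
  simp only [forLoop, wp_seq, wp_setWord, ok_wc, eval_wc, cost_wc]
  refine ⟨by omega, by omega, ?_⟩
  have key := wp_loop (W := W) (b := .wlt (wvar i) m)
    (p := .seq p (.setWord i (wc 0) (wvar i + wc 1))) (s := s.writeWord i 0 0)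
    (fun c s => ∃ k, k ≤ n ∧ I k s ∧ s.word i 0 = k ∧
      c = (n - k) * (K + m.cost + 10) + φ s) ?_ (n * (K + m.cost + 10))
    ⟨0, Nat.zero_le _, h0, by simp, by simp [hφ]⟩
  · refine wp_mono key ?_
    rintro t s' ⟨⟨c, ht, k, hk, hI, hik, -⟩, hb⟩
    have := (hm k s' hk hI).2
    simp only [BExp.Holds, eval_wvar] at hb
    simp only [BExp.cost, cost_wvar] at ht
    obtain rfl : k = n := by omega
    exact ⟨by omega, hI⟩
  · rintro c s ⟨k, hk, hI, hik, rfl⟩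
    obtain ⟨hok, hev⟩ := hm k s hk hI
    refine ⟨⟨by simp, hok⟩, fun hb => ?_⟩
    simp only [BExp.Holds, eval_wvar, hev, hik] at hb
    rw [wp_seq]
    refine wp_use (step k s hb hI hik) ?_
    rintro t s' ⟨ht, hI'⟩ hf
    have hi' : s'.word i 0 = k := by rw [hf.1 i hp, hik]
    simp only [wp_setWord, ok_wc, WExp.ok_add, ok_wvar, eval_wvar, eval_wc,
      WExp.eval_add, hi', cost_wvar, cost_wc, WExp.cost_add, BExp.cost]
    refine ⟨by omega, ⟨trivial, by omega, by omega⟩, _, ?_, k + 1, hb, hI', by simp, rfl⟩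
    obtain ⟨d, rfl⟩ : ∃ d, n = k + 1 + d := ⟨n - (k + 1), by omega⟩
    have e1 : k + 1 + d - k = d + 1 := by omega
    have e2 : k + 1 + d - (k + 1) = d := by omega
    rw [e1, e2, add_one_mul]
    omega

/-! ### Complete binary trees in arrays -/

/-- The inner nodes of the complete binary tree with root `1`, inner nodes `1, …, N - 1` and
leaves `N, …, 2 * N - 1` carry the combination of the values of their children, with the possible
exception of the proper ancestors of the node `z`. -/
def TreeOk {V : Type*} (N : ℕ) (op : V → V → V) (val : ℕ → V) (z : ℕ) : Prop :=
  ∀ i, 1 ≤ i → i < N → val i = op (val (2 * i)) (val (2 * i + 1)) ∨ ∃ k, 1 ≤ k ∧ i = z / 2 ^ k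

section Tree

variable {V : Type*} {N : ℕ} {op : V → V → V} {val val' : ℕ → V} {z : ℕ}

theorem TreeOk.climb (h : TreeOk N op val z) :
    TreeOk N op (Function.update val (z / 2)
      (op (val (2 * (z / 2))) (val (2 * (z / 2) + 1)))) (z / 2) := by
  intro i h1 hN
  by_cases hi : i = z / 2
  · left
    rw [hi, Function.update_self, Function.update_of_ne (by omega),
      Function.update_of_ne (by omega)]
  · by_cases hc : 2 * i = z / 2 ∨ 2 * i + 1 = z / 2
    · exact Or.inr ⟨1, le_rfl, by omega⟩
    · rcases h i h1 hN with h | ⟨k, hk, h⟩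
      · left
        rw [Function.update_of_ne hi, Function.update_of_ne (by omega),
          Function.update_of_ne (by omega), h]
      · right
        obtain ⟨k, rfl⟩ : ∃ k', k = k' + 1 := ⟨k - 1, by omega⟩
        have h' : i = z / 2 / 2 ^ k := by rw [h, pow_succ', Nat.div_div_eq_div_mul]
        refine ⟨k, ?_, h'⟩
        rcases Nat.eq_zero_or_pos k with rfl | hk'
        · exact absurd (by simpa using h') hi
        · exact hk'

theorem TreeOk.root (h : TreeOk N op val 1) {i : ℕ} (h1 : 1 ≤ i) (hN : i < N) :
    val i = op (val (2 * i)) (val (2 * i + 1)) := by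
  rcases h i h1 hN with h | ⟨k, hk, h⟩
  · exact h
  · rw [Nat.div_eq_of_lt (Nat.one_lt_two_pow (by omega))] at h
    omega

/-- Changing a leaf violates the tree condition at most at the ancestors of that leaf. -/
theorem TreeOk.set_leaf (h : TreeOk N op val 1) {p : ℕ}
    (hval : ∀ i, i ≠ N + p → val' i = val i) : TreeOk N op val' (N + p) := by
  intro i h1 hN
  by_cases hc : 2 * i = N + p ∨ 2 * i + 1 = N + p
  · exact Or.inr ⟨1, le_rfl, by omega⟩
  · left
    rw [hval i (by omega), hval (2 * i) (by omega), hval (2 * i + 1) (by omega)]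
    exact h.root h1 hN

/-- The value at the root represents the row of all leaves, for any notion `Rep a b v` of `v`
representing the leaves `a, …, b - 1` that is compatible with the combination. -/
theorem TreeOk.rep_root {H : ℕ} (h : TreeOk (2 ^ H) op val 1) (Rep : ℕ → ℕ → V → Prop)
    (hleaf : ∀ i < 2 ^ H, Rep i (i + 1) (val (2 ^ H + i)))
    (hop : ∀ a b c v w, a ≤ b → b ≤ c → Rep a b v → Rep b c w → Rep a c (op v w)) :
    Rep 0 (2 ^ H) (val 1) := by
  have key : ∀ d ≤ H, ∀ i < 2 ^ (H - d),
      Rep (i * 2 ^ d) ((i + 1) * 2 ^ d) (val (2 ^ (H - d) + i)) := by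
    intro d
    induction d with
    | zero => intro _ i hi; simpa using hleaf i hi
    | succ d ih =>
      intro hd i hi
      have e : 2 ^ (H - d) = 2 * 2 ^ (H - (d + 1)) := by
        rw [← pow_succ']
        congr 1
        omega
      have hlt : 2 ^ (H - (d + 1)) + i < 2 ^ H := by
        have : 2 ^ (H - d) ≤ 2 ^ H := Nat.pow_le_pow_right (by norm_num) (by omega)
        omega
      have hpos : 1 ≤ 2 ^ (H - (d + 1)) := Nat.one_le_two_pow
      rw [h.root (by omega) hlt]
      have h1 := ih (by omega) (2 * i) (by omega)
      have h2 := ih (by omega) (2 * i + 1) (by omega)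
      rw [e] at h1 h2
      have := hop _ _ _ _ _ (by gcongr; omega) (by gcongr; omega) h1 h2
      rw [show 2 * i * 2 ^ d = i * 2 ^ (d + 1) by ring,
        show (2 * i + 1 + 1) * 2 ^ d = (i + 1) * 2 ^ (d + 1) by ring] at this
      convert this using 3 <;> ring
  simpa using key H le_rfl 0 (by simp)

end Tree

/-- Recompute, by `C`, the proper ancestors of the tree node `wPos`, going up to the root. -/
def climb (C : Prog) : Prog :=
  .loop (.wlt (wc 1) (wvar wPos)) (.seq (.setWord wPos (wc 0) (wvar wPos / wc 2)) C)

/-- The specification of `climb`, for an abstract reading `val` of the nodes of the tree and a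
condition `ctx` that `C` preserves.  The tree condition, violated at most at the proper ancestors
of the start node, holds everywhere in the end; leaves do not change. -/
theorem climb_spec {V : Type*} {W H K : ℕ} {C : Prog} (val : State → ℕ → V) (op : V → V → V)
    (ctx : State → Prop) (hW : 2 ≤ W)
    (hctx : ∀ s v, ctx s → ctx (s.writeWord wPos 0 v))
    (hval : ∀ s v, val (s.writeWord wPos 0 v) = val s)
    (hC : ∀ s, ctx s → 1 ≤ s.word wPos 0 → s.word wPos 0 < 2 ^ H →
      wp W C (fun t s' => t ≤ K ∧ ctx s' ∧ s'.word wPos 0 = s.word wPos 0 ∧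
        val s' = Function.update (val s) (s.word wPos 0)
          (op (val s (2 * s.word wPos 0)) (val s (2 * s.word wPos 0 + 1)))) s)
    {s : State} (hs : ctx s) (h1 : 1 ≤ s.word wPos 0) (hz : s.word wPos 0 < 2 ^ (H + 1))
    (hok : TreeOk (2 ^ H) op (val s) (s.word wPos 0)) :
    wp W (climb C) (fun t s' => t ≤ H * (K + 20) + 10 ∧ ctx s' ∧
      TreeOk (2 ^ H) op (val s') 1 ∧ ∀ i, 2 ^ H ≤ i → val s' i = val s i) s := by
  have key := wp_loop (W := W) (b := .wlt (wc 1) (wvar wPos))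
    (p := .seq (.setWord wPos (wc 0) (wvar wPos / wc 2)) C) (s := s)
    (fun c s' => ∃ d ≤ H, c = d * (K + 20) ∧ ctx s' ∧ 1 ≤ s'.word wPos 0 ∧
      s'.word wPos 0 < 2 ^ (d + 1) ∧ TreeOk (2 ^ H) op (val s') (s'.word wPos 0) ∧
      ∀ i, 2 ^ H ≤ i → val s' i = val s i) ?_ (H * (K + 20))
    ⟨H, le_rfl, rfl, hs, h1, hz, hok, fun _ _ => rfl⟩
  · refine wp_mono key ?_
    rintro t s' ⟨⟨c, ht, d, hd, -, hc, h1', -, hok', hl⟩, hb⟩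
    simp only [BExp.Holds, eval_wc, eval_wvar, not_lt] at hb
    simp only [BExp.cost, cost_wc, cost_wvar] at ht
    rw [show s'.word wPos 0 = 1 by omega] at hok'
    exact ⟨by omega, hc, hok', hl⟩
  · rintro c s' ⟨d, hd, rfl, hc, h1', hz', hok', hl⟩
    refine ⟨by simp; omega, fun hb => ?_⟩
    simp only [BExp.Holds, eval_wc, eval_wvar] at hb
    have hd0 : d ≠ 0 := by
      rintro rfl
      norm_num at hz'
      omega
    obtain ⟨d, rfl⟩ : ∃ e, d = e + 1 := ⟨d - 1, by omega⟩
    have hz2 : s'.word wPos 0 / 2 < 2 ^ (d + 1) := by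
      rw [pow_succ 2 (d + 1)] at hz'
      omega
    have hH : 2 ^ (d + 1) ≤ 2 ^ H := Nat.pow_le_pow_right (by norm_num) hd
    simp only [wp_seq, wp_setWord, ok_wc, WExp.ok_div, ok_wvar, eval_wc, WExp.eval_div, eval_wvar,
      cost_wc, WExp.cost_div, cost_wvar, BExp.cost]
    refine ⟨by omega, ⟨trivial, hW, by norm_num⟩, ?_⟩
    have hw : (s'.writeWord wPos 0 (s'.word wPos 0 / 2)).word wPos 0 = s'.word wPos 0 / 2 := by
      simp
    refine wp_mono (hC _ (hctx _ _ hc) (by rw [hw]; omega) (by rw [hw]; omega)) ?_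
    rintro t s'' ⟨ht, hc'', hp, hv⟩
    rw [hw] at hp hv
    rw [hval] at hv
    refine ⟨d * (K + 20), by rw [add_one_mul]; omega, d, by omega, rfl, hc'',
      by omega, by omega, ?_, ?_⟩
    · rw [hp, hv]
      exact hok'.climb
    · intro i hi
      rw [hv, Function.update_of_ne (by omega), hl i hi]

/-! ### Sorting by a tournament -/

/-- The strict order of the indices by their keys; indices with equal keys are ordered by size. -/
def LexLt (key : ℕ → ℝ) (i j : ℕ) : Prop := key i < key j ∨ key i = key j ∧ i < j

/-- `p 0, …, p (n - 1)` are the indices `0, …, n - 1` in increasing order. -/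
structure IsSorting (key : ℕ → ℝ) (n : ℕ) (p : ℕ → ℕ) : Prop where
  lt : ∀ i < n, p i < n
  lexLt : ∀ i j, i < j → j < n → LexLt key (p i) (p j)

/-- The winner of two players of a tournament.  The player `i` is encoded by `i + 1`, and `0`
encodes the absence of a player. -/
noncomputable def winner (key : ℕ → ℝ) (a b : ℕ) : ℕ :=
  open Classical in if a = 0 ∨ b ≠ 0 ∧ key (b - 1) < key (a - 1) then b else a

/-- `v` is the winner among the players in `S` with numbers from `a` up to `b - 1`. -/
def Wins (key : ℕ → ℝ) (S : ℕ → Prop) (a b v : ℕ) : Prop :=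
  (v = 0 ∧ ∀ i, a ≤ i → i < b → ¬ S i) ∨
    ∃ i, v = i + 1 ∧ a ≤ i ∧ i < b ∧ S i ∧ ∀ j, a ≤ j → j < b → S j → i ≠ j → LexLt key i j

theorem Wins.combine {key : ℕ → ℝ} {S : ℕ → Prop} {a b c v w : ℕ} (hab : a ≤ b) (hbc : b ≤ c)
    (hv : Wins key S a b v) (hw : Wins key S b c w) : Wins key S a c (winner key v w) := by
  unfold winner
  rcases hv with ⟨rfl, h0⟩ | ⟨i, rfl, hi1, hi2, hS, hi⟩
  · simp only [true_or, if_true]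
    rcases hw with ⟨rfl, h0'⟩ | ⟨j, rfl, hj1, hj2, hS, hj⟩
    · refine Or.inl ⟨rfl, fun k h1 h2 => ?_⟩
      rcases lt_or_ge k b with h | h
      · exact h0 k h1 h
      · exact h0' k h h2
    · refine Or.inr ⟨j, rfl, by omega, hj2, hS, fun k h1 h2 hk hne => ?_⟩
      rcases lt_or_ge k b with h | h
      · exact absurd hk (h0 k h1 h)
      · exact hj k h h2 hk hne
  · rcases hw with ⟨rfl, h0'⟩ | ⟨j, rfl, hj1, hj2, hS', hj⟩
    · simp only [Nat.add_eq_zero_iff, one_ne_zero, and_false, ne_eq, not_true_eq_false, false_and,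
        or_self, if_false]
      refine Or.inr ⟨i, rfl, hi1, by omega, hS, fun k h1 h2 hk hne => ?_⟩
      rcases lt_or_ge k b with h | h
      · exact hi k h1 h hk hne
      · exact absurd hk (h0' k h h2)
    · simp only [Nat.add_eq_zero_iff, one_ne_zero, and_false, ne_eq, not_false_eq_true, true_and,
        false_or, Nat.add_sub_cancel]
      unfold LexLt at *
      split_ifs with hlt
      · refine Or.inr ⟨j, rfl, by omega, hj2, hS', fun k h1 h2 hk hne => ?_⟩
        rcases lt_or_ge k b with h | h
        · left
          by_cases hik : i = k
          · rwa [← hik]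
          · rcases hi k h1 h hk hik with h' | h' <;> linarith
        · exact hj k h h2 hk hne
      · refine Or.inr ⟨i, rfl, hi1, by omega, hS, fun k h1 h2 hk hne => ?_⟩
        rcases lt_or_ge k b with h | h
        · exact hi k h1 h hk hne
        · have hle : key i ≤ key k := by
            by_cases hjk : j = k
            · rw [← hjk]
              exact not_lt.1 hlt
            · rcases hj k h h2 hk hjk with h' | h' <;> linarith
          rcases hle.lt_or_eq with h' | h'
          · exact Or.inl h'
          · exact Or.inr ⟨h', by omega⟩

/-- Play the match at the tree node `wPos`. -/
def playMatch : Prog :=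
  .branch (.or (.weq (wat wNode (wc 2 * wvar wPos)) (wc 0))
      (.and (.not (.weq (wat wNode (wc 2 * wvar wPos + wc 1)) (wc 0)))
        (.rlt (rat rKey (wat wNode (wc 2 * wvar wPos + wc 1) - wc 1))
          (rat rKey (wat wNode (wc 2 * wvar wPos) - wc 1)))))
    (.setWord wNode (wvar wPos) (wat wNode (wc 2 * wvar wPos + wc 1)))
    (.setWord wNode (wvar wPos) (wat wNode (wc 2 * wvar wPos)))

theorem playMatch_spec {W : ℕ} {key : ℕ → ℝ} {s : State} (hkey : s.real rKey = key)
    (hW : 2 * s.word wPos 0 + 2 ≤ W) :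
    wp W playMatch (fun t s' => t ≤ 80 ∧ s'.real rKey = key ∧ s'.word wPos 0 = s.word wPos 0 ∧
      s'.word wNode = Function.update (s.word wNode) (s.word wPos 0)
        (winner key (s.word wNode (2 * s.word wPos 0))
          (s.word wNode (2 * s.word wPos 0 + 1)))) s := by
  have hW2 : 2 ≤ W := by omega
  have hW3 : 2 * s.word wPos 0 ≤ W := by omega
  have hW4 : 2 * s.word wPos 0 + 1 ≤ W := by omega
  have hW5 : 1 ≤ W := by omega
  simp only [playMatch, wp_branch, BExp.Ok, BExp.Holds, BExp.cost]
  refine ⟨by simp [hW2, hW3, hW4, hW5], fun hb => ?_, fun hb => ?_⟩ <;>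
  · rw [winner]
    simp [hkey] at hb
    simp [hW2, hW3, hW4, hW5, hkey, hb]
    try { rw [if_neg]; push Not; exact hb.2 }

/-- Compute the least power of two that is at least `wCount`. -/
def computeSize : Prog :=
  .seq (.setWord wSize (wc 0) (wc 1))
    (.loop (.wlt (wvar wSize) (wvar wCount))
      (.setWord wSize (wc 0) (wc 2 * wvar wSize)))

theorem computeSize_spec {W n : ℕ} {s : State} (hn : s.word wCount 0 = n)
    (hW : 2 * n + 2 ≤ W) :
    wp W computeSize (fun t s' => t ≤ 20 * n + 20 ∧
      ∃ H, s'.word wSize 0 = 2 ^ H ∧ n ≤ 2 ^ H ∧ 2 ^ H ≤ 2 * n + 1) s := by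
  simp only [computeSize, wp_seq, wp_setWord]
  refine ⟨by simp, by simp; omega, ?_⟩
  have key := wp_loop (W := W) (b := .wlt (wvar wSize) (wvar wCount))
    (p := .setWord wSize (wc 0) (wc 2 * wvar wSize))
    (s := s.writeWord wSize 0 1)
    (fun c s' => ∃ H, s'.word wCount 0 = n ∧ s'.word wSize 0 = 2 ^ H ∧ 2 ^ H ≤ 2 * n + 1 ∧
      c = 20 * (n - 2 ^ H)) ?_ (20 * (n - 1)) ⟨0, by simpa using hn, by simp, by simp, by simp⟩
  · refine wp_mono key ?_
    rintro t s' ⟨⟨c, ht, H, h1, h2, h3, -⟩, hb⟩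
    simp [h1, h2] at hb ht
    refine ⟨?_, H, h2, hb, h3⟩
    simp
    omega
  · rintro c s' ⟨H, h1, h2, h3, rfl⟩
    refine ⟨by simp, fun hb => ?_⟩
    simp only [BExp.Holds, eval_wvar, h1, h2] at hb
    have : 1 ≤ 2 ^ H := Nat.one_le_two_pow
    have e : 2 ^ (H + 1) = 2 * 2 ^ H := pow_succ' _ _
    simp [h1, h2]
    exact ⟨by omega, H + 1, by omega, e.symm, by omega⟩

/-- Sort the indices below `wCount` by the keys `rKey` into `wPerm`: a knock-out tournament whose
winner is taken out repeatedly. -/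
def sort : Prog :=
  .seq computeSize <|
  .seq (forLoop wI (wc 2 * wvar wSize) (.setWord wNode (wvar wI) (wc 0))) <|
  .seq (forLoop wI (wvar wCount) <|
    .seq (.setWord wPos (wc 0) (wvar wSize + wvar wI)) <|
    .seq (.setWord wNode (wvar wPos) (wvar wI + wc 1)) <|
    climb playMatch) <|
  forLoop wI (wvar wCount) <|
    .seq (.setWord wPerm (wvar wI) (wat wNode (wc 1) - wc 1)) <|
    .seq (.setWord wPos (wc 0) (wvar wSize + wat wPerm (wvar wI))) <|
    .seq (.setWord wNode (wvar wPos) (wc 0)) <|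
    climb playMatch

/-- The state of the tournament with the players in `S`. -/
structure Tournament (key : ℕ → ℝ) (n H : ℕ) (S : ℕ → Prop) (s : State) : Prop where
  key_eq : s.real rKey = key
  count : s.word wCount 0 = n
  size : s.word wSize 0 = 2 ^ H
  tree : TreeOk (2 ^ H) (winner key) (s.word wNode) 1
  present : ∀ i < 2 ^ H, S i → s.word wNode (2 ^ H + i) = i + 1
  absent : ∀ i < 2 ^ H, ¬ S i → s.word wNode (2 ^ H + i) = 0

theorem Tournament.root {key : ℕ → ℝ} {n H : ℕ} {S : ℕ → Prop} {s : State}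
    (h : Tournament key n H S s) : Wins key S 0 (2 ^ H) (s.word wNode 1) := by
  refine h.tree.rep_root (Wins key S) (fun i hi => ?_)
    fun a b c v w hab hbc hv hw => hv.combine hab hbc hw
  by_cases hS : S i
  · exact Or.inr ⟨i, h.present i hi hS, le_rfl, by omega, hS, fun j _ _ _ _ => by omega⟩
  · refine Or.inl ⟨h.absent i hi hS, fun j _ _ => ?_⟩
    rwa [show j = i by omega]

theorem playMatch_climb {W H : ℕ} {key : ℕ → ℝ} {s : State} (hW : 2 ^ (H + 1) + 2 ≤ W)
    (hs : s.real rKey = key) (h1 : 1 ≤ s.word wPos 0) (hz : s.word wPos 0 < 2 ^ (H + 1))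
    (hok : TreeOk (2 ^ H) (winner key) (s.word wNode) (s.word wPos 0)) :
    wp W (climb playMatch) (fun t s' => t ≤ H * 100 + 10 ∧ s'.real rKey = key ∧
      TreeOk (2 ^ H) (winner key) (s'.word wNode) 1 ∧
      ∀ i, 2 ^ H ≤ i → s'.word wNode i = s.word wNode i) s := by
  have e : 2 ^ (H + 1) = 2 * 2 ^ H := pow_succ' _ _
  exact climb_spec (fun s => s.word wNode) (winner key) (fun s => s.real rKey = key) (by omega)
    (fun s v h => by simpa using h) (fun s v => by simp)
    (fun s hs h1 h2 => playMatch_spec hs (by omega)) hs h1 hz hok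

/-- The tournament after the leaf of player `i` has been rewritten and the matches have been
replayed up to the root. -/
theorem Tournament.update {W n H i : ℕ} {key : ℕ → ℝ} {S S' : ℕ → Prop} {s₀ s : State}
    (h : Tournament key n H S s₀) (hW : 2 ^ (H + 1) + 2 ≤ W) (hi : i < 2 ^ H)
    (hkey : s.real rKey = s₀.real rKey) (hcount : s.word wCount = s₀.word wCount)
    (hsize : s.word wSize = s₀.word wSize) (hpos : s.word wPos 0 = 2 ^ H + i)
    (hnode : ∀ j, j ≠ 2 ^ H + i → s.word wNode j = s₀.word wNode j)
    (hS : ∀ j, j ≠ i → (S' j ↔ S j)) (hp : S' i → s.word wNode (2 ^ H + i) = i + 1)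
    (ha : ¬ S' i → s.word wNode (2 ^ H + i) = 0) :
    wp W (climb playMatch) (fun t s' => t ≤ H * 100 + 10 ∧ Tournament key n H S' s') s := by
  have e : 2 ^ (H + 1) = 2 * 2 ^ H := pow_succ' _ _
  have e1 : 1 ≤ 2 ^ H := Nat.one_le_two_pow
  refine wp_use (playMatch_climb hW (hkey.trans h.key_eq) (by omega) (by omega)
    (by rw [hpos]; exact h.tree.set_leaf hnode)) ?_
  rintro t s' ⟨ht, hk, htree, hleaf⟩ hf
  refine ⟨ht, hk, ?_, ?_, htree, fun j hj hSj => ?_, fun j hj hSj => ?_⟩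
  · rw [hf.1 wCount rfl, hcount, h.count]
  · rw [hf.1 wSize rfl, hsize, h.size]
  · rw [hleaf _ (by omega)]
    by_cases hji : j = i
    · subst hji
      exact hp hSj
    · rw [hnode _ (by omega)]
      exact h.present j hj ((hS j hji).1 hSj)
  · rw [hleaf _ (by omega)]
    by_cases hji : j = i
    · subst hji
      exact ha hSj
    · rw [hnode _ (by omega)]
      exact h.absent j hj fun h' => hSj ((hS j hji).2 h')

/-- The number `l` bounds the height of the tree, and is logarithmic in `n` when it is chosen
least. -/
theorem sort_spec {W n l : ℕ} {key : ℕ → ℝ} {s : State} (hkey : s.real rKey = key)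
    (hn : s.word wCount 0 = n) (hW : 4 * n + 4 < W) (hl : 2 * n + 1 < 2 ^ l) :
    wp W sort (fun t s' => t ≤ 1000 * ((n + 1) * (l + 1)) ∧ IsSorting key n (s'.word wPerm) ∧
      ∃ H, s'.word wSize 0 = 2 ^ H ∧ n ≤ 2 ^ H ∧ 2 ^ H ≤ 2 * n + 1) s := by
  unfold sort
  simp only [wp_seq]
  refine wp_use (computeSize_spec hn (by omega)) ?_
  rintro t1 s1 ⟨ht1, H, hH, hnH, hHn⟩ hf1
  have e : 2 ^ (H + 1) = 2 * 2 ^ H := pow_succ' _ _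
  have hHl : H < l := (Nat.pow_lt_pow_iff_right (by norm_num : 1 < 2)).1 (by omega)
  have hk1 : s1.real rKey = key := by rw [hf1.2 rKey rfl, hkey]
  have hn1 : s1.word wCount 0 = n := by rw [hf1.1 wCount rfl, hn]
  -- All leaves and inner nodes are cleared.
  refine wp_use (wp_for (n := 2 * 2 ^ H) (fun k s => s.word wSize 0 = 2 ^ H ∧
    ∀ i < k, s.word wNode i = 0) (fun _ => 0) 10 (by omega) rfl ?_ rfl ?_ ?_) ?_
  · exact ⟨by simpa using hH, by simp⟩
  · rintro k s hk ⟨h1, h2⟩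
    simp [h1]
    omega
  · rintro k s hk ⟨h1, h2⟩ hi
    simp [h1, hi]
    intro i hik
    rw [Function.update_apply]
    split_ifs
    · rfl
    · exact h2 i (by omega)
  rintro t2 s2 ⟨ht2, hH2, hz2⟩ hf2
  simp at ht2
  -- The players enter one by one.
  refine wp_use (wp_for (n := n) (fun k s => Tournament key n H (fun i => i < k) s)
    (fun _ => 0) (H * 100 + 30) (by omega) rfl ?_ rfl ?_ ?_) ?_
  · refine ⟨?_, ?_, by simpa using hH2, ?_, by simp, ?_⟩
    · simp [hf2.2 rKey rfl, hk1]
    · simp [hf2.1 wCount rfl, hn1]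
    · intro i h1 h2
      left
      simp [hz2 i (by omega), hz2 (2 * i) (by omega), hz2 (2 * i + 1) (by omega), winner]
    · intro i hi _
      simp [hz2 (2 ^ H + i) (by omega)]
  · rintro k s hk h
    simp [h.count]
  · rintro k s hk h hi
    have := h.size
    simp only [wp_seq, wp_setWord]
    refine ⟨by simp, by simp; omega, by simp, by simp; omega, ?_⟩
    refine wp_mono (h.update (S' := fun i => i < k + 1) (i := k) (by omega) (by omega)
      ?_ ?_ ?_ ?_ ?_ ?_ ?_ ?_) ?_
    · simp
    · simp
    · simp
    · simp [h.size, hi]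
    · intro j hj
      simp [h.size, hi, hj]
    · intro j hj
      omega
    · intro _
      simp [h.size, hi]
    · omega
    · rintro t s' ⟨ht, h'⟩
      refine ⟨by simp; omega, ?_⟩
      exact ⟨by simpa using h'.key_eq, by simpa using h'.count, by simpa using h'.size,
        by simpa using h'.tree, by simpa using h'.present, by simpa using h'.absent⟩
  rintro t3 s3 ⟨ht3, h3⟩ hf3
  simp at ht3
  -- The winners leave one by one; each winner precedes all players that have not left before.
  refine wp_use (wp_for (n := n) (fun k s =>
      Tournament key n H (fun i => i < n ∧ ∀ j < k, s.word wPerm j ≠ i) s ∧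
      (∀ i < k, s.word wPerm i < n) ∧
      (∀ i < k, ∀ e < n, (∀ j < i + 1, s.word wPerm j ≠ e) →
        LexLt key (s.word wPerm i) e) ∧
      ∀ i j, i < j → j < k → s.word wPerm i ≠ s.word wPerm j)
    (fun _ => 0) (H * 100 + 50) (by omega) rfl ?_ rfl ?_ ?_) ?_
  · refine ⟨⟨?_, ?_, ?_, ?_, ?_, ?_⟩, by simp, by simp, by simp⟩
    · simpa using h3.key_eq
    · simpa using h3.count
    · simpa using h3.size
    · simpa using h3.tree
    · simpa using fun i h h' => h3.present i h h'
    · simpa using fun i h h' => h3.absent i h (not_lt.2 h')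
  · rintro k s hk ⟨h, -⟩
    simp [h.count]
  · rintro k s hk ⟨h, hp, hle, hne⟩ hi
    have hsz := h.size
    -- Fewer than `n` players have left, so there is a winner.
    obtain ⟨r, hr, hrn⟩ : ∃ r < n, ∀ j < k, s.word wPerm j ≠ r := by
      by_contra! hcon
      have : Finset.range n ⊆ (Finset.range k).image (s.word wPerm) := by
        intro r hr
        obtain ⟨j, hj, hjr⟩ := hcon r (Finset.mem_range.1 hr)
        exact Finset.mem_image.2 ⟨j, Finset.mem_range.2 hj, hjr⟩
      have h2 := (Finset.card_le_card this).trans Finset.card_image_le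
      simp at h2
      omega
    obtain ⟨v, hv, -, hvH, ⟨hvn, hvk⟩, hvmin⟩ : ∃ v, s.word wNode 1 = v + 1 ∧ 0 ≤ v ∧ v < 2 ^ H ∧
        (v < n ∧ ∀ j < k, s.word wPerm j ≠ v) ∧ ∀ j, 0 ≤ j → j < 2 ^ H →
          (j < n ∧ ∀ i < k, s.word wPerm i ≠ j) → v ≠ j → LexLt key v j := by
      rcases h.root with ⟨-, h0⟩ | h0
      · exact absurd ⟨hr, hrn⟩ (h0 r (Nat.zero_le _) (by omega))
      · exact h0
    have hperm : ∀ j, Function.update (s.word wPerm) k v j =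
        if j = k then v else s.word wPerm j := fun j => Function.update_apply ..
    simp only [wp_seq, wp_setWord]
    refine ⟨by simp, by simp; omega, by simp, by simp [hi, hv, hsz]; omega, by simp, by simp, ?_⟩
    refine wp_use (h.update (i := v)
      (S' := fun i => i < n ∧ ∀ j < k + 1, Function.update (s.word wPerm) k v j ≠ i)
      (by omega) (by omega) ?_ ?_ ?_ ?_ ?_ ?_ ?_ ?_) ?_
    · simp
    · simp
    · simp
    · simp [hsz, hi, hv]
    · intro j hj
      simp [hsz, hi, hj, hv]
    · intro j hj
      refine and_congr_right fun _ => ⟨fun h j' hj' => ?_, fun h j' hj' => ?_⟩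
      · have := h j' (by omega)
        rwa [hperm, if_neg (by omega)] at this
      · rw [hperm]
        split_ifs with hjk
        · exact hj.symm
        · exact h j' (by omega)
    · intro hcon
      exact absurd (by simp) (hcon.2 k (by omega))
    · intro _
      simp [hsz, hi, hv]
    · rintro t s' ⟨ht, h'⟩ hf
      have hpe : s'.word wPerm = Function.update (s.word wPerm) k v := by
        rw [hf.1 wPerm rfl]
        simp [hi, hv]
      refine ⟨by simp; omega, ?_, ?_, ?_, ?_⟩
      · refine ⟨by simpa using h'.key_eq, by simpa using h'.count, by simpa using h'.size,
          by simpa using h'.tree, ?_, ?_⟩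
        · simpa [hpe] using h'.present
        · simpa [hpe] using h'.absent
      · intro i hik
        simp only [State.writeWord_word, Nat.reduceEqDiff, if_false, hpe,
          hperm]
        split_ifs with hh
        · exact hvn
        · exact hp i (by omega)
      · intro i hik e he hj
        simp only [State.writeWord_word, Nat.reduceEqDiff, if_false, hpe,
          hperm] at hj ⊢
        split_ifs with hh
        · subst hh
          refine hvmin e (Nat.zero_le _) (by omega) ⟨he, fun j hj' => ?_⟩ ?_
          · have := hj j (by omega)
            rwa [if_neg (by omega)] at this
          · have := hj i (by omega)
            rwa [if_pos rfl] at this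
        · refine hle i (by omega) e he fun j hj' => ?_
          have := hj j (by omega)
          rwa [if_neg (by omega)] at this
      · intro i j hij hjk
        simp only [State.writeWord_word, Nat.reduceEqDiff, if_false, hpe,
          hperm]
        rw [if_neg (by omega)]
        split_ifs with hh
        · exact hvk i (by omega)
        · exact hne i j hij (by omega)
  rintro t4 s4 ⟨ht4, h4, hp4, hle4, hne4⟩ hf4
  simp at ht4
  refine ⟨?_, ⟨hp4, fun i j hij hj => ?_⟩, H, h4.size, hnH, hHn⟩
  · have h5 : n * (H * 100 + 30 + 2 + 10) ≤ n * (l * 100 + 30 + 2 + 10) := by gcongr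
    have h6 : n * (H * 100 + 50 + 2 + 10) ≤ n * (l * 100 + 50 + 2 + 10) := by gcongr
    have h7 : n * (l * 100 + 30 + 2 + 10) = 100 * (n * l) + 42 * n := by ring
    have h8 : n * (l * 100 + 50 + 2 + 10) = 100 * (n * l) + 62 * n := by ring
    have h9 : (n + 1) * (l + 1) = n * l + n + l + 1 := by ring
    omega
  · refine hle4 i (by omega) _ (hp4 j hj) fun k hk => ?_
    exact hne4 k j (by omega) hj

theorem IsSorting.inj {key : ℕ → ℝ} {n : ℕ} {p : ℕ → ℕ} (h : IsSorting key n p) {i j : ℕ}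
    (hi : i < n) (hj : j < n) (hij : p i = p j) : i = j := by
  by_contra hne
  rcases Nat.lt_or_gt_of_ne hne with hlt | hlt
  · rcases h.lexLt i j hlt hj with h' | h' <;> rw [hij] at h'
    · exact lt_irrefl _ h'
    · exact lt_irrefl _ h'.2
  · rcases h.lexLt j i hlt hi with h' | h' <;> rw [hij] at h'
    · exact lt_irrefl _ h'
    · exact lt_irrefl _ h'.2

theorem IsSorting.surj {key : ℕ → ℝ} {n : ℕ} {p : ℕ → ℕ} (h : IsSorting key n p) {e : ℕ}
    (he : e < n) : ∃ i < n, p i = e := by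
  have hinj : Set.InjOn p (Finset.range n) := fun i hi j hj hij =>
    h.inj (by simpa using hi) (by simpa using hj) hij
  have heq : (Finset.range n).image p = Finset.range n := by
    refine Finset.eq_of_subset_of_card_le (fun e he => ?_) ?_
    · obtain ⟨i, hi, rfl⟩ := Finset.mem_image.1 he
      exact Finset.mem_range.2 (h.lt i (Finset.mem_range.1 hi))
    · rw [Finset.card_image_of_injOn hinj]
  have : e ∈ (Finset.range n).image p := by rw [heq]; exact Finset.mem_range.2 he
  obtain ⟨i, hi, hie⟩ := Finset.mem_image.1 this
  exact ⟨i, Finset.mem_range.1 hi, hie⟩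

/-! ### Lower convex hulls and their tangents -/

section Hull

variable (X Y : ℕ → ℝ)

/-- The path from the point `a` over `b` to `c` turns to the left in `b`. -/
def LeftTurn (a b c : ℕ) : Prop := (Y b - Y a) * (X c - X b) < (X b - X a) * (Y c - Y b)

/-- The points `S 0, …, S (m - 1)` form, from left to right, a strictly convex chain of points in
`blue`; and every nonvertical line that passes below these points and below the points in `E`
passes below all points in `blue`. -/
structure LowerHull (blue E : ℕ → Prop) (S : ℕ → ℕ) (m : ℕ) : Prop where
  mem : ∀ i < m, blue (S i)
  incr : ∀ i, i + 1 < m → X (S i) < X (S (i + 1))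
  convex : ∀ i, i + 2 < m → LeftTurn X Y (S i) (S (i + 1)) (S (i + 2))
  below : ∀ μ ν : ℝ, (∀ i < m, ν ≤ Y (S i) - μ * X (S i)) → (∀ e, E e → ν ≤ Y e - μ * X e) →
    ∀ b, blue b → ν ≤ Y b - μ * X b

variable {X Y} {blue : ℕ → Prop} {S : ℕ → ℕ} {m p : ℕ}

/-- If there is no left turn at the last point of the chain on the way to the new point `p`, then
that point is not below the segment from its predecessor to `p`, and can be dropped. -/
theorem LowerHull.pop (h : LowerHull X Y blue (fun e => e = p) S (m + 2))
    (hp : ∀ b, blue b → X b < X p) (hturn : ¬ LeftTurn X Y (S m) (S (m + 1)) p) :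
    LowerHull X Y blue (fun e => e = p) S (m + 1) where
  mem i hi := h.mem i (by omega)
  incr i hi := h.incr i (by omega)
  convex i hi := h.convex i (by omega)
  below μ ν hS hE := by
    refine h.below μ ν (fun i hi => ?_) hE
    rcases Nat.lt_or_ge i (m + 1) with him | him
    · exact hS i him
    · obtain rfl : i = m + 1 := by omega
      have h1 := hS m (by omega)
      have h2 := hE p rfl
      have h3 := h.incr m (by omega)
      have h4 := hp _ (h.mem (m + 1) (by omega))
      simp only [LeftTurn, not_lt] at hturn
      have h5 := mul_le_mul_of_nonneg_left h1 (sub_nonneg.2 h4.le)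
      have h6 := mul_le_mul_of_nonneg_left h2 (sub_nonneg.2 h3.le)
      have h7 : 0 < X p - X (S m) := by linarith
      refine le_of_mul_le_mul_left ?_ h7
      nlinarith

theorem LowerHull.push (h : LowerHull X Y blue (fun e => e = p) S m)
    (hp : ∀ b, blue b → X b < X p)
    (hturn : ∀ k, m = k + 2 → LeftTurn X Y (S k) (S (k + 1)) p) :
    LowerHull X Y (fun b => blue b ∨ b = p) (fun _ => False) (Function.update S m p) (m + 1) where
  mem i hi := by
    rw [Function.update_apply]
    split_ifs with him
    · exact Or.inr rfl
    · exact Or.inl (h.mem i (by omega))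
  incr i hi := by
    rw [Function.update_of_ne (by omega), Function.update_apply]
    split_ifs with him
    · exact hp _ (h.mem i (by omega))
    · exact h.incr i (by omega)
  convex i hi := by
    rw [Function.update_of_ne (by omega), Function.update_of_ne (by omega), Function.update_apply]
    split_ifs with him
    · exact hturn i him.symm
    · exact h.convex i (by omega)
  below μ ν hS _ := by
    have hp' : ν ≤ Y p - μ * X p := by simpa using hS m (by omega)
    rintro b (hb | rfl)
    · refine h.below μ ν (fun i hi => ?_) (by rintro e rfl; exact hp') b hb
      have := hS i (by omega)
      rwa [Function.update_of_ne (by omega)] at this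
    · exact hp'

/-- The slope of the line through the points `b` and `q`. -/
noncomputable def slopeTo (X Y : ℕ → ℝ) (q b : ℕ) : ℝ := (Y q - Y b) / (X q - X b)

theorem slopeTo_lt_iff {q a b : ℕ} (ha : X a < X q) (hb : X b < X q) :
    slopeTo X Y q a < slopeTo X Y q b ↔
      (Y q - Y a) * (X q - X b) < (Y q - Y b) * (X q - X a) :=
  div_lt_div_iff₀ (sub_pos.2 ha) (sub_pos.2 hb)

/-- Along a convex chain the slopes of the lines to a point right of it are unimodal. -/
theorem slopeTo_unimodal {a b c q : ℕ} (hab : X a < X b) (hbc : X b < X c) (hcq : X c < X q)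
    (hturn : LeftTurn X Y a b c) (h : slopeTo X Y q b < slopeTo X Y q c) :
    slopeTo X Y q a < slopeTo X Y q b := by
  rw [slopeTo_lt_iff (by linarith) hcq] at h
  rw [slopeTo_lt_iff (by linarith) (by linarith)]
  unfold LeftTurn at hturn
  have h1 : 0 < X c - X b := by linarith
  have h2 : 0 < X b - X a := by linarith
  have h3 : 0 < X q - X b := by linarith
  have h4 : (Y c - Y b) * (X q - X b) < (Y q - Y b) * (X c - X b) := by nlinarith
  have h5 := mul_lt_mul_of_pos_right hturn h3
  have h6 := mul_lt_mul_of_pos_left h4 h2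
  have h7 : (Y b - Y a) * (X q - X b) < (Y q - Y b) * (X b - X a) := by
    refine lt_of_mul_lt_mul_right ?_ h1.le
    nlinarith
  nlinarith

/-- What the tangent computation delivers for the point `q`: if there are points in `blue`, then
`flag = 1` and `L` is the largest slope of a line from a point in `blue` to `q`. -/
def IsTangent (X Y : ℕ → ℝ) (blue : ℕ → Prop) (q flag : ℕ) (L : ℝ) : Prop :=
  (flag = 0 ∧ ∀ b, ¬ blue b) ∨
    (flag = 1 ∧ (∃ b, blue b ∧ Y q - Y b = L * (X q - X b)) ∧
      ∀ b, blue b → Y q - Y b ≤ L * (X q - X b))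

theorem LowerHull.isTangent {E : ℕ → Prop} {q k : ℕ} (h : LowerHull X Y blue E S m)
    (hE : ∀ e, ¬ E e) (hq : ∀ b, blue b → X b < X q) (hk : k < m)
    (hlo : ∀ i < k, slopeTo X Y q (S i) < slopeTo X Y q (S (i + 1)))
    (hhi : ∀ i, k ≤ i → i + 1 < m → slopeTo X Y q (S (i + 1)) ≤ slopeTo X Y q (S i)) :
    IsTangent X Y blue q 1 (slopeTo X Y q (S k)) := by
  have up : ∀ d ≤ k, slopeTo X Y q (S (k - d)) ≤ slopeTo X Y q (S k) := by
    intro d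
    induction d with
    | zero => simp
    | succ d ih =>
      intro hd
      have := hlo (k - (d + 1)) (by omega)
      rw [show k - (d + 1) + 1 = k - d by omega] at this
      exact this.le.trans (ih (by omega))
  have down : ∀ d, k + d < m → slopeTo X Y q (S (k + d)) ≤ slopeTo X Y q (S k) := by
    intro d
    induction d with
    | zero => simp
    | succ d ih =>
      intro hd
      exact (hhi (k + d) (by omega) hd).trans (ih (by omega))
  have hmax : ∀ i < m, slopeTo X Y q (S i) ≤ slopeTo X Y q (S k) := by
    intro i hi
    rcases Nat.le_total i k with hik | hik
    · simpa [Nat.sub_sub_self hik] using up (k - i) (by omega)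
    · simpa [Nat.add_sub_cancel' hik] using down (i - k) (by omega)
  refine Or.inr ⟨rfl, ⟨S k, h.mem k hk, ?_⟩, fun b hb => ?_⟩
  · have := hq _ (h.mem k hk)
    rw [slopeTo, div_mul_cancel₀ _ (by linarith)]
  · have := h.below (slopeTo X Y q (S k)) (Y q - slopeTo X Y q (S k) * X q) (fun i hi => ?_)
      (fun e he => absurd he (hE e)) b hb
    · linarith
    · have h1 := sub_pos.2 (hq _ (h.mem i hi))
      have h2 := hmax i hi
      have h3 : Y q - Y (S i) = slopeTo X Y q (S i) * (X q - X (S i)) := by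
        rw [slopeTo, div_mul_cancel₀ _ h1.ne']
      have h4 := mul_le_mul_of_nonneg_right h2 h1.le
      linarith

theorem LowerHull.congr {blue' E : ℕ → Prop} {S' : ℕ → ℕ} (h : LowerHull X Y blue E S m)
    (hb : ∀ b, blue' b ↔ blue b) (hS : ∀ i < m, S' i = S i) : LowerHull X Y blue' E S' m where
  mem i hi := by rw [hb, hS i hi]; exact h.mem i hi
  incr i hi := by rw [hS i (by omega), hS _ hi]; exact h.incr i hi
  convex i hi := by rw [hS i (by omega), hS _ (by omega), hS _ hi]; exact h.convex i hi
  below μ ν hS' hE b hb' :=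
    h.below μ ν (fun i hi => by rw [← hS i hi]; exact hS' i hi) hE b ((hb b).1 hb')

theorem LowerHull.weaken {E E' : ℕ → Prop} (h : LowerHull X Y blue E S m)
    (hE : ∀ e, E e → E' e) : LowerHull X Y blue E' S m where
  mem := h.mem
  incr := h.incr
  convex := h.convex
  below μ ν hS hE' := h.below μ ν hS fun e he => hE' e (hE e he)

end Hull

/-! ### Tangents from the red points -/

/-- Shrink the stack until it makes a left turn on the way to the point `wJ`, and push `wJ`. -/
def pushPoint : Prog :=
  .seq (.loop (.and (.wlt (wc 1) (wvar wTop)) (.not (.rlt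
      ((rat rY (wat wStack (wvar wTop - wc 1)) - rat rY (wat wStack (wvar wTop - wc 2))) *
        (rat rKey (wvar wJ) - rat rKey (wat wStack (wvar wTop - wc 1))))
      ((rat rKey (wat wStack (wvar wTop - wc 1)) - rat rKey (wat wStack (wvar wTop - wc 2))) *
        (rat rY (wvar wJ) - rat rY (wat wStack (wvar wTop - wc 1)))))))
    (.setWord wTop (wc 0) (wvar wTop - wc 1))) <|
  .seq (.setWord wStack (wvar wTop) (wvar wJ))
    (.setWord wTop (wc 0) (wvar wTop + wc 1))

/-- Every round of the loop makes the stack smaller, so the cost of `pushPoint` is constant up to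
the change of the height of the stack. -/
theorem pushPoint_spec {W m p : ℕ} {X Y : ℕ → ℝ} {blue : ℕ → Prop} {s : State}
    (hX : s.real rKey = X) (hY : s.real rY = Y) (hm : s.word wTop 0 = m) (hj : s.word wJ 0 = p)
    (hW : m + 2 ≤ W) (hp : ∀ b, blue b → X b < X p)
    (h : LowerHull X Y blue (fun _ => False) (s.word wStack) m) :
    wp W pushPoint (fun t s' => t + 100 * s'.word wTop 0 ≤ 300 + 100 * m ∧
      s'.word wTop 0 ≤ m + 1 ∧
      LowerHull X Y (fun b => blue b ∨ b = p) (fun _ => False) (s'.word wStack)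
        (s'.word wTop 0)) s := by
  unfold pushPoint
  simp only [wp_seq]
  refine wp_use (wp_loop (fun c s' => ∃ m', s'.word wTop 0 = m' ∧ m' ≤ m ∧ c = 100 * m' ∧
    s'.real rKey = X ∧ s'.real rY = Y ∧ s'.word wJ 0 = p ∧
    LowerHull X Y blue (fun e => e = p) (s'.word wStack) m') ?_ (100 * m)
    ⟨m, hm, le_rfl, rfl, hX, hY, hj, h.weaken (by simp)⟩) ?_
  · rintro c s ⟨m', h1, h2, rfl, h3, h4, h5, h6⟩
    refine ⟨by simp; omega, fun hb => ?_⟩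
    simp [h1, h3, h4, h5] at hb
    obtain ⟨m', rfl⟩ : ∃ e, m' = e + 2 := ⟨m' - 2, by omega⟩
    simp [h1, h3, h4, h5]
    refine ⟨by omega, by omega, by omega, h6.pop hp ?_⟩
    simpa [LeftTurn] using hb.2
  · rintro t s' ⟨⟨c, ht, m', h1, h2, rfl, h3, h4, h5, h6⟩, hb⟩ hf
    simp [h1, h3, h4, h5] at hb
    simp at ht
    simp [h1, h5]
    refine ⟨⟨by omega, by omega⟩, ?_, h2, ?_⟩
    · omega
    · refine h6.push hp ?_
      rintro k rfl
      simpa [LeftTurn] using hb (by omega)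

/-- Find, by binary search on the stack, the tangent from the point `wJ` to the hull. -/
def findTangent : Prog :=
  .branch (.weq (wvar wTop) (wc 0)) (.setWord wFlag (wvar wJ) (wc 0)) <|
  .seq (.setWord wLo (wc 0) (wc 0)) <|
  .seq (.setWord wHi (wc 0) (wvar wTop - wc 1)) <|
  .seq (.loop (.wlt (wvar wLo) (wvar wHi)) <|
    .seq (.setWord wMid (wc 0) ((wvar wLo + wvar wHi) / wc 2)) <|
    .branch (.rlt
      ((rat rY (wvar wJ) - rat rY (wat wStack (wvar wMid))) *
        (rat rKey (wvar wJ) - rat rKey (wat wStack (wvar wMid + wc 1))))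
      ((rat rY (wvar wJ) - rat rY (wat wStack (wvar wMid + wc 1))) *
        (rat rKey (wvar wJ) - rat rKey (wat wStack (wvar wMid)))))
      (.setWord wLo (wc 0) (wvar wMid + wc 1))
      (.setWord wHi (wc 0) (wvar wMid))) <|
  .seq (.setReal rTan (wvar wJ)
    ((rat rY (wvar wJ) - rat rY (wat wStack (wvar wLo))) /
      (rat rKey (wvar wJ) - rat rKey (wat wStack (wvar wLo)))))
  (.setWord wFlag (wvar wJ) (wc 1))

theorem findTangent_spec {W m l q : ℕ} {X Y : ℕ → ℝ} {blue : ℕ → Prop} {s : State}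
    (hX : s.real rKey = X) (hY : s.real rY = Y) (hm : s.word wTop 0 = m) (hj : s.word wJ 0 = q)
    (hW : 2 * m + 2 ≤ W) (hl : m < 2 ^ l) (hq : ∀ b, blue b → X b < X q)
    (h : LowerHull X Y blue (fun _ => False) (s.word wStack) m) :
    wp W findTangent (fun t s' => t ≤ 100 * l + 100 ∧
      (∀ i, i ≠ q → s'.word wFlag i = s.word wFlag i ∧ s'.real rTan i = s.real rTan i) ∧
      IsTangent X Y blue q (s'.word wFlag q) (s'.real rTan q)) s := by
  have hW1 : 1 ≤ W := by omega
  have hW2 : 2 ≤ W := by omega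
  rw [findTangent, wp_branch]
  refine ⟨by simp, fun hb => ?_, fun hb => ?_⟩
  · simp [hm] at hb
    subst hb
    simp [hj]
    refine ⟨fun i hi => ?_, Or.inl ⟨rfl, fun b hb => ?_⟩⟩
    · simp [hi]
    · have := h.below 0 (Y b + 1) (by simp) (by simp) b hb
      linarith
  · simp [hm] at hb
    simp only [wp_seq, wp_setWord]
    refine ⟨by simp, by simp, by simp, by simp [hW1], ?_⟩
    generalize hs1 : ((s.writeWord wLo ((wc 0).eval s) ((wc 0).eval s)).writeWord wHi _ _) = s1
    have hlo1 : s1.word wLo 0 = 0 := by simp [← hs1]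
    have hhi1 : s1.word wHi 0 = m - 1 := by simp [← hs1, hm]
    have hfr : ∀ a, a ≠ wLo → a ≠ wHi → s1.word a = s.word a := by
      intro a h1 h2
      simp [← hs1, h1, h2]
    have hfr' : s1.real = s.real := by simp [← hs1]
    -- The slopes increase up to `lo` and decrease from `hi` on, so the maximum is between them.
    refine wp_use (wp_loop (fun c s' => ∃ lo hi d, s'.word wLo 0 = lo ∧ s'.word wHi 0 = hi ∧
      lo ≤ hi ∧ hi < m ∧ hi - lo < 2 ^ d ∧ c = 100 * d ∧ s'.real = s1.real ∧
      s'.word wStack = s.word wStack ∧ s'.word wJ 0 = q ∧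
      (∀ i < lo, slopeTo X Y q (s.word wStack i) < slopeTo X Y q (s.word wStack (i + 1))) ∧
      (∀ i, hi ≤ i → i + 1 < m →
        slopeTo X Y q (s.word wStack (i + 1)) ≤ slopeTo X Y q (s.word wStack i)))
      ?_ (100 * l) ⟨0, m - 1, l, hlo1, hhi1, by omega, by omega, by omega, rfl, rfl,
        hfr _ (by simp) (by simp), by rw [hfr _ (by simp) (by simp), hj], by simp, by omega⟩) ?_
    · rintro c s' ⟨lo, hi, d, h1, h2, h3, h4, h5, rfl, h6, h7, h8, h9, h10⟩
      refine ⟨by simp, fun hb => ?_⟩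
      simp [h1, h2] at hb
      obtain ⟨d, rfl⟩ : ∃ e, d = e + 1 := by
        rcases d with _ | e
        · omega
        · exact ⟨e, rfl⟩
      have hd : 2 ^ (d + 1) = 2 * 2 ^ d := pow_succ' _ _
      have hltq : ∀ i < m, X (s.word wStack i) < X q := fun i hi => hq _ (h.mem i hi)
      set mid := (lo + hi) / 2 with hmid
      have hiff := slopeTo_lt_iff (Y := Y) (hltq mid (by omega)) (hltq (mid + 1) (by omega))
      simp [h1, h2, h6, h7, h8, hfr', hX, hY, hW1, hW2, ← hmid]
      refine ⟨by omega, by omega,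
        fun hb => ⟨by omega, d, by omega, by omega, h4, by omega, ?_, h10⟩,
        fun hb => ⟨d, by omega, by omega, by omega, by omega, h9, ?_⟩⟩
      · have hlt := hiff.2 hb
        have key : ∀ e ≤ mid, slopeTo X Y q (s.word wStack (mid - e)) <
            slopeTo X Y q (s.word wStack (mid - e + 1)) := by
          intro e
          induction e with
          | zero => intro _; simpa using hlt
          | succ e ih =>
            intro he
            have := ih (by omega)
            rw [show mid - e = mid - (e + 1) + 1 by omega] at this
            exact slopeTo_unimodal (h.incr _ (by omega)) (h.incr _ (by omega))
              (hltq _ (by omega)) (h.convex _ (by omega)) this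
        intro i hi'
        have := key (mid - i) (by omega)
        rwa [Nat.sub_sub_self (by omega)] at this
      · have hle := mt hiff.1 (not_lt.2 hb)
        have key : ∀ e, mid + e + 1 < m → slopeTo X Y q (s.word wStack (mid + e + 1)) ≤
            slopeTo X Y q (s.word wStack (mid + e)) := by
          intro e
          induction e with
          | zero => intro _; exact not_lt.1 hle
          | succ e ih =>
            intro he
            by_contra! hcon
            exact absurd (slopeTo_unimodal (h.incr (mid + e) (by omega))
              (h.incr (mid + e + 1) (by omega)) (hltq _ (by omega))
              (h.convex (mid + e) (by omega)) hcon) (not_lt.2 (ih (by omega)))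
        intro i hi' him
        have := key (i - mid) (by omega)
        rwa [show mid + (i - mid) = i by omega] at this
    · rintro t s' ⟨⟨c, ht, lo, hi, d, h1, h2, h3, h4, h5, rfl, h6, h7, h8, h9, h10⟩, hb⟩ hf
      simp [h1, h2] at hb
      obtain rfl : lo = hi := by omega
      simp at ht
      have hlt := hq _ (h.mem lo h4)
      simp [h1, h6, h7, h8, hfr', hX, hY, hW1]
      refine ⟨by linarith, by omega, fun i hi => ?_, ?_⟩
      · simp [hi, hf.1 wFlag rfl, hfr]
      · exact h.isTangent (by simp) hq h4 h9 h10

/-- For each red point, that is, each index from the number of blue points up to `wCount`, find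
the tangent to the lower hull of the blue points to the left of it. -/
def tangents : Prog :=
  .seq sort <|
  .seq (.setWord wTop (wc 0) (wc 0)) <|
  forLoop wK (wvar wCount) <|
    .seq (.setWord wJ (wc 0) (wat wPerm (wvar wK))) <|
    .branch (.wlt (wvar wJ) (wat wIn (wc 0))) pushPoint findTangent

theorem tangents_spec {W n nb l : ℕ} {X Y : ℕ → ℝ} {s : State} (hX : s.real rKey = X)
    (hY : s.real rY = Y) (hn : s.word wCount 0 = n) (hnb : s.word wIn 0 = nb) (hle : nb ≤ n)
    (hW : 4 * n + 4 < W) (hl : 2 * n + 1 < 2 ^ l)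
    (hinj : ∀ i < n, ∀ j < n, X i = X j → i = j) :
    wp W tangents (fun t s' => t ≤ 3000 * ((n + 1) * (l + 1)) ∧
      ∀ q, nb ≤ q → q < n →
        IsTangent X Y (fun b => b < nb ∧ X b < X q) q (s'.word wFlag q) (s'.real rTan q)) s := by
  unfold tangents
  simp only [wp_seq]
  refine wp_use (sort_spec hX hn hW hl) ?_
  rintro t1 s1 ⟨ht1, hsort, -⟩ hf1
  simp only [wp_setWord]
  refine ⟨by simp, by simp, ?_⟩
  have hp0 := hsort
  set p := s1.word wPerm with hp
  have hmono : ∀ i < n, ∀ j < n, (X (p i) < X (p j) ↔ i < j) := by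
    have hlt : ∀ i j, i < j → j < n → X (p i) < X (p j) := by
      intro i j hij hj
      rcases hsort.lexLt i j hij hj with h | h
      · exact h
      · have := hinj _ (hsort.lt i (by omega)) _ (hsort.lt j hj) h.1
        exact absurd h.2 (by omega)
    intro i hi j hj
    refine ⟨fun h => ?_, fun h => hlt i j h hj⟩
    by_contra! hji
    rcases hji.eq_or_lt with rfl | hji
    · exact lt_irrefl _ h
    · exact lt_asymm h (hlt j i hji hi)
  -- The potential is the height of the stack, which pays for the points that `pushPoint` drops.
  refine wp_use (wp_for (n := n) (fun k s => s.real rKey = X ∧ s.real rY = Y ∧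
      s.word wCount 0 = n ∧ s.word wIn 0 = nb ∧ s.word wPerm = p ∧ s.word wTop 0 ≤ k ∧
      LowerHull X Y (fun b => b < nb ∧ ∃ i < k, p i = b) (fun _ => False) (s.word wStack)
        (s.word wTop 0) ∧
      ∀ i < k, nb ≤ p i → IsTangent X Y (fun b => b < nb ∧ X b < X (p i)) (p i)
        (s.word wFlag (p i)) (s.real rTan (p i)))
    (fun s => 100 * s.word wTop 0) (100 * l + 400) (by omega) rfl ?_ (by simp) ?_ ?_) ?_
  · refine ⟨?_, ?_, ?_, ?_, ?_, by simp, ⟨by simp, by simp, by simp, by simp⟩, by simp⟩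
    · simp [hf1.2 rKey rfl, hX]
    · simp [hf1.2 rY rfl, hY]
    · simp [hf1.1 wCount rfl, hn]
    · simp [hf1.1 wIn rfl, hnb]
    · simp [hp]
  · rintro k s hk ⟨-, -, h, -⟩
    simp [h]
  · rintro k s hk ⟨h1, h2, h3, h4, h5, h6, h7, h8⟩ hi
    have hbefore : ∀ b, (b < nb ∧ ∃ i < k, p i = b) ↔ (b < nb ∧ X b < X (p k)) := by
      refine fun b => and_congr_right fun hb => ⟨?_, fun h => ?_⟩
      · rintro ⟨i, hik, rfl⟩
        exact (hmono i (by omega) k hk).2 hik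
      · obtain ⟨i, hin, rfl⟩ := hsort.surj (show b < n by omega)
        exact ⟨i, (hmono i hin k hk).1 h, rfl⟩
    have hlt : ∀ b, (b < nb ∧ ∃ i < k, p i = b) → X b < X (p k) := fun b hb =>
      ((hbefore b).1 hb).2
    simp only [wp_seq, wp_setWord, wp_branch]
    refine ⟨by simp, by simp, by simp, fun hb => ?_, fun hb => ?_⟩
    · simp [hi, h4, h5] at hb
      refine wp_use (pushPoint_spec (m := s.word wTop 0) (p := p k) (X := X) (Y := Y)
        (blue := fun b => b < nb ∧ ∃ i < k, p i = b)
        (by simpa using h1) (by simpa using h2) (by simp) (by simp [hi, h5]) (by omega) hlt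
        (by simpa using h7)) ?_
      rintro t s' ⟨ht, htop, hhull⟩ hf
      simp
      refine ⟨by omega, ?_, ?_, ?_, ?_, ?_, by omega, ?_, ?_⟩
      · simpa [h1] using hf.2 rKey rfl
      · simpa [h2] using hf.2 rY rfl
      · simpa [h3] using congrFun (hf.1 wCount rfl) 0
      · simpa [h4] using congrFun (hf.1 wIn rfl) 0
      · simpa [h5] using hf.1 wPerm rfl
      · refine hhull.congr (fun b => ?_) fun _ _ => rfl
        constructor
        · rintro ⟨h, i, hi, rfl⟩
          rcases Nat.lt_or_eq_of_le hi with hi | rfl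
          · exact Or.inl ⟨h, i, hi, rfl⟩
          · exact Or.inr rfl
        · rintro (⟨h, i, hi, rfl⟩ | rfl)
          · exact ⟨h, i, by omega, rfl⟩
          · exact ⟨hb, k, by omega, rfl⟩
      · intro i hik hnbi
        have hne : i ≠ k := by rintro rfl; omega
        rw [show s'.word wFlag = s.word wFlag by simpa using hf.1 wFlag rfl,
          show s'.real rTan = s.real rTan by simpa using hf.2 rTan rfl]
        exact h8 i (by omega) hnbi
    · simp [hi, h4, h5] at hb
      refine wp_use (findTangent_spec (m := s.word wTop 0) (q := p k) (X := X) (Y := Y) (l := l)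
        (blue := fun b => b < nb ∧ ∃ i < k, p i = b)
        (by simpa using h1) (by simpa using h2) (by simp) (by simp [hi, h5]) (by omega) (by omega)
        hlt (by simpa using h7)) ?_
      rintro t s' ⟨ht, hrest, htan⟩ hf
      have htop : s'.word wTop = s.word wTop := by simpa using hf.1 wTop rfl
      have hstack : s'.word wStack = s.word wStack := by simpa using hf.1 wStack rfl
      simp [htop, hstack]
      refine ⟨by omega, ?_, ?_, ?_, ?_, ?_, by omega, ?_, ?_⟩
      · simpa [h1] using hf.2 rKey rfl
      · simpa [h2] using hf.2 rY rfl
      · simpa [h3] using congrFun (hf.1 wCount rfl) 0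
      · simpa [h4] using congrFun (hf.1 wIn rfl) 0
      · simpa [h5] using hf.1 wPerm rfl
      · refine h7.congr (fun b => ?_) fun _ _ => rfl
        refine and_congr_right fun hbn => ⟨?_, ?_⟩
        · rintro ⟨i, hi, rfl⟩
          rcases Nat.lt_or_eq_of_le hi with hi | rfl
          · exact ⟨i, hi, rfl⟩
          · omega
        · rintro ⟨i, hi, rfl⟩
          exact ⟨i, by omega, rfl⟩
      · intro i hik hnbi
        rcases Nat.lt_or_eq_of_le hik with hik | rfl
        · have hne : p i ≠ p k := fun h => by
            have := hsort.inj (by omega) hk h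
            omega
          rw [(hrest _ hne).1, (hrest _ hne).2]
          simpa using h8 i hik hnbi
        · rwa [show (fun b => b < nb ∧ X b < X (p i)) = fun b => b < nb ∧ ∃ j < i, p j = b from
            funext fun b => propext (hbefore b).symm]
  · rintro t s' ⟨ht, -, -, -, -, -, -, -, h8⟩ hf
    simp at ht
    refine ⟨?_, fun q hq hqn => ?_⟩
    · have h7 : n * (100 * l + 400 + 2 + 10) = 100 * (n * l) + 412 * n := by ring
      have h9 : (n + 1) * (l + 1) = n * l + n + l + 1 := by ring
      simp
      omega
    · obtain ⟨i, hi, rfl⟩ := hsort.surj hqn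
      exact h8 i hi hq

/-! ### Stabbing intervals by two points -/

/-- The intervals `[E j, E (k + j)]` for `j < k`, with weights `w j`.  Their `2 * k` ends are
sorted: `P i` is the index of the `i`-th end, and `Q` is the inverse of `P`.  An interval with
nonzero weight is not empty. -/
structure Events (k : ℕ) (E w : ℕ → ℝ) (P Q : ℕ → ℕ) : Prop where
  sorted : IsSorting E (2 * k) P
  rank : ∀ i < 2 * k, Q (P i) = i
  nonneg : ∀ j < k, 0 ≤ w j
  le : ∀ j < k, w j ≠ 0 → E j ≤ E (k + j)

open Classical in
/-- The total weight of the intervals that contain at least one of the points `x` and `y`. -/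
noncomputable def stabbed (k : ℕ) (E w : ℕ → ℝ) (x y : ℝ) : ℝ :=
  ∑ j ∈ Finset.range k,
    if (E j ≤ x ∧ x ≤ E (k + j)) ∨ (E j ≤ y ∧ y ≤ E (k + j)) then w j else 0

/-- The change of the weight at the `i`-th end, if only the intervals are counted whose left end
has rank at least `p`: the weight of the interval at its left end and the negative weight at its
right end. -/
def delta (k : ℕ) (w : ℕ → ℝ) (P Q : ℕ → ℕ) (p i : ℕ) : ℝ :=
  if 2 * k ≤ i then 0
  else if P i < k then (if p ≤ i then w (P i) else 0)
  else if p ≤ Q (P i - k) then - w (P i - k) else 0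

section Stabbing

variable {k : ℕ} {E w : ℕ → ℝ} {P Q : ℕ → ℕ}

theorem Events.rank_lt (h : Events k E w P Q) {e : ℕ} (he : e < 2 * k) : Q e < 2 * k := by
  obtain ⟨i, hi, rfl⟩ := h.sorted.surj he
  rwa [h.rank i hi]

theorem Events.perm_rank (h : Events k E w P Q) {e : ℕ} (he : e < 2 * k) : P (Q e) = e := by
  obtain ⟨i, hi, rfl⟩ := h.sorted.surj he
  rw [h.rank i hi]

theorem Events.key_le (h : Events k E w P Q) {i j : ℕ} (hij : i ≤ j) (hj : j < 2 * k) :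
    E (P i) ≤ E (P j) := by
  rcases hij.eq_or_lt with rfl | hij
  · exact le_rfl
  · rcases h.sorted.lexLt i j hij hj with h | h
    · exact h.le
    · exact h.1.le

theorem Events.rank_lt_rank (h : Events k E w P Q) {j : ℕ} (hj : j < k) (hw : w j ≠ 0) :
    Q j < Q (k + j) := by
  by_contra! hcon
  have h1 : Q j < 2 * k := h.rank_lt (by omega)
  have hle := h.le j hj hw
  have e1 := h.perm_rank (e := j) (by omega)
  have e2 := h.perm_rank (e := k + j) (by omega)
  rcases hcon.eq_or_lt with heq | hlt
  · rw [heq, e1] at e2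
    omega
  · rcases h.sorted.lexLt _ _ hlt h1 with h' | h'
    · rw [e1, e2] at h'
      linarith
    · rw [e1, e2] at h'
      omega

/-- The partial sums of the changes give the weight of the counted intervals that contain the cut
`q`. -/
theorem Events.sum_delta (h : Events k E w P Q) (p : ℕ) {q : ℕ} (hq : q ≤ 2 * k) :
    ∑ i ∈ Finset.range q, delta k w P Q p i =
      ∑ j ∈ Finset.range k, if p ≤ Q j then
        (if Q j < q then w j else 0) - (if Q (k + j) < q then w j else 0) else 0 := by
  have h1 : ∑ i ∈ Finset.range q, delta k w P Q p i =
      ∑ i ∈ Finset.range (2 * k), if i < q then delta k w P Q p i else 0 := by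
    rw [← Finset.sum_filter]
    congr 1
    ext i
    simp only [Finset.mem_range, Finset.mem_filter]
    omega
  have h2 : ∑ i ∈ Finset.range (2 * k), (if i < q then delta k w P Q p i else 0) =
      ∑ e ∈ Finset.range (2 * k), if Q e < q then delta k w P Q p (Q e) else 0 := by
    refine Finset.sum_nbij' P Q ?_ ?_ ?_ ?_ ?_
    · intro i hi
      simpa using h.sorted.lt i (by simpa using hi)
    · intro i hi
      simpa using h.rank_lt (by simpa using hi)
    · intro i hi
      exact h.rank i (by simpa using hi)
    · intro i hi
      exact h.perm_rank (by simpa using hi)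
    · intro i hi
      rw [h.rank i (by simpa using hi)]
  rw [h1, h2, two_mul, Finset.sum_range_add, ← Finset.sum_add_distrib]
  refine Finset.sum_congr rfl fun j hj => ?_
  have hj : j < k := by simpa using hj
  have e1 := h.perm_rank (e := j) (by omega)
  have e2 := h.perm_rank (e := k + j) (by omega)
  have l1 := h.rank_lt (e := j) (by omega)
  have l2 := h.rank_lt (e := k + j) (by omega)
  simp only [delta, e1, e2, Nat.add_sub_cancel_left, if_pos hj, if_neg (not_le.2 l1),
    if_neg (not_le.2 l2), if_neg (not_lt.2 (Nat.le_add_right k j))]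
  split_ifs <;> simp

/-- The weight counted at the cuts `p` and `q` (the cut `p` lies just before the `p`-th end): the
intervals that contain the cut `p`, and those of the intervals to the right of it that contain the
cut `q`. -/
noncomputable def cutValue (k : ℕ) (w : ℕ → ℝ) (P Q : ℕ → ℕ) (p q : ℕ) : ℝ :=
  ∑ i ∈ Finset.range p, delta k w P Q 0 i + ∑ i ∈ Finset.range q, delta k w P Q p i

/-- An interval that contains the cut `p` contributes only to the first sum of `cutValue`, and an
interval to the left of `p` contributes to none. -/
theorem Events.cutValue_eq (h : Events k E w P Q) {p q : ℕ} (hp : p ≤ 2 * k) (hq : q ≤ 2 * k) :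
    cutValue k w P Q p q = ∑ j ∈ Finset.range k,
      if (Q j < p ∧ p ≤ Q (k + j)) ∨ (p ≤ Q j ∧ Q j < q ∧ q ≤ Q (k + j)) then w j else 0 := by
  rw [cutValue, h.sum_delta 0 hp, h.sum_delta p hq, ← Finset.sum_add_distrib]
  refine Finset.sum_congr rfl fun j hj => ?_
  have hj : j < k := by simpa using hj
  by_cases hw : w j = 0
  · simp [hw]
  · have := h.rank_lt_rank hj hw
    simp only [Nat.zero_le, if_true]
    split_ifs <;> first | omega | simp

/-- A pair of cuts is realised by the pair of the ends just behind the first cut and just before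
the second cut. -/
theorem Events.cutValue_le (h : Events k E w P Q) {p q : ℕ} {y : ℝ} (hp : p < 2 * k)
    (hq : q ≤ 2 * k) (hy : q = 0 ∨ y = E (P (q - 1))) :
    cutValue k w P Q p q ≤ stabbed k E w (E (P p)) y := by
  classical
  rw [h.cutValue_eq hp.le hq, stabbed]
  refine Finset.sum_le_sum fun j hj => ?_
  have hj : j < k := by simpa using hj
  have e1 := h.perm_rank (e := j) (by omega)
  have e2 := h.perm_rank (e := k + j) (by omega)
  have l2 := h.rank_lt (e := k + j) (by omega)
  have hw := h.nonneg j hj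
  split_ifs with h1 h2 h2
  · exact le_rfl
  · exfalso
    apply h2
    rcases h1 with h1 | ⟨h1, h3, h4⟩
    · left
      have a1 := h.key_le h1.1.le hp
      have a2 := h.key_le h1.2 l2
      rw [e1] at a1
      rw [e2] at a2
      exact ⟨a1, a2⟩
    · right
      have hy : y = E (P (q - 1)) := hy.resolve_left (by omega)
      have a1 := h.key_le (show Q j ≤ q - 1 by omega) (by omega)
      have a2 := h.key_le (show q - 1 ≤ Q (k + j) by omega) l2
      rw [e1] at a1
      rw [e2] at a2
      rw [hy]
      exact ⟨a1, a2⟩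
  · exact hw
  · exact le_rfl

/-- Every point `x` lies in the same intervals as some cut `p`: just before the `p`-th end come
the left ends that are at most `x` and the right ends that are less than `x`. -/
theorem Events.exists_cut (h : Events k E w P Q) (x : ℝ) : ∃ p ≤ 2 * k,
    ∀ j < k, (Q j < p ↔ E j ≤ x) ∧ (Q (k + j) < p ↔ E (k + j) < x) := by
  classical
  let Before : ℕ → Prop := fun e => E e < x ∨ E e = x ∧ e < k
  have hmono : ∀ i i', i ≤ i' → i' < 2 * k → Before (P i') → Before (P i) := by
    intro i i' hii hi' hb
    rcases hii.eq_or_lt with rfl | hii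
    · exact hb
    · rcases h.sorted.lexLt i i' hii hi' with hlt | ⟨heq, hlt⟩
      · rcases hb with hb | hb
        · exact Or.inl (hlt.trans hb)
        · exact Or.inl (hlt.trans_eq hb.1)
      · rcases hb with hb | hb
        · exact Or.inl (heq.trans_lt hb)
        · exact Or.inr ⟨heq.trans hb.1, by omega⟩
  obtain ⟨p, hp, hlt, hge⟩ : ∃ p ≤ 2 * k, (∀ i < p, Before (P i)) ∧
      ∀ i, p ≤ i → i < 2 * k → ¬ Before (P i) := by
    by_cases hex : ∃ i, i < 2 * k ∧ ¬ Before (P i)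
    · refine ⟨Nat.find hex, (Nat.find_spec hex).1.le, fun i hi => ?_, fun i hi hik hb => ?_⟩
      · have := Nat.find_min hex hi
        have h2 := (Nat.find_spec hex).1
        by_contra hcon
        exact this ⟨by omega, hcon⟩
      · exact (Nat.find_spec hex).2 (hmono _ _ hi hik hb)
    · push Not at hex
      exact ⟨2 * k, le_rfl, hex, fun i h1 h2 => by omega⟩
  have key : ∀ e < 2 * k, (Q e < p ↔ Before e) := by
    intro e he
    have e1 := h.perm_rank he
    constructor
    · intro hlt'
      have := hlt _ hlt'
      rwa [e1] at this
    · intro hb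
      by_contra! hcon
      have := hge _ hcon (h.rank_lt he)
      rw [e1] at this
      exact this hb
  refine ⟨p, hp, fun j hj => ⟨?_, ?_⟩⟩
  · rw [key j (by omega), le_iff_lt_or_eq]
    exact or_congr_right (and_iff_left hj)
  · rw [key (k + j) (by omega)]
    exact ⟨fun h => h.resolve_right (by omega), Or.inl⟩

/-- It suffices to consider pairs of cuts. -/
theorem Events.stabbed_le (h : Events k E w P Q) {x y : ℝ} (hxy : x ≤ y) {b : ℝ} (hb : 0 ≤ b)
    (hcut : ∀ p q, p < 2 * k → q ≤ 2 * k → cutValue k w P Q p q ≤ b) :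
    stabbed k E w x y ≤ b := by
  classical
  obtain ⟨p, hp, hpx⟩ := h.exists_cut x
  obtain ⟨q, hq, hqy⟩ := h.exists_cut y
  rcases hp.eq_or_lt with rfl | hp'
  · refine le_trans (le_of_eq ?_) hb
    refine Finset.sum_eq_zero fun j hj => ?_
    have hj : j < k := by simpa using hj
    have := (hpx j hj).2.1 (h.rank_lt (by omega))
    rw [if_neg]
    rintro (h' | h') <;> linarith
  · refine le_trans ?_ (hcut p q hp' hq)
    rw [h.cutValue_eq hp hq, stabbed]
    refine Finset.sum_le_sum fun j hj => ?_
    have hj : j < k := by simpa using hj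
    obtain ⟨a1, a2⟩ := hpx j hj
    obtain ⟨a3, a4⟩ := hqy j hj
    split_ifs with h1 h2 h2
    · exact le_rfl
    · exfalso
      apply h2
      have b2 : x ≤ E (k + j) ↔ p ≤ Q (k + j) := by rw [← not_lt, ← a2, not_lt]
      have b4 : y ≤ E (k + j) ↔ q ≤ Q (k + j) := by rw [← not_lt, ← a4, not_lt]
      rw [← a1, ← a3, b2, b4] at h1
      rcases h1 with h1 | h1
      · exact Or.inl h1
      · by_cases hpj : p ≤ Q j
        · exact Or.inr ⟨hpj, h1⟩
        · push Not at hpj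
          refine Or.inl ⟨hpj, ?_⟩
          by_contra! hcon
          have := a2.1 hcon
          have := a4.2 (by linarith)
          omega
    · exact h.nonneg j hj
    · exact le_rfl

theorem stabbed_nonneg (h : Events k E w P Q) (x y : ℝ) : 0 ≤ stabbed k E w x y := by
  refine Finset.sum_nonneg fun j hj => ?_
  split_ifs
  · exact h.nonneg j (by simpa using hj)
  · exact le_rfl

/-- When the sweep passes a right end, the counted intervals stay the same. -/
theorem Events.delta_right (h : Events k E w P Q) {p : ℕ} (hp : p < 2 * k) (hr : ¬ P p < k)
    (i : ℕ) : delta k w P Q p i = delta k w P Q (p + 1) i := by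
  unfold delta
  by_cases h1 : 2 * k ≤ i
  · simp [h1]
  · rw [if_neg h1, if_neg h1]
    by_cases h2 : P i < k
    · have : i ≠ p := by rintro rfl; exact hr h2
      rw [if_pos h2, if_pos h2]
      simp only [show (p ≤ i) = (p + 1 ≤ i) from propext (by omega)]
    · rw [if_neg h2, if_neg h2]
      have h3 := h.sorted.lt i (by omega)
      have h4 := h.perm_rank (e := P i - k) (by omega)
      have : Q (P i - k) ≠ p := by
        intro hcon
        rw [hcon] at h4
        omega
      simp only [show (p ≤ Q (P i - k)) = (p + 1 ≤ Q (P i - k)) from propext (by omega)]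

/-- When the sweep passes a left end, one more interval is counted. -/
theorem Events.delta_left (h : Events k E w P Q) {p : ℕ} (hp : p < 2 * k) (hl : P p < k) :
    delta k w P Q p = Function.update (Function.update (delta k w P Q (p + 1)) p (w (P p)))
      (Q (k + P p)) (- w (P p)) := by
  have e2 := h.perm_rank (e := k + P p) (by omega)
  have l2 := h.rank_lt (e := k + P p) (by omega)
  have e1 := h.rank p hp
  funext i
  rw [Function.update_apply]
  split_ifs with h1
  · subst h1
    simp [delta, e2, l2, e1]
  · rw [Function.update_apply]
    split_ifs with h2
    · subst h2
      simp [delta, hp, hl]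
    · unfold delta
      by_cases h3 : 2 * k ≤ i
      · simp [h3]
      · rw [if_neg h3, if_neg h3]
        by_cases h4 : P i < k
        · rw [if_pos h4, if_pos h4]
          simp only [show (p ≤ i) = (p + 1 ≤ i) from propext (by omega)]
        · rw [if_neg h4, if_neg h4]
          have h5 := h.sorted.lt i (by omega)
          have h6 := h.perm_rank (e := P i - k) (by omega)
          have : Q (P i - k) ≠ p := by
            intro hcon
            rw [hcon] at h6
            apply h1
            rw [h6, Nat.add_sub_cancel' (by omega), h.rank i (by omega)]
          simp only [show (p ≤ Q (P i - k)) = (p + 1 ≤ Q (P i - k)) from propext (by omega)]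

end Stabbing

/-! ### The sweep -/

/-- Combination of the nodes of the sweep tree.  A node holds the sum of the changes at its
leaves, the largest partial sum of these, and the key at which that partial sum is reached. -/
noncomputable def joinNodes (v w : ℝ × ℝ × ℝ) : ℝ × ℝ × ℝ :=
  (v.1 + w.1, if v.2.1 < v.1 + w.2.1 then (v.1 + w.2.1, w.2.2) else v.2)

/-- The value `v` is correct for the changes `δ` and the keys `κ` at the leaves
`a, …, b - 1`. -/
structure PrefixMax (δ κ : ℕ → ℝ) (a b : ℕ) (v : ℝ × ℝ × ℝ) : Prop where
  sum_eq : v.1 = ∑ i ∈ Finset.Ico a b, δ i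
  le : ∀ q, a ≤ q → q ≤ b → ∑ i ∈ Finset.Ico a q, δ i ≤ v.2.1
  attained : ∃ q, a ≤ q ∧ q ≤ b ∧ ∑ i ∈ Finset.Ico a q, δ i = v.2.1 ∧
    (q = a ∨ a < q ∧ 0 < δ (q - 1) ∧ v.2.2 = κ (q - 1))

theorem PrefixMax.join {δ κ : ℕ → ℝ} {a b c : ℕ} {v w : ℝ × ℝ × ℝ} (hab : a ≤ b) (hbc : b ≤ c)
    (hv : PrefixMax δ κ a b v) (hw : PrefixMax δ κ b c w) :
    PrefixMax δ κ a c (joinNodes v w) where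
  sum_eq := by
    rw [joinNodes, ← Finset.sum_Ico_consecutive _ hab hbc, hv.sum_eq, hw.sum_eq]
  le q haq hqc := by
    have hmax : v.2.1 ≤ (joinNodes v w).2.1 ∧ v.1 + w.2.1 ≤ (joinNodes v w).2.1 := by
      unfold joinNodes
      split_ifs with h
      · exact ⟨h.le, le_rfl⟩
      · exact ⟨le_rfl, not_lt.1 h⟩
    rcases Nat.le_total q b with h | h
    · exact (hv.le q haq h).trans hmax.1
    · rw [← Finset.sum_Ico_consecutive _ hab h, ← hv.sum_eq]
      have := hw.le q h hqc
      linarith [hmax.2]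
  attained := by
    unfold joinNodes
    split_ifs with h
    · obtain ⟨q, h1, h2, h3, h4⟩ := hw.attained
      refine ⟨q, by omega, h2, ?_, ?_⟩
      · rw [← Finset.sum_Ico_consecutive _ hab h1, ← hv.sum_eq, h3]
      · rcases h4 with rfl | ⟨h4, h5, h6⟩
        · -- The empty partial sum of the right child does not beat the left child.
          exfalso
          have := hv.le q hab le_rfl
          rw [Finset.Ico_self, Finset.sum_empty] at h3
          rw [← hv.sum_eq] at this
          linarith
        · exact Or.inr ⟨by omega, h5, h6⟩
    · obtain ⟨q, h1, h2, h3, h4⟩ := hv.attained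
      exact ⟨q, h1, by omega, h3, h4⟩

/-- The value `v` is correct for a single leaf with change `d` and key `x`. -/
def LeafValue (d x : ℝ) (v : ℝ × ℝ × ℝ) : Prop :=
  v.1 = d ∧ v.2.1 = max d 0 ∧ (0 < d → v.2.2 = x)

theorem LeafValue.prefixMax {δ κ : ℕ → ℝ} {i : ℕ} {v : ℝ × ℝ × ℝ}
    (h : LeafValue (δ i) (κ i) v) : PrefixMax δ κ i (i + 1) v where
  sum_eq := by simp [h.1]
  le q h1 h2 := by
    rcases h1.eq_or_lt with rfl | h1
    · simp [h.2.1]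
    · obtain rfl : q = i + 1 := by omega
      simp [h.2.1]
  attained := by
    by_cases hd : 0 < δ i
    · exact ⟨i + 1, by omega, le_rfl, by simp [h.2.1, hd.le], Or.inr ⟨by omega, hd, h.2.2 hd⟩⟩
    · exact ⟨i, le_rfl, by omega, by simp [h.2.1, not_lt.1 hd], Or.inl rfl⟩

/-- The node `i` of the sweep tree. -/
def sweepNode (s : State) (i : ℕ) : ℝ × ℝ × ℝ := (s.real rSum i, s.real rMax i, s.real rArg i)

/-- Recompute the node `wPos` of the sweep tree from its children. -/
def joinChildren : Prog :=
  .seq (.branch (.rlt (rat rMax (wc 2 * wvar wPos))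
      (rat rSum (wc 2 * wvar wPos) + rat rMax (wc 2 * wvar wPos + wc 1)))
    (.seq (.setReal rMax (wvar wPos)
        (rat rSum (wc 2 * wvar wPos) + rat rMax (wc 2 * wvar wPos + wc 1)))
      (.setReal rArg (wvar wPos) (rat rArg (wc 2 * wvar wPos + wc 1))))
    (.seq (.setReal rMax (wvar wPos) (rat rMax (wc 2 * wvar wPos)))
      (.setReal rArg (wvar wPos) (rat rArg (wc 2 * wvar wPos))))) <|
  .setReal rSum (wvar wPos) (rat rSum (wc 2 * wvar wPos) + rat rSum (wc 2 * wvar wPos + wc 1))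

theorem joinChildren_spec {W : ℕ} {s : State} (h1 : 1 ≤ s.word wPos 0)
    (hW : 2 * s.word wPos 0 + 2 ≤ W) :
    wp W joinChildren (fun t s' => t ≤ 100 ∧ s'.word wPos 0 = s.word wPos 0 ∧
      sweepNode s' = Function.update (sweepNode s) (s.word wPos 0)
        (joinNodes (sweepNode s (2 * s.word wPos 0))
          (sweepNode s (2 * s.word wPos 0 + 1)))) s := by
  have hW2 : 2 ≤ W := by omega
  have hW3 : 2 * s.word wPos 0 ≤ W := by omega
  have hW4 : 2 * s.word wPos 0 + 1 ≤ W := by omega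
  have hW5 : 1 ≤ W := by omega
  have hne1 : 2 * s.word wPos 0 ≠ s.word wPos 0 := by omega
  have hne2 : 2 * s.word wPos 0 + 1 ≠ s.word wPos 0 := by omega
  simp only [joinChildren, wp_seq, wp_branch]
  refine ⟨by simp [hW2, hW3, hW4, hW5], fun hb => ?_, fun hb => ?_⟩ <;>
  · simp only [BExp.Holds, eval_rat, RExp.eval_add, WExp.eval_mul, WExp.eval_add, eval_wc,
      eval_wvar] at hb
    simp [hW2, hW3, hW4, hW5]
    refine ⟨by omega, ?_⟩
    funext i
    by_cases hi : i = s.word wPos 0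
    · subst hi
      simp [sweepNode, joinNodes, hb]
    · simp [sweepNode, hi]

/-- The sweep tree with the changes `δ` and the keys `κ`. -/
structure SweepTree (H : ℕ) (δ κ : ℕ → ℝ) (s : State) : Prop where
  tree : TreeOk (2 ^ H) joinNodes (sweepNode s) 1
  leaf : ∀ i < 2 ^ H, LeafValue (δ i) (κ i) (sweepNode s (2 ^ H + i))

theorem SweepTree.root {H : ℕ} {δ κ : ℕ → ℝ} {s : State} (h : SweepTree H δ κ s) :
    PrefixMax δ κ 0 (2 ^ H) (sweepNode s 1) :=
  h.tree.rep_root (PrefixMax δ κ) (fun i hi => (h.leaf i hi).prefixMax)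
    fun _ _ _ _ _ hab hbc hv hw => hv.join hab hbc hw

theorem SweepTree.congr {H : ℕ} {δ κ : ℕ → ℝ} {s s' : State} (h : SweepTree H δ κ s)
    (h1 : s'.real rSum = s.real rSum) (h2 : s'.real rMax = s.real rMax)
    (h3 : s'.real rArg = s.real rArg) : SweepTree H δ κ s' := by
  have e : sweepNode s' = sweepNode s := by
    funext i
    simp only [sweepNode, h1, h2, h3]
  exact ⟨e ▸ h.tree, e ▸ h.leaf⟩

theorem SweepTree.update {W H i : ℕ} {δ κ : ℕ → ℝ} {d : ℝ} {s₀ s : State}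
    (h : SweepTree H δ κ s₀) (hW : 2 ^ (H + 1) + 2 ≤ W) (hi : i < 2 ^ H)
    (hpos : s.word wPos 0 = 2 ^ H + i)
    (hnode : ∀ j, j ≠ 2 ^ H + i → sweepNode s j = sweepNode s₀ j)
    (hleaf : LeafValue d (κ i) (sweepNode s (2 ^ H + i))) :
    wp W (climb joinChildren) (fun t s' => t ≤ H * 120 + 10 ∧
      SweepTree H (Function.update δ i d) κ s') s := by
  have e : 2 ^ (H + 1) = 2 * 2 ^ H := pow_succ' _ _
  have e1 : 1 ≤ 2 ^ H := Nat.one_le_two_pow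
  refine wp_mono (climb_spec (W := W) (H := H) (K := 100) sweepNode joinNodes (fun _ => True)
    (by omega) (fun _ _ _ => trivial) (fun s v => ?_) (fun s _ h1 h2 => ?_) trivial (by omega)
    (by omega) (by rw [hpos]; exact h.tree.set_leaf hnode)) ?_
  · funext i
    simp [sweepNode]
  · refine wp_mono (joinChildren_spec h1 (by omega)) ?_
    rintro t s' ⟨ht, h2, h3⟩
    exact ⟨ht, trivial, h2, h3⟩
  · rintro t s' ⟨ht, -, htree, hl⟩
    refine ⟨ht, htree, fun j hj => ?_⟩
    rw [hl _ (by omega)]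
    by_cases hji : j = i
    · subst hji
      simpa using hleaf
    · rw [Function.update_of_ne hji, hnode _ (by omega)]
      exact h.leaf j hj

/-- Compute the ranks of the events from their sorting. -/
def computeRanks : Prog :=
  forLoop wI (wvar wCount) (.setWord wRank (wat wPerm (wvar wI)) (wvar wI))

/-- Set all nodes of the sweep tree to zero. -/
def clearTree : Prog :=
  forLoop wI (wc 2 * wvar wSize) <|
    .seq (.setReal rSum (wvar wI) (rc 0)) <|
    .seq (.setReal rMax (wvar wI) (rc 0)) <|
    .setReal rArg (wvar wI) (rc 0)

/-- Put the interval `wJ`, whose left end has rank `wCut`, into the sweep tree. -/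
def insertInterval : Prog :=
  .seq (.setWord wPos (wc 0) (wvar wSize + wvar wCut)) <|
  .seq (.setReal rSum (wvar wPos) (rat rWeight (wvar wJ))) <|
  .seq (.setReal rMax (wvar wPos) (rat rWeight (wvar wJ))) <|
  .seq (.setReal rArg (wvar wPos) (rat rKey (wvar wJ))) <|
  .seq (climb joinChildren) <|
  .seq (.setWord wPos (wc 0) (wvar wSize + wat wRank (wat wIn (wc 1) + wvar wJ))) <|
  .seq (.setReal rSum (wvar wPos) (rc 0 - rat rWeight (wvar wJ))) <|
  .seq (.setReal rMax (wvar wPos) (rc 0)) <|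
  climb joinChildren

/-- Move the sweep over the event of rank `wCut` and update the best solution.  The scalar `rAcc`
is the total weight of the intervals that contain the cut just before that event. -/
def sweepStep : Prog :=
  .seq (.setWord wCut (wc 0) (wvar wCount - wc 1 - wvar wK)) <|
  .seq (.setWord wJ (wc 0) (wat wPerm (wvar wCut))) <|
  .seq (.branch (.wlt (wvar wJ) (wat wIn (wc 1)))
    (.seq (.setReal rAcc (wc 0) (rvar rAcc - rat rWeight (wvar wJ))) insertInterval)
    (.setReal rAcc (wc 0) (rvar rAcc + rat rWeight (wvar wJ - wat wIn (wc 1))))) <|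
  .branch (.rlt (rvar rBest) (rvar rAcc + rat rMax (wc 1)))
    (.seq (.setReal rBest (wc 0) (rvar rAcc + rat rMax (wc 1))) <|
     .seq (.setReal rSlope₁ (wc 0) (rat rKey (wvar wJ))) <|
     .setReal rSlope₂ (wc 0) (rat rArg (wc 1)))
    .skip

/-- Find two points that stab as many intervals as possible.  The best value starts with `-1`, so
that the first pair of points that is considered is accepted. -/
def sweep : Prog :=
  .seq computeRanks <|
  .seq clearTree <|
  .seq (.setReal rAcc (wc 0) (rc 0)) <|
  .seq (.setReal rBest (wc 0) (rc (-1))) <|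
  .seq (.setReal rSlope₁ (wc 0) (rc 0)) <|
  .seq (.setReal rSlope₂ (wc 0) (rc 0)) <|
  forLoop wK (wvar wCount) sweepStep

section Sweep

variable {W k H l : ℕ} {E w : ℕ → ℝ} {P : ℕ → ℕ}

theorem computeRanks_spec {n : ℕ} {key : ℕ → ℝ} {s : State} (hP : s.word wPerm = P)
    (hn : s.word wCount 0 = n) (hW : n < W) (hs : IsSorting key n P) :
    wp W computeRanks (fun t s' => t ≤ 30 * n + 30 ∧ ∀ i < n, s'.word wRank (P i) = i) s := by
  unfold computeRanks
  refine wp_mono (wp_for (n := n) (fun k s => s.word wPerm = P ∧ s.word wCount 0 = n ∧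
    ∀ i < k, s.word wRank (P i) = i) (fun _ => 0) 10 hW rfl ?_ rfl ?_ ?_) ?_
  · simp [hP, hn]
  · rintro k s hk ⟨h1, h2, h3⟩
    simp [h2]
  · rintro k s hk ⟨h1, h2, h3⟩ hi
    simp [h1, h2, hi]
    intro i hik
    rw [Function.update_apply]
    split_ifs with h
    · exact (hs.inj (by omega) hk h).symm
    · refine h3 i (lt_of_le_of_ne hik ?_)
      rintro rfl
      exact h rfl
  · rintro t s' ⟨ht, -, -, h⟩
    simp at ht
    exact ⟨by omega, h⟩

theorem clearTree_spec {s : State} (hH : s.word wSize 0 = 2 ^ H) (hW : 2 * 2 ^ H < W) :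
    wp W clearTree (fun t s' => t ≤ 100 * 2 ^ H + 30 ∧
      ∀ i < 2 * 2 ^ H, sweepNode s' i = (0, 0, 0)) s := by
  have : 1 ≤ 2 ^ H := Nat.one_le_two_pow
  unfold clearTree
  refine wp_mono (wp_for (n := 2 * 2 ^ H) (fun k s => s.word wSize 0 = 2 ^ H ∧
    ∀ i < k, sweepNode s i = (0, 0, 0)) (fun _ => 0) 20 hW rfl ?_ rfl ?_ ?_) ?_
  · simp [hH]
  · rintro k s hk ⟨h1, h2⟩
    simp [h1]
    omega
  · rintro k s hk ⟨h1, h2⟩ hi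
    simp [h1, hi]
    intro i hik
    by_cases h : i = k
    · simp [sweepNode, h]
    · simpa [sweepNode, h] using h2 i (by omega)
  · rintro t s' ⟨ht, -, h⟩
    simp at ht
    exact ⟨by omega, h⟩

/-- The data that stay fixed during the sweep. -/
structure SweepData (k H : ℕ) (E w : ℕ → ℝ) (P Q : ℕ → ℕ) (s : State) : Prop where
  key_eq : s.real rKey = E
  weight_eq : s.real rWeight = w
  perm_eq : s.word wPerm = P
  rank_eq : s.word wRank = Q
  count : s.word wCount 0 = 2 * k
  size : s.word wSize 0 = 2 ^ H
  num : s.word wIn 1 = k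

theorem SweepData.congr {Q : ℕ → ℕ} {s s' : State} (h : SweepData k H E w P Q s)
    (h1 : s'.real rKey = s.real rKey) (h2 : s'.real rWeight = s.real rWeight)
    (h3 : s'.word wPerm = s.word wPerm) (h4 : s'.word wRank = s.word wRank)
    (h5 : s'.word wCount = s.word wCount) (h6 : s'.word wSize = s.word wSize)
    (h7 : s'.word wIn = s.word wIn) : SweepData k H E w P Q s' :=
  ⟨h1.trans h.key_eq, h2.trans h.weight_eq, h3.trans h.perm_eq, h4.trans h.rank_eq,
    h5 ▸ h.count, h6 ▸ h.size, h7 ▸ h.num⟩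

theorem insertInterval_spec {Q : ℕ → ℕ} {p : ℕ} {s : State} (h : Events k E w P Q)
    (hd : SweepData k H E w P Q s) (hkH : 2 * k ≤ 2 ^ H) (hW : 2 ^ (H + 1) + 2 ≤ W)
    (hp : p < 2 * k) (hl : P p < k) (hcut : s.word wCut 0 = p) (hj : s.word wJ 0 = P p)
    (ht : SweepTree H (delta k w P Q (p + 1)) (fun i => E (P i)) s) :
    wp W insertInterval (fun t s' => t ≤ 240 * H + 100 ∧
      SweepTree H (delta k w P Q p) (fun i => E (P i)) s') s := by
  have e : 2 ^ (H + 1) = 2 * 2 ^ H := pow_succ' _ _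
  have l2 := h.rank_lt (e := k + P p) (by omega)
  have hne : Q (k + P p) ≠ p := by
    intro hcon
    have := h.perm_rank (e := k + P p) (by omega)
    rw [hcon] at this
    omega
  have hw := h.nonneg (P p) hl
  obtain ⟨h1, h2, h3, h4, h5, h6, h7⟩ := hd
  simp only [insertInterval, wp_seq, wp_setWord, wp_setReal]
  refine ⟨by simp, by simp [h6, hcut, show 2 ^ H + p ≤ W by omega], by simp, by simp, by simp,
    by simp, by simp, by simp, ?_⟩
  refine wp_use (ht.update (i := p) (d := w (P p)) hW (by omega) ?_ ?_ ?_) ?_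
  · simp [h6, hcut]
  · intro j hj
    simp [sweepNode, h6, hcut, hj]
  · simp [LeafValue, sweepNode, h1, h2, h6, hcut, hj, hw]
  rintro t1 s1 ⟨ht1, htree⟩ hf1
  have a1 : s1.word wSize 0 = 2 ^ H := by simpa [h6] using congrFun (hf1.1 wSize rfl) 0
  have a2 : s1.word wJ 0 = P p := by simpa [hj] using congrFun (hf1.1 wJ rfl) 0
  have a3 : s1.word wIn 1 = k := by simpa [h7] using congrFun (hf1.1 wIn rfl) 1
  have a4 : s1.word wRank = Q := by simpa [h4] using hf1.1 wRank rfl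
  have a5 : s1.real rWeight = w := by simpa [h2] using hf1.2 rWeight rfl
  have hQH : Q (k + P p) < 2 ^ H := by omega
  refine ⟨by simp, by simp [a1, a2, a3, a4]; omega, by simp, by simp [a2], by simp, by simp, ?_⟩
  refine wp_use (htree.update (i := Q (k + P p)) (d := - w (P p)) hW hQH ?_ ?_ ?_) ?_
  · simp [a1, a2, a3, a4]
  · intro j hj
    simp [sweepNode, a1, a2, a3, a4, hj]
  · simp [LeafValue, sweepNode, a1, a2, a3, a4, a5, hw]
  rintro t2 s2 ⟨ht2, htree2⟩ hf2
  refine ⟨by simp; omega, ?_⟩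
  rwa [← h.delta_left hp hl] at htree2

/-- The state of the sweep after the events of rank at least `p` have been processed. -/
structure SweepState (k H : ℕ) (E w : ℕ → ℝ) (P Q : ℕ → ℕ) (p : ℕ) (s : State) : Prop where
  data : SweepData k H E w P Q s
  tree : SweepTree H (delta k w P Q p) (fun i => E (P i)) s
  acc : s.real rAcc 0 = ∑ i ∈ Finset.range p, delta k w P Q 0 i
  best : ∀ p' q, p ≤ p' → p' < 2 * k → q ≤ 2 * k → cutValue k w P Q p' q ≤ s.real rBest 0
  le : s.real rBest 0 ≤ stabbed k E w (s.real rSlope₁ 0) (s.real rSlope₂ 0)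

/-- The root of the sweep tree yields the best second cut for the first cut `p`. -/
theorem SweepTree.best_cut {Q : ℕ → ℕ} {p : ℕ} {s : State} (h : Events k E w P Q)
    (hkH : 2 * k ≤ 2 ^ H) (hp : p < 2 * k)
    (ht : SweepTree H (delta k w P Q p) (fun i => E (P i)) s) :
    (∀ q ≤ 2 * k, cutValue k w P Q p q ≤
      ∑ i ∈ Finset.range p, delta k w P Q 0 i + s.real rMax 1) ∧
    ∑ i ∈ Finset.range p, delta k w P Q 0 i + s.real rMax 1 ≤
      stabbed k E w (E (P p)) (s.real rArg 1) := by
  have hroot := ht.root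
  refine ⟨fun q hq => ?_, ?_⟩
  · have := hroot.le q (Nat.zero_le _) (by omega)
    rw [← Finset.range_eq_Ico] at this
    unfold cutValue
    simp only [sweepNode] at this
    linarith
  · obtain ⟨q, -, hq, hsum, hor⟩ := hroot.attained
    rw [← Finset.range_eq_Ico] at hsum
    have hq' : q ≤ 2 * k := by
      rcases hor with rfl | ⟨h1, h2, -⟩
      · omega
      · -- Beyond the last event nothing changes.
        by_contra! hcon
        rw [delta, if_pos (by omega)] at h2
        exact lt_irrefl _ h2
    have := h.cutValue_le (y := s.real rArg 1) hp hq' (hor.imp_right fun h => h.2.2)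
    unfold cutValue at this
    simp only [sweepNode] at hsum
    rwa [hsum] at this

theorem sweepStep_spec {Q : ℕ → ℕ} {p t : ℕ} {s : State} (h : Events k E w P Q)
    (hkH : 2 * k ≤ 2 ^ H) (hW : 2 ^ (H + 1) + 2 ≤ W) (hp : p + 1 + t = 2 * k)
    (ht : s.word wK 0 = t) (hs : SweepState k H E w P Q (p + 1) s) :
    wp W sweepStep (fun u s' => u ≤ 240 * H + 300 ∧ SweepState k H E w P Q p s') s := by
  obtain ⟨hd, htree, hacc, hbest, hle⟩ := hs
  have hcut : 2 * k - 1 - t = p := by omega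
  have hp2 : p < 2 * k := by omega
  have e1 := h.rank p hp2
  have ecut : ∑ i ∈ Finset.range (p + 1), delta k w P Q 0 i =
      ∑ i ∈ Finset.range p, delta k w P Q 0 i + delta k w P Q 0 p := Finset.sum_range_succ _ _
  -- The two kinds of events lead to states with the same description.
  have finish : ∀ s1, SweepData k H E w P Q s1 →
      SweepTree H (delta k w P Q p) (fun i => E (P i)) s1 → s1.word wJ 0 = P p →
      s1.real rAcc 0 = ∑ i ∈ Finset.range p, delta k w P Q 0 i →
      s1.real rBest = s.real rBest → s1.real rSlope₁ = s.real rSlope₁ →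
      s1.real rSlope₂ = s.real rSlope₂ →
      wp W (.branch (.rlt (rvar rBest) (rvar rAcc + rat rMax (wc 1)))
        (.seq (.setReal rBest (wc 0) (rvar rAcc + rat rMax (wc 1))) <|
         .seq (.setReal rSlope₁ (wc 0) (rat rKey (wvar wJ))) <|
         .setReal rSlope₂ (wc 0) (rat rArg (wc 1)))
        .skip) (fun u s' => u ≤ 100 ∧ SweepState k H E w P Q p s') s1 := by
    intro s1 hd1 ht1 hj1 ha1 hb1 hx1 hy1
    obtain ⟨hb, hb'⟩ := ht1.best_cut h hkH hp2
    rw [← ha1] at hb hb'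
    simp only [wp_branch]
    refine ⟨by simp; omega, fun hlt => ?_, fun hlt => ?_⟩
    · simp at hlt
      simp only [wp_seq, wp_setReal]
      refine ⟨by simp, by simp; omega, by simp, by simp, by simp, by simp; omega, by simp,
        ?_, ?_, ?_, ?_, ?_⟩
      · exact hd1.congr (by simp) (by simp) (by simp) (by simp) (by simp) (by simp) (by simp)
      · exact ht1.congr (by simp) (by simp) (by simp)
      · simpa using ha1
      · intro p' q hpp hp' hq
        simp
        rcases hpp.eq_or_lt with rfl | hpp
        · exact hb q hq
        · have := hbest p' q hpp hp' hq
          rw [← hb1] at this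
          linarith
      · simpa [hd1.key_eq, hj1] using hb'
    · simp at hlt
      simp only [wp_skip]
      refine ⟨by simp, hd1, ht1, ha1, ?_, by rw [hb1, hx1, hy1]; exact hle⟩
      intro p' q hpp hp' hq
      rcases hpp.eq_or_lt with rfl | hpp
      · exact (hb q hq).trans hlt
      · rw [hb1]
        exact hbest p' q hpp hp' hq
  have hW2 : 2 * k ≤ W := by
    have e : 2 ^ (H + 1) = 2 * 2 ^ H := pow_succ' _ _
    omega
  simp only [sweepStep, wp_seq, wp_setWord]
  rw [wp_branch]
  refine ⟨by simp, by simp; omega, by simp, by simp, by simp; omega, fun hb => ?_, fun hb => ?_⟩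
  · simp [hd.count, ht, hcut, hd.perm_eq, hd.num] at hb
    simp only [wp_seq, wp_setReal]
    refine ⟨by simp, by simp, ?_⟩
    refine wp_use (insertInterval_spec (p := p) h ?_ hkH hW hp2 hb ?_ ?_ ?_) ?_
    · exact hd.congr (by simp) (by simp) (by simp) (by simp) (by simp) (by simp) (by simp)
    · simp [hd.count, ht, hcut]
    · simp [hd.count, ht, hcut, hd.perm_eq]
    · exact htree.congr (by simp) (by simp) (by simp)
    rintro u1 s1 ⟨hu1, ht1⟩ hf
    refine wp_mono (finish _ ?_ ht1 ?_ ?_ ?_ ?_ ?_) ?_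
    · exact hd.congr (by simpa using hf.2 rKey rfl) (by simpa using hf.2 rWeight rfl)
        (by simpa using hf.1 wPerm rfl) (by simpa using hf.1 wRank rfl)
        (by simpa using hf.1 wCount rfl) (by simpa using hf.1 wSize rfl)
        (by simpa using hf.1 wIn rfl)
    · rw [hf.1 wJ rfl]
      simp [hd.count, ht, hcut, hd.perm_eq]
    · rw [hf.2 rAcc rfl]
      have : delta k w P Q 0 p = w (P p) := by simp [delta, hp2, hb]
      simp [hd.count, ht, hcut, hd.perm_eq, hd.weight_eq, hacc, ecut, this]
    · simpa using hf.2 rBest rfl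
    · simpa using hf.2 rSlope₁ rfl
    · simpa using hf.2 rSlope₂ rfl
    · rintro u s' ⟨hu, hs'⟩
      refine ⟨?_, hs'⟩
      simp
      omega
  · simp [hd.count, ht, hcut, hd.perm_eq, hd.num] at hb
    simp only [wp_setReal]
    refine ⟨by simp, by simp; omega, ?_⟩
    have hdelta : delta k w P Q p = delta k w P Q (p + 1) :=
      funext fun i => h.delta_right hp2 (by omega) i
    refine wp_mono (finish _ ?_ ?_ ?_ ?_ ?_ ?_ ?_) ?_
    · exact hd.congr (by simp) (by simp) (by simp) (by simp) (by simp) (by simp) (by simp)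
    · rw [hdelta]
      exact htree.congr (by simp) (by simp) (by simp)
    · simp [hd.count, ht, hcut, hd.perm_eq]
    · have : delta k w P Q 0 p = - w (P p - k) := by
        rw [delta, if_neg (by omega), if_neg (by omega), if_pos (Nat.zero_le _)]
      simp [hd.count, ht, hcut, hd.perm_eq, hd.weight_eq, hd.num, hacc, ecut, this]
    · simp
    · simp
    · simp
    · rintro u s' ⟨hu, hs'⟩
      refine ⟨?_, hs'⟩
      simp
      omega

theorem sweep_spec {s : State} (hE : s.real rKey = E) (hw : s.real rWeight = w)
    (hP : s.word wPerm = P) (hn : s.word wCount 0 = 2 * k) (hk : s.word wIn 1 = k)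
    (hH : s.word wSize 0 = 2 ^ H) (hkH : 2 * k ≤ 2 ^ H) (hHk : 2 ^ H ≤ 2 * (2 * k) + 1)
    (hW : 8 * k + 10 < W) (hl : 2 * (2 * k) + 1 < 2 ^ l) (hs : IsSorting E (2 * k) P)
    (hw0 : ∀ j < k, 0 ≤ w j) (hwE : ∀ j < k, w j ≠ 0 → E j ≤ E (k + j)) :
    wp W sweep (fun t s' => t ≤ 1000 * ((2 * k + 1) * (l + 1)) ∧
      ∀ x y, x ≤ y → stabbed k E w x y ≤
        stabbed k E w (s'.real rSlope₁ 0) (s'.real rSlope₂ 0)) s := by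
  have e : 2 ^ (H + 1) = 2 * 2 ^ H := pow_succ' _ _
  have hHl : H < l := (Nat.pow_lt_pow_iff_right (by norm_num : 1 < 2)).1 (by omega)
  unfold sweep
  simp only [wp_seq]
  refine wp_use (computeRanks_spec hP hn (by omega) hs) ?_
  rintro t1 s1 ⟨ht1, hrank⟩ hf1
  set Q := s1.word wRank with hQ
  have hev : Events k E w P Q := ⟨hs, hrank, hw0, hwE⟩
  refine wp_use (clearTree_spec (H := H) (by rw [hf1.1 wSize rfl, hH]) (by omega)) ?_
  rintro t2 s2 ⟨ht2, hclear⟩ hf2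
  simp only [wp_setReal]
  refine ⟨by simp, by simp, by simp, by simp, by simp, by simp, by simp, by simp, ?_⟩
  refine wp_mono (wp_for (n := 2 * k)
    (fun t s => SweepState k H E w P Q (2 * k - t) s) (fun _ => 0) (240 * H + 300) (by omega)
    rfl ?_ rfl ?_ ?_) ?_
  · refine ⟨⟨?_, ?_, ?_, ?_, ?_, ?_, ?_⟩, ⟨?_, ?_⟩, ?_, ?_, ?_⟩
    · simp [hf2.2 rKey rfl, hf1.2 rKey rfl, hE]
    · simp [hf2.2 rWeight rfl, hf1.2 rWeight rfl, hw]
    · simp [hf2.1 wPerm rfl, hf1.1 wPerm rfl, hP]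
    · simp [hf2.1 wRank rfl, hQ]
    · simp [hf2.1 wCount rfl, hf1.1 wCount rfl, hn]
    · simp [hf2.1 wSize rfl, hf1.1 wSize rfl, hH]
    · simp [hf2.1 wIn rfl, hf1.1 wIn rfl, hk]
    · intro i h1 h2
      left
      have a1 := hclear i (by omega)
      have a2 := hclear (2 * i) (by omega)
      have a3 := hclear (2 * i + 1) (by omega)
      simp only [sweepNode] at a1 a2 a3
      simp [sweepNode, a1, a2, a3, joinNodes]
    · intro i hi
      have a1 := hclear (2 ^ H + i) (by omega)
      simp only [sweepNode] at a1
      have a2 : delta k w P Q (2 * k) i = 0 := by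
        unfold delta
        split_ifs with h1 h2 h3
        · rfl
        · rfl
        · have := hs.lt i (by omega)
          have := hev.rank_lt (e := P i - k) (by omega)
          omega
        · rfl
      simp [sweepNode, a1, LeafValue, a2]
    · simp
      rw [hev.sum_delta 0 le_rfl]
      symm
      refine Finset.sum_eq_zero fun j hj => ?_
      have hj : j < k := by simpa using hj
      rw [if_pos (Nat.zero_le _), if_pos (hev.rank_lt (by omega)),
        if_pos (hev.rank_lt (by omega)), sub_self]
    · intro p' q h1 h2
      omega
    · have := stabbed_nonneg hev 0 0
      simp
      linarith
  · rintro t s ht h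
    simp [h.data.count]
  · rintro t s ht h hi
    refine wp_mono (sweepStep_spec (p := 2 * k - (t + 1)) (t := t) hev hkH (by omega) (by omega) hi
      (by rwa [show 2 * k - (t + 1) + 1 = 2 * k - t by omega])) ?_
    rintro u s' ⟨hu, hd, htr, ha, hb, hle⟩
    refine ⟨by omega, ?_, ?_, by simpa using ha, by simpa using hb, by simpa using hle⟩
    · exact hd.congr (by simp) (by simp) (by simp) (by simp) (by simp) (by simp) (by simp)
    · exact htr.congr (by simp) (by simp) (by simp)
  · rintro t s' ⟨ht, -, -, -, hb, hle⟩
    simp at ht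
    refine ⟨?_, fun x y hxy => ?_⟩
    · have h6 : 2 * k * (240 * H + 300 + 2 + 10) ≤ 2 * k * (240 * l + 300 + 2 + 10) := by gcongr
      have h7 : 2 * k * (240 * l + 300 + 2 + 10) = 480 * (k * l) + 624 * k := by ring
      have h9 : (2 * k + 1) * (l + 1) = 2 * (k * l) + 2 * k + l + 1 := by ring
      simp
      omega
    · refine hev.stabbed_le hxy (stabbed_nonneg hev _ _) fun p q hp hq => ?_
      exact (hb p q (by omega) hp hq).trans hle

end Sweep

/-! ### Optimal North wedges -/

section Optimal

variable {X Y : ℕ → ℝ} {nb nr : ℕ}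

/-- The red points are those with the indices `nb, …, nb + nr - 1`.  The number of them that lie
strictly above both lines. -/
noncomputable def outlierCount (X Y : ℕ → ℝ) (nb nr : ℕ) (m₁ c₁ m₂ c₂ : ℝ) : ℕ :=
  ((Finset.range nr).filter fun j =>
    m₁ * X (nb + j) + c₁ < Y (nb + j) ∧ m₂ * X (nb + j) + c₂ < Y (nb + j)).card

/-- All blue points, that is, those with index less than `nb`, are on or above the line. -/
def LineBelow (X Y : ℕ → ℝ) (nb : ℕ) (m c : ℝ) : Prop := ∀ b < nb, m * X b + c ≤ Y b

/-- The two lines define a North wedge that is optimal among the North wedges of two nonvertical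
lines. -/
structure NorthOptimal (X Y : ℕ → ℝ) (nb nr : ℕ) (m₁ c₁ m₂ c₂ : ℝ) : Prop where
  lt : m₁ < m₂
  below₁ : LineBelow X Y nb m₁ c₁
  below₂ : LineBelow X Y nb m₂ c₂
  le : ∀ m₁' c₁' m₂' c₂', m₁' < m₂' → LineBelow X Y nb m₁' c₁' → LineBelow X Y nb m₂' c₂' →
    outlierCount X Y nb nr m₁ c₁ m₂ c₂ ≤ outlierCount X Y nb nr m₁' c₁' m₂' c₂'

/-- The line with slope `m` and intercept `c` is as high as possible below the blue points; if
there are no blue points, then it is above the red points. -/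
def IsTight (X Y : ℕ → ℝ) (nb nr : ℕ) (m c : ℝ) : Prop :=
  LineBelow X Y nb m c ∧ (0 < nb → ∃ b < nb, m * X b + c = Y b) ∧
    (nb = 0 → ∀ q < nr, Y q ≤ m * X q + c)

/-- The interval `[l, u]` is the set of the slopes of the lines through `q` that pass below the
blue points, cut off to slopes in `[-D, D]` beyond which it does not change. -/
structure IsSlopeInterval (X Y : ℕ → ℝ) (nb q : ℕ) (D l u : ℝ) : Prop where
  below : ∀ m, l ≤ m → m ≤ u → ∀ b < nb, Y q - Y b ≤ m * (X q - X b)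
  mem : ∀ m, (∀ b < nb, Y q - Y b ≤ m * (X q - X b)) → l ≤ max (-D) (min m D) ∧
    max (-D) (min m D) ≤ u

theorem isSlopeInterval_of_isTangent {q f g : ℕ} {D L M l u : ℝ}
    (hq : ∀ b < nb, X b ≠ X q)
    (hL : IsTangent X Y (fun b => b < nb ∧ X b < X q) q f L)
    (hM : IsTangent (fun i => - X i) Y (fun b => b < nb ∧ - X b < - X q) q g M)
    (hLD : |L| < D) (hMD : |M| < D)
    (hl : l = if f = 0 then - D else L) (hu : u = if g = 0 then D else - M) :
    IsSlopeInterval X Y nb q D l u := by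
  rw [abs_lt] at hLD hMD
  refine ⟨fun m hlm hmu b hb => ?_, fun m hm => ⟨?_, ?_⟩⟩
  · rcases lt_or_gt_of_ne (hq b hb) with h | h
    · rcases hL with ⟨-, hL⟩ | ⟨rfl, -, hL⟩
      · exact absurd ⟨hb, h⟩ (hL b)
      · have h1 := hL b ⟨hb, h⟩
        rw [if_neg one_ne_zero] at hl
        nlinarith
    · rcases hM with ⟨-, hM⟩ | ⟨rfl, -, hM⟩
      · exact absurd ⟨hb, by linarith⟩ (hM b)
      · have h1 := hM b ⟨hb, by linarith⟩
        rw [if_neg one_ne_zero] at hu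
        nlinarith
  · rcases hL with ⟨rfl, -⟩ | ⟨rfl, ⟨b, ⟨hb, hbq⟩, hbL⟩, -⟩
    · rw [if_pos rfl] at hl
      rw [hl]
      exact le_max_left _ _
    · rw [if_neg one_ne_zero] at hl
      have := hm b hb
      rw [hbL] at this
      have : L ≤ m := le_of_mul_le_mul_right this (by linarith)
      rw [hl]
      exact le_max_of_le_right (le_min this hLD.2.le)
  · rcases hM with ⟨rfl, -⟩ | ⟨rfl, ⟨b, ⟨hb, hbq⟩, hbM⟩, -⟩
    · rw [if_pos rfl] at hu
      rw [hu]
      exact max_le (by linarith) (min_le_right _ _)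
    · rw [if_neg one_ne_zero] at hu
      have := hm b hb
      rw [hbM] at this
      have : M ≤ - m := by
        refine le_of_mul_le_mul_right (a := X b - X q) ?_ (by linarith)
        linarith
      rw [hu]
      exact max_le (by linarith) (min_le_of_left_le (by linarith))

theorem stabbed_eq_card {E w : ℕ → ℝ} (hw : ∀ j < nr, w j = if E (nr + j) < E j then 0 else 1)
    (x y : ℝ) : stabbed nr E w x y = ((Finset.range nr).filter fun j =>
      (E j ≤ x ∧ x ≤ E (nr + j)) ∨ (E j ≤ y ∧ y ≤ E (nr + j))).card := by
  classical
  rw [stabbed, Finset.card_filter, Nat.cast_sum]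
  refine Finset.sum_congr rfl fun j hj => ?_
  have hj : j < nr := by simpa using hj
  split_ifs with h
  · rw [hw j hj, if_neg]
    · simp
    · rcases h with h | h <;> linarith [h.1, h.2]
  · simp

/-- Two slopes that stab as many of the slope intervals as possible yield an optimal wedge. -/
theorem northOptimal_of_stabbed {E w : ℕ → ℝ} {D m₁ c₁ m₂ c₂ : ℝ}
    (hE : ∀ j < nr, IsSlopeInterval X Y nb (nb + j) D (E j) (E (nr + j)))
    (hw : ∀ j < nr, w j = if E (nr + j) < E j then 0 else 1)
    (hmax : ∀ x y, x ≤ y → stabbed nr E w x y ≤ stabbed nr E w m₁ m₂) (hlt : m₁ < m₂)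
    (h₁ : IsTight X Y nb nr m₁ c₁) (h₂ : IsTight X Y nb nr m₂ c₂) :
    NorthOptimal X Y nb nr m₁ c₁ m₂ c₂ := by
  classical
  refine ⟨hlt, h₁.1, h₂.1, fun m₁' c₁' m₂' c₂' hlt' hb₁ hb₂ => ?_⟩
  rcases Nat.eq_zero_or_pos nb with rfl | hnb
  · refine le_trans (le_of_eq ?_) (Nat.zero_le _)
    rw [outlierCount, Finset.card_eq_zero, Finset.filter_eq_empty_iff]
    rintro j hj ⟨h, -⟩
    have := h₁.2.2 rfl (0 + j) (by simpa using hj)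
    linarith
  · have h1 : ∀ m₁ c₁ m₂ c₂, outlierCount X Y nb nr m₁ c₁ m₂ c₂ +
        ((Finset.range nr).filter fun j =>
          ¬ (m₁ * X (nb + j) + c₁ < Y (nb + j) ∧ m₂ * X (nb + j) + c₂ < Y (nb + j))).card = nr := by
      intro m₁ c₁ m₂ c₂
      rw [outlierCount, Finset.card_filter_add_card_filter_not, Finset.card_range]
    have hle := hmax (max (-D) (min m₁' D)) (max (-D) (min m₂' D))
      (max_le_max le_rfl (min_le_min hlt'.le le_rfl))
    rw [stabbed_eq_card hw, stabbed_eq_card hw, Nat.cast_le] at hle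
    -- Every point that is stabbed by the slopes found is not an outlier.
    have h2 : ∀ m c, IsTight X Y nb nr m c → ∀ j < nr, E j ≤ m → m ≤ E (nr + j) →
        ¬ m * X (nb + j) + c < Y (nb + j) := by
      intro m c htight j hj hl hu
      obtain ⟨b, hb, hbe⟩ := htight.2.1 hnb
      have := (hE j hj).below m hl hu b hb
      linarith
    -- Every point that is not an outlier of the other wedge is stabbed by one of its slopes.
    have h3 : ∀ m c, LineBelow X Y nb m c → ∀ j < nr, ¬ m * X (nb + j) + c < Y (nb + j) →
        E j ≤ max (-D) (min m D) ∧ max (-D) (min m D) ≤ E (nr + j) := by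
      intro m c hbelow j hj hnot
      refine (hE j hj).mem m fun b hb => ?_
      have := hbelow b hb
      linarith
    have h4 : ((Finset.range nr).filter fun j =>
        (E j ≤ m₁ ∧ m₁ ≤ E (nr + j)) ∨ (E j ≤ m₂ ∧ m₂ ≤ E (nr + j))).card ≤
        ((Finset.range nr).filter fun j =>
          ¬ (m₁ * X (nb + j) + c₁ < Y (nb + j) ∧ m₂ * X (nb + j) + c₂ < Y (nb + j))).card := by
      refine Finset.card_le_card fun j hj => ?_
      simp only [Finset.mem_filter, Finset.mem_range] at hj ⊢
      refine ⟨hj.1, fun hcon => ?_⟩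
      rcases hj.2 with h | h
      · exact h2 m₁ c₁ h₁ j hj.1 h.1 h.2 hcon.1
      · exact h2 m₂ c₂ h₂ j hj.1 h.1 h.2 hcon.2
    have h5 : ((Finset.range nr).filter fun j =>
          ¬ (m₁' * X (nb + j) + c₁' < Y (nb + j) ∧ m₂' * X (nb + j) + c₂' < Y (nb + j))).card ≤
        ((Finset.range nr).filter fun j =>
          (E j ≤ max (-D) (min m₁' D) ∧ max (-D) (min m₁' D) ≤ E (nr + j)) ∨
          (E j ≤ max (-D) (min m₂' D) ∧ max (-D) (min m₂' D) ≤ E (nr + j))).card := by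
      refine Finset.card_le_card fun j hj => ?_
      simp only [Finset.mem_filter, Finset.mem_range] at hj ⊢
      refine ⟨hj.1, ?_⟩
      rcases not_and_or.1 hj.2 with h | h
      · exact Or.inl (h3 m₁' c₁' hb₁ j hj.1 h)
      · exact Or.inr (h3 m₂' c₂' hb₂ j hj.1 h)
    have h6 := h1 m₁ c₁ m₂ c₂
    have h7 := h1 m₁' c₁' m₂' c₂'
    omega

end Optimal

/-! ### The program for North wedges -/

/-- The number of points. -/
def pointCount : WExp := wat wIn (wc 0) + wat wIn (wc 1)

/-- The keys are the `x`-coordinates, multiplied by `σ`. -/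
def loadKeys (σ : ℚ) : Prog :=
  forLoop wI pointCount (.setReal rKey (wvar wI) (rc σ * rat rX (wvar wI)))

/-- Save the tangents to the points on the left. -/
def saveLeft : Prog :=
  forLoop wI (wat wIn (wc 1)) <|
    .seq (.setReal rLeft (wvar wI) (rat rTan (wat wIn (wc 0) + wvar wI))) <|
    .setWord wLeft (wvar wI) (wat wFlag (wat wIn (wc 0) + wvar wI))

/-- Compute a strict bound for the absolute values of all slopes of tangents.  Since `|x| < x² + 1`,
the sum of the numbers `x² + 1` will do. -/
def computeBound : Prog :=
  .seq (.setReal rBound (wc 0) (rc 1)) <|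
  forLoop wI (wat wIn (wc 1)) <|
    .setReal rBound (wc 0) (rvar rBound +
      (rat rLeft (wvar wI) * rat rLeft (wvar wI) + rc 1 +
        (rat rTan (wat wIn (wc 0) + wvar wI) * rat rTan (wat wIn (wc 0) + wvar wI) + rc 1)))

/-- Compute the ends of the slope intervals and their weights, which are `0` for empty intervals
and `1` otherwise.  The right end is the negative of the tangent slope in the mirrored plane. -/
def makeIntervals : Prog :=
  forLoop wI (wat wIn (wc 1)) <|
    .seq (.branch (.weq (wat wLeft (wvar wI)) (wc 0))
      (.setReal rKey (wvar wI) (rc 0 - rvar rBound))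
      (.setReal rKey (wvar wI) (rat rLeft (wvar wI)))) <|
    .seq (.branch (.weq (wat wFlag (wat wIn (wc 0) + wvar wI)) (wc 0))
      (.setReal rKey (wat wIn (wc 1) + wvar wI) (rvar rBound))
      (.setReal rKey (wat wIn (wc 1) + wvar wI)
        (rc 0 - rat rTan (wat wIn (wc 0) + wvar wI)))) <|
    .branch (.rlt (rat rKey (wat wIn (wc 1) + wvar wI)) (rat rKey (wvar wI)))
      (.setReal rWeight (wvar wI) (rc 0))
      (.setReal rWeight (wvar wI) (rc 1))

/-- Make the first slope less than the second one.  If they are equal, then one slope suffices,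
and the other one is arbitrary. -/
def orderSlopes : Prog :=
  .branch (.rlt (rvar rSlope₁) (rvar rSlope₂)) .skip <|
  .branch (.rlt (rvar rSlope₂) (rvar rSlope₁))
    (.seq (.setReal rAcc (wc 0) (rvar rSlope₁)) <|
     .seq (.setReal rSlope₁ (wc 0) (rvar rSlope₂)) <|
     .setReal rSlope₂ (wc 0) (rvar rAcc))
    (.setReal rSlope₂ (wc 0) (rvar rSlope₁ + rc 1))

/-- Compute the intercept `c` of a tight line with the slope `m`. -/
def computeIntercept (m c : ℕ) : Prog :=
  .seq (.setReal c (wc 0) (rat rY (wc 0) - rvar m * rat rX (wc 0))) <|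
  forLoop wI pointCount <|
    .branch (.or (.and (.wlt (wvar wI) (wat wIn (wc 0)))
          (.rlt (rat rY (wvar wI) - rvar m * rat rX (wvar wI)) (rvar c)))
        (.and (.weq (wat wIn (wc 0)) (wc 0))
          (.rlt (rvar c) (rat rY (wvar wI) - rvar m * rat rX (wvar wI)))))
      (.setReal c (wc 0) (rat rY (wvar wI) - rvar m * rat rX (wvar wI)))
      .skip

/-- Count the red points above the two lines. -/
def countOutliers : Prog :=
  .seq (.setWord wOutliers (wc 0) (wc 0)) <|
  forLoop wI (wat wIn (wc 1)) <|
    .branch (.and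
        (.rlt (rvar rSlope₁ * rat rX (wat wIn (wc 0) + wvar wI) + rvar rCut₁)
          (rat rY (wat wIn (wc 0) + wvar wI)))
        (.rlt (rvar rSlope₂ * rat rX (wat wIn (wc 0) + wvar wI) + rvar rCut₂)
          (rat rY (wat wIn (wc 0) + wvar wI))))
      (.setWord wOutliers (wc 0) (wvar wOutliers + wc 1))
      .skip

/-- Compute an optimal North wedge for the points in `rX` and `rY`. -/
def northWedge : Prog :=
  .seq (loadKeys 1) <|
  .seq (.setWord wCount (wc 0) pointCount) <|
  .seq tangents <|
  .seq saveLeft <|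
  .seq (loadKeys (-1)) <|
  .seq tangents <|
  .seq computeBound <|
  .seq makeIntervals <|
  .seq (.setWord wCount (wc 0) (wc 2 * wat wIn (wc 1))) <|
  .seq sort <|
  .seq sweep <|
  .seq orderSlopes <|
  .seq (computeIntercept rSlope₁ rCut₁) <|
  .seq (computeIntercept rSlope₂ rCut₂) <|
  countOutliers

section North

variable {W nb nr : ℕ} {X Y : ℕ → ℝ} {s : State}

theorem loadKeys_spec (σ : ℚ) (hnb : s.word wIn 0 = nb) (hnr : s.word wIn 1 = nr)
    (hX : s.real rX = X) (hW : nb + nr < W) :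
    wp W (loadKeys σ) (fun t s' => t ≤ 50 * (nb + nr) + 50 ∧
      ∀ i < nb + nr, s'.real rKey i = σ * X i) s := by
  unfold loadKeys
  refine wp_mono (wp_for (n := nb + nr) (fun k s => s.word wIn 0 = nb ∧ s.word wIn 1 = nr ∧
    s.real rX = X ∧ ∀ i < k, s.real rKey i = σ * X i) (fun _ => 0) 10 hW rfl ?_ rfl ?_ ?_) ?_
  · simp [hnb, hnr, hX]
  · rintro k s hk ⟨h1, h2, h3, h4⟩
    simp [pointCount, h1, h2]
    omega
  · rintro k s hk ⟨h1, h2, h3, h4⟩ hi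
    simp [h1, h2, h3, hi]
    intro i hik
    rw [Function.update_apply]
    split_ifs with h
    · rw [h]
    · exact h4 i (by omega)
  · rintro t s' ⟨ht, -, -, -, h⟩
    simp [pointCount] at ht
    exact ⟨by omega, h⟩

theorem saveLeft_spec (hnb : s.word wIn 0 = nb) (hnr : s.word wIn 1 = nr) (hW : nb + nr < W) :
    wp W saveLeft (fun t s' => t ≤ 50 * nr + 50 ∧
      ∀ j < nr, s'.real rLeft j = s.real rTan (nb + j) ∧
        s'.word wLeft j = s.word wFlag (nb + j)) s := by
  unfold saveLeft
  refine wp_mono (wp_for (n := nr) (fun k s' => s'.word wIn 0 = nb ∧ s'.word wIn 1 = nr ∧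
    s'.real rTan = s.real rTan ∧ s'.word wFlag = s.word wFlag ∧
    ∀ j < k, s'.real rLeft j = s.real rTan (nb + j) ∧
        s'.word wLeft j = s.word wFlag (nb + j)) (fun _ => 0) 20 (by omega) rfl ?_ rfl ?_ ?_) ?_
  · simp [hnb, hnr]
  · rintro k s hk ⟨h1, h2, -⟩
    simp [h2]
    omega
  · rintro k s hk ⟨h1, h2, h3, h4, h5⟩ hi
    simp [h1, h2, h3, h4, hi]
    refine ⟨by omega, fun i hik => ?_⟩
    rw [Function.update_apply, Function.update_apply]
    split_ifs with h
    · simp [h]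
    · exact h5 i (by omega)
  · rintro t s' ⟨ht, -, -, -, -, h⟩
    simp at ht
    exact ⟨by omega, h⟩

theorem abs_lt_sq_add_one (x : ℝ) : |x| < x * x + 1 := by
  rw [abs_lt]
  constructor <;> nlinarith [sq_nonneg (x - 1), sq_nonneg (x + 1)]

theorem computeBound_spec (hnb : s.word wIn 0 = nb) (hnr : s.word wIn 1 = nr) (hW : nb + nr < W) :
    wp W computeBound (fun t s' => t ≤ 60 * nr + 50 ∧
      ∀ j < nr, |s.real rLeft j| < s'.real rBound 0 ∧
        |s.real rTan (nb + j)| < s'.real rBound 0) s := by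
  unfold computeBound
  simp only [wp_seq, wp_setReal]
  refine ⟨by simp, by simp, ?_⟩
  refine wp_mono (wp_for (n := nr) (fun k s' => s'.word wIn 0 = nb ∧ s'.word wIn 1 = nr ∧
    s'.real rTan = s.real rTan ∧ s'.real rLeft = s.real rLeft ∧ 0 ≤ s'.real rBound 0 ∧
    ∀ j < k, |s.real rLeft j| < s'.real rBound 0 ∧
        |s.real rTan (nb + j)| < s'.real rBound 0) (fun _ => 0) 40 (by omega) rfl ?_ rfl ?_ ?_) ?_
  · simp [hnb, hnr]
  · rintro k s hk ⟨h1, h2, -⟩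
    simp [h2]
    omega
  · rintro k s hk ⟨h1, h2, h3, h4, h5, h6⟩ hi
    simp [h1, h2, h3, h4, hi]
    have a1 := abs_lt_sq_add_one (s.real rLeft k)
    have a2 := abs_lt_sq_add_one (s.real rTan (nb + k))
    rw [h4] at a1
    rw [h3] at a2
    have a3 := abs_nonneg (s.real rLeft k)
    have a4 := abs_nonneg (s.real rTan (nb + k))
    rw [h4] at a3
    rw [h3] at a4
    refine ⟨by omega, by linarith, fun j hj => ?_⟩
    rcases Nat.lt_or_eq_of_le hj with hj | rfl
    · have := h6 j hj
      constructor <;> linarith [this.1, this.2]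
    · constructor <;> linarith
  · rintro t s' ⟨ht, -, -, -, -, -, h⟩
    simp at ht
    exact ⟨by simp; omega, h⟩

theorem makeIntervals_spec {D : ℝ} (hnb : s.word wIn 0 = nb) (hnr : s.word wIn 1 = nr)
    (hD : s.real rBound 0 = D) (hW : nb + 2 * nr < W) :
    wp W makeIntervals (fun t s' => t ≤ 150 * nr + 50 ∧
      ∀ j < nr, s'.real rKey j = (if s.word wLeft j = 0 then - D else s.real rLeft j) ∧
        s'.real rKey (nr + j) =
          (if s.word wFlag (nb + j) = 0 then D else - s.real rTan (nb + j)) ∧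
        s'.real rWeight j = if s'.real rKey (nr + j) < s'.real rKey j then 0 else 1) s := by
  unfold makeIntervals
  refine wp_mono (wp_for (n := nr) (fun k s' => s'.word wIn 0 = nb ∧ s'.word wIn 1 = nr ∧
    s'.real rTan = s.real rTan ∧ s'.real rLeft = s.real rLeft ∧ s'.real rBound 0 = D ∧
    s'.word wFlag = s.word wFlag ∧ s'.word wLeft = s.word wLeft ∧
    ∀ j < k, s'.real rKey j = (if s.word wLeft j = 0 then - D else s.real rLeft j) ∧
        s'.real rKey (nr + j) =
          (if s.word wFlag (nb + j) = 0 then D else - s.real rTan (nb + j)) ∧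
        s'.real rWeight j = if s'.real rKey (nr + j) < s'.real rKey j then 0 else 1)
    (fun _ => 0) 100 (by omega) rfl ?_ rfl ?_ ?_) ?_
  · simp [hnb, hnr, hD]
  · rintro k s hk ⟨h1, h2, -⟩
    simp [h2]
    omega
  · rintro k s1 hk ⟨h1, h2, h3, h4, h5, h6, h7, h8⟩ hi
    have n1 : nr + k ≠ k := by omega
    have n2 : k ≠ nr + k := by omega
    have W1 : 1 ≤ W := by omega
    have W2 : nb + k ≤ W := by omega
    have W3 : nr + k ≤ W := by omega
    have hold : ∀ j < k, j ≠ k ∧ j ≠ nr + k ∧ nr + j ≠ k ∧ nr + j ≠ nr + k := by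
      intro j hj
      omega
    simp only [wp_seq, wp_branch, wp_setReal]
    refine ⟨by simp, fun hl => ⟨by simp, by simp, ?_⟩, fun hl => ⟨by simp, by simp, ?_⟩⟩ <;>
    refine ⟨by simp [h1, hi, W2], fun hf => ⟨by simp [h2, hi, W1, W3], by simp, ?_⟩,
      fun hf => ⟨by simp [h2, hi, W1, W3], by simp [h1, hi, W2], ?_⟩⟩ <;>
    refine ⟨by simp [h2, hi, W1, W3], fun hw => ⟨by simp, by simp, ?_⟩,
      fun hw => ⟨by simp, by simp, ?_⟩⟩ <;>
    · simp [hi, h7] at hl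
      simp [hi, h6, h1] at hf
      simp [hi, h2, h1, h3, h4, h5] at hw
      simp [h1, h2, h3, h4, h5, h6, h7, hi]
      intro j hj
      rcases Nat.lt_or_eq_of_le hj with hj | rfl
      · have := hold j hj
        simpa [this] using h8 j hj
      · have n3 : nr ≠ 0 := by omega
        simp [n3] at hw
        simp [hl, hf, n3]
        linarith
  · rintro t s' ⟨ht, -, -, -, -, -, -, -, h⟩
    simp at ht
    exact ⟨by omega, h⟩

end North

section North

variable {W nb nr : ℕ} {X Y : ℕ → ℝ} {s : State}

theorem computeIntercept_spec {m c : ℕ} {x : ℝ} (hnb : s.word wIn 0 = nb) (hnr : s.word wIn 1 = nr)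
    (hX : s.real rX = X) (hY : s.real rY = Y) (hx : s.real m 0 = x)
    (hc : c ≠ rX ∧ c ≠ rY ∧ c ≠ m) (hpos : 0 < nb + nr) (hW : nb + nr < W) :
    wp W (computeIntercept m c) (fun t s' => t ≤ 150 * (nb + nr) + 100 ∧
      IsTight X Y nb nr x (s'.real c 0)) s := by
  obtain ⟨c1, c2, c3⟩ := hc
  unfold computeIntercept
  simp only [wp_seq, wp_setReal]
  refine ⟨by simp, by simp, ?_⟩
  refine wp_mono (wp_for (n := nb + nr) (fun k s' => s'.word wIn 0 = nb ∧ s'.word wIn 1 = nr ∧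
    s'.real rX = X ∧ s'.real rY = Y ∧ s'.real m 0 = x ∧
    (0 < nb → (∃ b < nb, s'.real c 0 = Y b - x * X b) ∧
      ∀ b < nb, b < k → s'.real c 0 ≤ Y b - x * X b) ∧
    (nb = 0 → ∀ q < k, Y q - x * X q ≤ s'.real c 0)) (fun _ => 0) 100 hW rfl ?_ rfl ?_ ?_) ?_
  · simp [hnb, hnr, hX, hY, hx, c1.symm, c2.symm, c3.symm]
    exact fun h => ⟨0, h, by ring⟩
  · rintro k s hk ⟨h1, h2, -⟩
    simp [pointCount, h1, h2]
    omega
  · rintro k s hk ⟨h1, h2, h3, h4, h5, h6, h7⟩ hi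
    rw [wp_branch]
    refine ⟨by simp, fun hb => ?_, fun hb => ?_⟩
    · simp [h1, h3, h4, h5, hi] at hb
      simp [h1, h2, h3, h4, h5, hi, c1.symm, c2.symm, c3.symm]
      refine ⟨fun hn => ?_, fun hn q hq => ?_⟩
      · have hb : k < nb ∧ Y k - x * X k < s.real c 0 := by
          rcases hb with hb | hb
          · exact hb
          · omega
        refine ⟨⟨k, hb.1, rfl⟩, fun b hbn hbk => ?_⟩
        rcases Nat.lt_or_eq_of_le hbk with hbk | rfl
        · have := (h6 hn).2 b hbn hbk
          linarith
        · linarith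
      · have hb : s.real c 0 < Y k - x * X k := by
          rcases hb with hb | hb
          · omega
          · exact hb.2
        rcases Nat.lt_or_eq_of_le hq with hq | rfl
        · have := h7 hn q hq
          linarith
        · linarith
    · simp [h1, h3, h4, h5, hi] at hb
      simp [h1, h2, h3, h4, h5]
      refine ⟨fun hn => ⟨?_, fun b hbn hbk => ?_⟩, fun hn q hq => ?_⟩
      · simpa using (h6 hn).1
      · rcases Nat.lt_or_eq_of_le hbk with hbk | rfl
        · simpa using (h6 hn).2 b hbn hbk
        · simpa using hb.1 hbn
      · rcases Nat.lt_or_eq_of_le hq with hq | rfl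
        · simpa using h7 hn q hq
        · simpa using hb.2 hn
  · rintro t s' ⟨ht, -, -, -, -, -, h6, h7⟩
    simp [pointCount] at ht
    refine ⟨by simp; omega, fun b hb => ?_, fun hn => ?_, fun hn q hq => ?_⟩
    · have := (h6 (by omega)).2 b hb (by omega)
      linarith
    · obtain ⟨b, hb, hbe⟩ := (h6 hn).1
      exact ⟨b, hb, by linarith⟩
    · have := h7 hn q (by omega)
      linarith

theorem countOutliers_spec {m₁ c₁ m₂ c₂ : ℝ} (hnb : s.word wIn 0 = nb) (hnr : s.word wIn 1 = nr)
    (hX : s.real rX = X) (hY : s.real rY = Y) (hm₁ : s.real rSlope₁ 0 = m₁)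
    (hc₁ : s.real rCut₁ 0 = c₁) (hm₂ : s.real rSlope₂ 0 = m₂) (hc₂ : s.real rCut₂ 0 = c₂)
    (hW : nb + nr < W) :
    wp W countOutliers (fun t s' => t ≤ 150 * nr + 100 ∧
      s'.word wOutliers 0 = outlierCount X Y nb nr m₁ c₁ m₂ c₂) s := by
  unfold countOutliers
  simp only [wp_seq, wp_setWord]
  refine ⟨by simp, by simp, ?_⟩
  refine wp_mono (wp_for (n := nr) (fun k s' => s'.word wIn 0 = nb ∧ s'.word wIn 1 = nr ∧
    s'.real = s.real ∧ s'.word wOutliers 0 = outlierCount X Y nb k m₁ c₁ m₂ c₂)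
    (fun _ => 0) 100 (by omega) rfl ?_ rfl ?_ ?_) ?_
  · simp [hnb, hnr, outlierCount]
  · rintro k s hk ⟨h1, h2, -⟩
    simp [h2]
    omega
  · rintro k s hk ⟨h1, h2, h3, h4⟩ hi
    have hle : outlierCount X Y nb k m₁ c₁ m₂ c₂ ≤ k :=
      (Finset.card_filter_le _ _).trans (by simp)
    rw [wp_branch]
    refine ⟨by simp [h1, hi]; omega, fun hb => ?_, fun hb => ?_⟩
    · simp [h1, h3, hX, hY, hm₁, hm₂, hc₁, hc₂, hi] at hb
      simp [h1, h2, h3, h4]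
      refine ⟨by omega, ?_⟩
      simp [outlierCount, Finset.range_add_one, Finset.filter_insert, hb]
    · simp [h1, h3, hX, hY, hm₁, hm₂, hc₁, hc₂, hi] at hb
      simp [h1, h2, h3, h4]
      rw [outlierCount, outlierCount, Finset.range_add_one, Finset.filter_insert, if_neg]
      rintro ⟨hb1, hb2⟩
      linarith [hb hb1]
  · rintro t s' ⟨ht, -, -, -, h⟩
    simp at ht
    exact ⟨by simp; omega, h⟩

theorem stabbed_comm (k : ℕ) (E w : ℕ → ℝ) (x y : ℝ) : stabbed k E w x y = stabbed k E w y x := by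
  classical
  simp only [stabbed, or_comm]

theorem orderSlopes_spec {E w : ℕ → ℝ} (hw : ∀ j < nr, 0 ≤ w j) :
    wp W orderSlopes (fun t s' => t ≤ 50 ∧ s'.real rSlope₁ 0 < s'.real rSlope₂ 0 ∧
      stabbed nr E w (s.real rSlope₁ 0) (s.real rSlope₂ 0) ≤
        stabbed nr E w (s'.real rSlope₁ 0) (s'.real rSlope₂ 0)) s := by
  classical
  simp only [orderSlopes, wp_branch, wp_seq, wp_skip, wp_setReal]
  refine ⟨by simp, fun h1 => ?_, fun h1 => ⟨by simp, fun h2 => ?_, fun h2 => ?_⟩⟩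
  · simp at h1
    simp [h1]
  · simp at h2
    simp [h2, stabbed_comm nr E w (s.real rSlope₂ 0)]
  · simp at h1 h2
    simp
    refine Finset.sum_le_sum fun j hj => ?_
    rw [le_antisymm h1 h2]
    simp only [or_self]
    split_ifs with h3 h4 h4
    · exact le_rfl
    · exact absurd (Or.inl h3) h4
    · exact hw j (by simpa using hj)
    · exact le_rfl

theorem IsTangent.congr {X' : ℕ → ℝ} {q f : ℕ} {L : ℝ} (hb : ∀ b < nb, X' b = X b)
    (hq : X' q = X q) (h : IsTangent X' Y (fun b => b < nb ∧ X' b < X' q) q f L) :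
    IsTangent X Y (fun b => b < nb ∧ X b < X q) q f L := by
  rcases h with ⟨h1, h2⟩ | ⟨h1, ⟨b, hb1, hb2⟩, h3⟩
  · refine Or.inl ⟨h1, fun b hb' => h2 b ⟨hb'.1, ?_⟩⟩
    rw [hb b hb'.1, hq]
    exact hb'.2
  · refine Or.inr ⟨h1, ⟨b, ⟨hb1.1, ?_⟩, ?_⟩, fun b' hb' => ?_⟩
    · rw [← hb b hb1.1, ← hq]
      exact hb1.2
    · rw [← hb b hb1.1, ← hq]
      exact hb2
    · have := h3 b' ⟨hb'.1, by rw [hb b' hb'.1, hq]; exact hb'.2⟩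
      rwa [hb b' hb'.1, hq] at this

theorem northWedge_spec {l : ℕ} (hnb : s.word wIn 0 = nb) (hnr : s.word wIn 1 = nr)
    (hX : s.real rX = X) (hY : s.real rY = Y)
    (hinj : ∀ i < nb + nr, ∀ j < nb + nr, X i = X j → i = j) (hpos : 0 < nb + nr)
    (hW : 8 * (nb + nr) + 10 < W) (hl : 2 * (2 * (nb + nr)) + 1 < 2 ^ l) :
    wp W northWedge (fun t s' => t ≤ 20000 * ((nb + nr + 1) * (l + 1)) ∧
      s'.word wOutliers 0 = outlierCount X Y nb nr (s'.real rSlope₁ 0) (s'.real rCut₁ 0)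
        (s'.real rSlope₂ 0) (s'.real rCut₂ 0) ∧
      NorthOptimal X Y nb nr (s'.real rSlope₁ 0) (s'.real rCut₁ 0)
        (s'.real rSlope₂ 0) (s'.real rCut₂ 0)) s := by
  unfold northWedge
  simp only [wp_seq]
  refine wp_use (loadKeys_spec 1 hnb hnr hX (by omega)) ?_
  rintro t1 s1 ⟨ht1, hk1⟩ hf1
  simp only [wp_setWord]
  have i1 : s1.word wIn = s.word wIn := hf1.1 wIn rfl
  refine ⟨by simp, by simp [pointCount, i1, hnb, hnr]; omega, ?_⟩
  refine wp_use (tangents_spec (n := nb + nr) (nb := nb) (l := l) (X := s1.real rKey) (Y := Y)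
    (by simp) (by simp [hf1.2 rY rfl, hY]) (by simp [pointCount, i1, hnb, hnr])
    (by simp [i1, hnb]) (by omega) (by omega) (by omega)
    (fun i hi j hj h => hinj i hi j hj (by simpa [hk1 i hi, hk1 j hj] using h))) ?_
  rintro t2 s2 ⟨ht2, htan2⟩ hf2
  have i2 : s2.word wIn = s.word wIn := by simp [hf2.1 wIn rfl, i1]
  refine wp_use (saveLeft_spec (nb := nb) (nr := nr) (by rw [i2, hnb]) (by rw [i2, hnr])
    (by omega)) ?_
  rintro t3 s3 ⟨ht3, hleft⟩ hf3
  have i3 : s3.word wIn = s.word wIn := by simp [hf3.1 wIn rfl, i2]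
  have x3 : s3.real rX = X := by simp [hf3.2 rX rfl, hf2.2 rX rfl, hf1.2 rX rfl, hX]
  have y3 : s3.real rY = Y := by simp [hf3.2 rY rfl, hf2.2 rY rfl, hf1.2 rY rfl, hY]
  have n3 : s3.word wCount 0 = nb + nr := by
    simp [hf3.1 wCount rfl, hf2.1 wCount rfl, pointCount, i1, hnb, hnr]
  refine wp_use (loadKeys_spec (-1) (by rw [i3, hnb]) (by rw [i3, hnr]) x3 (by omega)) ?_
  rintro t4 s4 ⟨ht4, hk4⟩ hf4
  have i4 : s4.word wIn = s.word wIn := by simp [hf4.1 wIn rfl, i3]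
  refine wp_use (tangents_spec (n := nb + nr) (nb := nb) (l := l) (X := s4.real rKey) (Y := Y)
    rfl (by simp [hf4.2 rY rfl, y3]) (by simp [hf4.1 wCount rfl, n3])
    (by simp [i4, hnb]) (by omega) (by omega) (by omega)
    (fun i hi j hj h => hinj i hi j hj (by simpa [hk4 i hi, hk4 j hj] using h))) ?_
  rintro t5 s5 ⟨ht5, htan5⟩ hf5
  have i5 : s5.word wIn = s.word wIn := by simp [hf5.1 wIn rfl, i4]
  refine wp_use (computeBound_spec (nb := nb) (nr := nr) (by rw [i5, hnb]) (by rw [i5, hnr])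
    (by omega)) ?_
  rintro t6 s6 ⟨ht6, hbound⟩ hf6
  have i6 : s6.word wIn = s.word wIn := by simp [hf6.1 wIn rfl, i5]
  refine wp_use (makeIntervals_spec (nb := nb) (nr := nr) (by rw [i6, hnb]) (by rw [i6, hnr]) rfl
    (by omega)) ?_
  rintro t7 s7 ⟨ht7, hint⟩ hf7
  have i7 : s7.word wIn = s.word wIn := by simp [hf7.1 wIn rfl, i6]
  refine ⟨by simp, by simp [i7, hnr]; omega, ?_⟩
  set E := s7.real rKey with hE
  set w := s7.real rWeight with hw
  refine wp_use (sort_spec (n := 2 * nr) (l := l) (key := E) (by simp [hE]) (by simp [i7, hnr])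
    (by omega) (by omega)) ?_
  rintro t8 s8 ⟨ht8, hsort, H, hH, hle1, hle2⟩ hf8
  have i8 : s8.word wIn = s.word wIn := by simp [hf8.1 wIn rfl, i7]
  have hwE : ∀ j < nr, w j = if E (nr + j) < E j then 0 else 1 := fun j hj => (hint j hj).2.2
  refine wp_use (sweep_spec (k := nr) (H := H) (l := l) (E := E) (w := w)
    (by simp [hf8.2 rKey rfl, hE])
    (by simp [hf8.2 rWeight rfl, hw]) rfl (by simp [hf8.1 wCount rfl, i7, hnr]) (by rw [i8, hnr])
    hH hle1 hle2 (by omega) (by omega) hsort ?_ ?_) ?_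
  · intro j hj
    rw [hwE j hj]
    split_ifs <;> norm_num
  · intro j hj
    rw [hwE j hj]
    split_ifs with h
    · simp
    · exact fun _ => not_lt.1 h
  rintro t9 s9 ⟨ht9, hmax⟩ hf9
  have i9 : s9.word wIn = s.word wIn := by simp [hf9.1 wIn rfl, i8]
  have x9 : s9.real rX = X := by
    simp [hf9.2 rX rfl, hf8.2 rX rfl, hf7.2 rX rfl, hf6.2 rX rfl, hf5.2 rX rfl, hf4.2 rX rfl, x3]
  have y9 : s9.real rY = Y := by
    simp [hf9.2 rY rfl, hf8.2 rY rfl, hf7.2 rY rfl, hf6.2 rY rfl, hf5.2 rY rfl, hf4.2 rY rfl, y3]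
  have hinterval : ∀ j < nr,
      IsSlopeInterval X Y nb (nb + j) (s6.real rBound 0) (E j) (E (nr + j)) := by
    intro j hj
    have a1 := htan2 (nb + j) (by omega) (by omega)
    have a2 := htan5 (nb + j) (by omega) (by omega)
    have a3 := hint j hj
    have a4 := hbound j hj
    have a5 := hleft j hj
    rw [← a5.1, ← a5.2, ← hf4.2 rLeft rfl, ← hf5.2 rLeft rfl, ← hf6.2 rLeft rfl,
      ← hf4.1 wLeft rfl, ← hf5.1 wLeft rfl, ← hf6.1 wLeft rfl] at a1
    rw [← hf6.1 wFlag rfl, ← hf6.2 rTan rfl] at a2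
    rw [← hf6.2 rLeft rfl, ← hf6.2 rTan rfl] at a4
    refine isSlopeInterval_of_isTangent (fun b hb h => ?_)
      (a1.congr (X := X) (fun b hb => ?_) ?_)
      (a2.congr (X := fun i => - X i) (fun b hb => ?_) ?_) a4.1 a4.2 a3.1 a3.2.1
    · have := hinj b (by omega) (nb + j) (by omega) h
      omega
    · simp [hk1 b (by omega)]
    · simp [hk1 (nb + j) (by omega)]
    · simp [hk4 b (by omega)]
    · simp [hk4 (nb + j) (by omega)]
  have finish : ∀ t10 s10, t10 ≤ 50 → s10.word = s9.word → s10.real rX = X → s10.real rY = Y →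
      s10.real rSlope₁ 0 < s10.real rSlope₂ 0 →
      (∀ x y, x ≤ y → stabbed nr E w x y ≤
        stabbed nr E w (s10.real rSlope₁ 0) (s10.real rSlope₂ 0)) →
      wp W (computeIntercept rSlope₁ rCut₁) (fun t11 s11 =>
        wp W (computeIntercept rSlope₂ rCut₂) (fun t12 s12 =>
          wp W countOutliers (fun t13 s' =>
            t10 + t11 + t12 + t13 ≤ 500 * (nb + nr) + 500 ∧
            s'.word wOutliers 0 = outlierCount X Y nb nr (s'.real rSlope₁ 0) (s'.real rCut₁ 0)
              (s'.real rSlope₂ 0) (s'.real rCut₂ 0) ∧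
            NorthOptimal X Y nb nr (s'.real rSlope₁ 0) (s'.real rCut₁ 0)
              (s'.real rSlope₂ 0) (s'.real rCut₂ 0)) s12) s11) s10 := by
    intro t10 s10 ht10 hw10 x10 y10 hlt hmax10
    have i10 : s10.word wIn = s.word wIn := by rw [hw10, i9]
    refine wp_use (computeIntercept_spec (nb := nb) (nr := nr) (by rw [i10, hnb]) (by rw [i10, hnr])
      x10 y10 rfl (by simp) hpos (by omega)) ?_
    rintro t11 s11 ⟨ht11, htight1⟩ hf11
    have i11 : s11.word wIn = s.word wIn := by rw [hf11.1 wIn rfl, i10]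
    refine wp_use (computeIntercept_spec (nb := nb) (nr := nr) (X := X) (Y := Y)
      (by rw [i11, hnb]) (by rw [i11, hnr])
      (by rw [hf11.2 rX rfl, x10]) (by rw [hf11.2 rY rfl, y10]) rfl (by simp) hpos (by omega)) ?_
    rintro t12 s12 ⟨ht12, htight2⟩ hf12
    have i12 : s12.word wIn = s.word wIn := by rw [hf12.1 wIn rfl, i11]
    refine wp_use (countOutliers_spec (nb := nb) (nr := nr) (X := X) (Y := Y)
      (by rw [i12, hnb]) (by rw [i12, hnr]) (by rw [hf12.2 rX rfl, hf11.2 rX rfl, x10])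
      (by rw [hf12.2 rY rfl, hf11.2 rY rfl, y10]) rfl rfl rfl rfl (by omega)) ?_
    rintro t13 s13 ⟨ht13, hout⟩ hf13
    refine ⟨by omega, ?_, ?_⟩
    · rw [hout, hf13.2 rSlope₁ rfl, hf13.2 rSlope₂ rfl, hf13.2 rCut₁ rfl, hf13.2 rCut₂ rfl]
    · rw [hf13.2 rSlope₁ rfl, hf13.2 rSlope₂ rfl, hf13.2 rCut₁ rfl, hf13.2 rCut₂ rfl]
      rw [← hf11.2 rSlope₁ rfl, ← hf12.2 rSlope₁ rfl, ← hf11.2 rSlope₂ rfl,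
        ← hf12.2 rSlope₂ rfl] at hmax10 hlt
      rw [← hf11.2 rSlope₁ rfl, ← hf12.2 rSlope₁ rfl, ← hf12.2 rCut₁ rfl] at htight1
      rw [← hf12.2 rSlope₂ rfl] at htight2
      exact northOptimal_of_stabbed hinterval hwE hmax10 hlt htight1 htight2
  have hcost : ∀ t, t ≤ 500 * (nb + nr) + 600 →
      t1 + ((wc 0).cost + pointCount.cost + 1 + (t2 + (t3 + (t4 + (t5 + (t6 + (t7 +
        ((wc 0).cost + (wc 2 * wat wIn (wc 1)).cost + 1 + (t8 + (t9 + t)))))))))) ≤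
      20000 * ((nb + nr + 1) * (l + 1)) := by
    intro t ht
    have h1 : (2 * nr + 1) * (l + 1) ≤ 2 * ((nb + nr + 1) * (l + 1)) := by
      rw [← mul_assoc]
      gcongr
      omega
    have h2 : (nb + nr + 1) * 1 ≤ (nb + nr + 1) * (l + 1) := by
      gcongr
      omega
    generalize (nb + nr + 1) * (l + 1) = M at *
    simp [pointCount]
    omega
  refine wp_use (orderSlopes_spec (nr := nr) (E := E) (w := w) (s := s9) ?_) ?_
  · intro j hj
    rw [hwE j hj]
    split_ifs <;> norm_num
  rintro t10 s10 ⟨ht10, hlt, hge⟩ hf10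
  refine wp_mono (finish t10 s10 ht10 ?_ (by rw [hf10.2 rX rfl, x9]) (by rw [hf10.2 rY rfl, y9])
    hlt fun x y hxy => (hmax x y hxy).trans hge) ?_
  · funext a
    exact hf10.1 a rfl
  intro t11 s11 h11
  refine wp_mono h11 ?_
  intro t12 s12 h12
  refine wp_mono h12 ?_
  rintro t13 s13 ⟨ht, h⟩
  refine ⟨hcost _ ?_, h⟩
  omega

end North

end RealRAM

/-! ### Wedges and their reflections -/

section Geometry

open Filter

/-- The sign of the reflection which turns wedges of the given kind into North wedges. -/
def WedgeKind.sign : WedgeKind → ℚ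
  | .north => 1
  | .south => -1

theorem WedgeKind.sign_mul_self (K : WedgeKind) : (K.sign : ℝ) * K.sign = 1 := by
  cases K <;> norm_num [WedgeKind.sign]

/-- The closed half-plane of a line that is used by wedges of the given kind. -/
def Line.side (K : WedgeKind) (ℓ : Line) : Set (ℝ × ℝ) :=
  match K with
  | .north => ℓ.upper
  | .south => ℓ.lower

theorem Wedge.region_eq (w : Wedge) : w.region = w.line₁.side w.kind ∩ w.line₂.side w.kind := by
  obtain ⟨K, l₁, l₂, h⟩ := w
  cases K <;> rfl

theorem Line.mem_side_nonvertical {K : WedgeKind} {m c : ℝ} {p : ℝ × ℝ} :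
    p ∈ (Line.nonvertical m c).side K ↔ m * (K.sign * p.1) + K.sign * c ≤ K.sign * p.2 := by
  cases K
  · simp [Line.side, Line.upper, WedgeKind.sign]
  · simp only [Line.side, Line.lower, WedgeKind.sign, Set.mem_ofPred_eq]
    push_cast
    constructor <;> intro h <;> linarith

theorem Line.mem_side_vertical {K : WedgeKind} {a : ℝ} {p : ℝ × ℝ} :
    p ∈ (Line.vertical a).side K ↔ K.sign * a ≤ K.sign * p.1 := by
  cases K
  · simp [Line.side, Line.upper, WedgeKind.sign]
  · simp [Line.side, Line.lower, WedgeKind.sign]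

theorem interior_preimage_Ici (L : ℝ × ℝ →L[ℝ] ℝ) (hL : Function.Surjective L) (a : ℝ) :
    interior (L ⁻¹' Set.Ici a) = L ⁻¹' Set.Ioi a := by
  rw [← (L.isOpenMap hL).preimage_interior_eq_interior_preimage L.continuous, interior_Ici]

theorem Line.mem_interior_side_nonvertical {K : WedgeKind} {m c : ℝ} {p : ℝ × ℝ} :
    p ∈ interior ((Line.nonvertical m c).side K) ↔
      m * (K.sign * p.1) + K.sign * c < K.sign * p.2 := by
  let L : ℝ × ℝ →L[ℝ] ℝ := (K.sign : ℝ) • ContinuousLinearMap.snd ℝ ℝ ℝ -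
    (m * K.sign) • ContinuousLinearMap.fst ℝ ℝ ℝ
  have hL : ∀ p : ℝ × ℝ, L p = K.sign * p.2 - m * K.sign * p.1 := fun p => rfl
  have hsurj : Function.Surjective L := fun y =>
    ⟨(0, K.sign * y), by rw [hL, ← mul_assoc, K.sign_mul_self]; ring⟩
  have hset : (Line.nonvertical m c).side K = L ⁻¹' Set.Ici (K.sign * c) := by
    ext p
    rw [Line.mem_side_nonvertical, Set.mem_preimage, Set.mem_Ici, hL]
    constructor <;> intro h <;> linarith
  rw [hset, interior_preimage_Ici L hsurj, Set.mem_preimage, Set.mem_Ioi, hL]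
  constructor <;> intro h <;> linarith

theorem Line.mem_interior_side_vertical {K : WedgeKind} {a : ℝ} {p : ℝ × ℝ} :
    p ∈ interior ((Line.vertical a).side K) ↔ K.sign * a < K.sign * p.1 := by
  let L : ℝ × ℝ →L[ℝ] ℝ := (K.sign : ℝ) • ContinuousLinearMap.fst ℝ ℝ ℝ
  have hL : ∀ p : ℝ × ℝ, L p = K.sign * p.1 := fun p => rfl
  have hsurj : Function.Surjective L := fun y =>
    ⟨(K.sign * y, 0), by rw [hL, ← mul_assoc, K.sign_mul_self]; ring⟩
  have hset : (Line.vertical a).side K = L ⁻¹' Set.Ici (K.sign * a) := by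
    ext p
    rw [Line.mem_side_vertical, Set.mem_preimage, Set.mem_Ici, hL]
  rw [hset, interior_preimage_Ici L hsurj, Set.mem_preimage, Set.mem_Ioi, hL]

/-- A vertical line can be replaced by a steep one, without new red points on the wrong side. -/
theorem exists_steep_line (K : WedgeKind) {B R : Finset (ℝ × ℝ)}
    (hBR : ∀ b ∈ B, ∀ r ∈ R, b.1 ≠ r.1) {a : ℝ}
    (hB : (B : Set (ℝ × ℝ)) ⊆ (Line.vertical a).side K) (m₂ : ℝ) :
    ∃ m < m₂, ∃ c, (B : Set (ℝ × ℝ)) ⊆ (Line.nonvertical m c).side K ∧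
      ∀ r ∈ R, r ∈ interior ((Line.nonvertical m c).side K) →
        r ∈ interior ((Line.vertical a).side K) := by
  have hσ := K.sign_mul_self
  set σ : ℝ := ((K.sign : ℚ) : ℝ) with hσdef
  have hB' : ∀ b ∈ B, σ * a ≤ σ * b.1 := fun b hb => Line.mem_side_vertical.1 (hB hb)
  have hev : ∀ᶠ M : ℝ in atTop, ∀ b ∈ B, ∀ r ∈ R, σ * r.1 ≤ σ * a →
      σ * r.2 + M * (σ * r.1) ≤ σ * b.2 + M * (σ * b.1) := by
    rw [Finset.eventually_all]
    intro b hb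
    rw [Finset.eventually_all]
    intro r hr
    by_cases hra : σ * r.1 ≤ σ * a
    · have hlt : 0 < σ * b.1 - σ * r.1 := by
        refine sub_pos.2 (lt_of_le_of_ne (hra.trans (hB' b hb)) fun h => hBR b hb r hr ?_)
        have := congrArg (σ * ·) h
        simp only [← mul_assoc, hσ, one_mul] at this
        exact this.symm
      filter_upwards [eventually_ge_atTop ((σ * r.2 - σ * b.2) / (σ * b.1 - σ * r.1))] with M hM _
      rw [div_le_iff₀ hlt] at hM
      linarith
    · exact Eventually.of_forall fun M h => absurd h hra
  obtain ⟨M, hM, hMm⟩ := (hev.and (eventually_gt_atTop (-m₂))).exists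
  obtain ⟨c, hc1, hc2⟩ : ∃ c, (∀ b ∈ B, c ≤ σ * b.2 + M * (σ * b.1)) ∧
      ∀ r ∈ R, σ * r.1 ≤ σ * a → σ * r.2 + M * (σ * r.1) ≤ c := by
    rcases B.eq_empty_or_nonempty with rfl | hne
    · obtain ⟨c, hc⟩ := (R.image fun r => σ * r.2 + M * (σ * r.1)).exists_le
      exact ⟨c, by simp, fun r hr _ => hc _ (Finset.mem_image_of_mem _ hr)⟩
    · obtain ⟨b, hb, hmin⟩ := B.exists_min_image (fun b => σ * b.2 + M * (σ * b.1)) hne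
      exact ⟨_, hmin, fun r hr h => hM b hb r hr h⟩
  have hcc : σ * (σ * c) = c := by rw [← mul_assoc, hσ, one_mul]
  refine ⟨-M, by linarith, σ * c, fun b hb => ?_, fun r hr h => ?_⟩
  · rw [Line.mem_side_nonvertical, ← hσdef, hcc]
    linarith [hc1 b hb]
  · rw [Line.mem_interior_side_nonvertical, ← hσdef, hcc] at h
    rw [Line.mem_interior_side_vertical, ← hσdef]
    by_contra! hcon
    linarith [hc2 r hr hcon]

theorem Wedge.redOutliers_le {w w' : Wedge} {R : Finset (ℝ × ℝ)}
    (h : ∀ r ∈ R, r ∈ interior w.region → r ∈ interior w'.region) :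
    w.redOutliers R ≤ w'.redOutliers R :=
  Set.ncard_le_ncard (fun r hr => ⟨hr.1, h r hr.1 hr.2⟩) (R.finite_toSet.inter_of_left _)

/-- For each wedge there is one with two nonvertical lines that is at least as good. -/
theorem Wedge.exists_nonvertical (w : Wedge) {B R : Finset (ℝ × ℝ)}
    (hBR : ∀ b ∈ B, ∀ r ∈ R, b.1 ≠ r.1) (hB : (B : Set (ℝ × ℝ)) ⊆ w.region) :
    ∃ w' : Wedge, w'.kind = w.kind ∧ (B : Set (ℝ × ℝ)) ⊆ w'.region ∧
      w'.redOutliers R ≤ w.redOutliers R ∧ ∃ m₁ c₁ m₂ c₂, w'.line₁ = .nonvertical m₁ c₁ ∧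
        w'.line₂ = .nonvertical m₂ c₂ := by
  obtain ⟨K, l₁, l₂, hlt⟩ := w
  rcases l₂ with ⟨m₂, c₂⟩ | a₂
  · rcases l₁ with ⟨m₁, c₁⟩ | a₁
    · exact ⟨_, rfl, hB, le_rfl, m₁, c₁, m₂, c₂, rfl, rfl⟩
    · rw [Wedge.region_eq, Set.subset_inter_iff] at hB
      obtain ⟨m, hm, c, hc1, hc2⟩ := exists_steep_line K hBR hB.1 m₂
      refine ⟨⟨K, .nonvertical m c, .nonvertical m₂ c₂, WithBot.coe_lt_coe.2 hm⟩, rfl, ?_, ?_,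
        m, c, m₂, c₂, rfl, rfl⟩
      · rw [Wedge.region_eq]
        exact Set.subset_inter hc1 hB.2
      · refine Wedge.redOutliers_le fun r hr h => ?_
        rw [Wedge.region_eq, interior_inter] at h ⊢
        exact ⟨hc2 r hr h.1, h.2⟩
  · exact absurd hlt not_lt_bot

end Geometry

namespace RealRAM

section Lists

variable {bs rs : List (ℝ × ℝ)} {B R : Finset (ℝ × ℝ)} {X Y : ℕ → ℝ} {K : WedgeKind}

/-- The coordinate arrays hold the points of the two lists, reflected according to the kind of
wedge. -/
structure Represents (K : WedgeKind) (bs rs : List (ℝ × ℝ)) (X Y : ℕ → ℝ) : Prop where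
  blue : ∀ i < bs.length, X i = K.sign * (bs.getD i (0, 0)).1 ∧
    Y i = K.sign * (bs.getD i (0, 0)).2
  red : ∀ j < rs.length, X (bs.length + j) = K.sign * (rs.getD j (0, 0)).1 ∧
    Y (bs.length + j) = K.sign * (rs.getD j (0, 0)).2

theorem exists_getD_iff {l : List (ℝ × ℝ)} {S : Finset (ℝ × ℝ)} (hl : l.Perm S.toList)
    {p : ℝ × ℝ} : p ∈ S ↔ ∃ i < l.length, l.getD i (0, 0) = p := by
  rw [← Finset.mem_toList, ← hl.mem_iff, List.mem_iff_getElem]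
  constructor
  · rintro ⟨i, hi, rfl⟩
    exact ⟨i, hi, List.getD_eq_getElem _ _ hi⟩
  · rintro ⟨i, hi, rfl⟩
    exact ⟨i, hi, (List.getD_eq_getElem _ _ hi).symm⟩

theorem getD_inj {l : List (ℝ × ℝ)} {S : Finset (ℝ × ℝ)} (hl : l.Perm S.toList) {i j : ℕ}
    (hi : i < l.length) (hj : j < l.length) (h : l.getD i (0, 0) = l.getD j (0, 0)) : i = j := by
  rw [List.getD_eq_getElem _ _ hi, List.getD_eq_getElem _ _ hj] at h
  exact ((hl.nodup_iff.2 S.nodup_toList).getElem_inj_iff).1 h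

theorem Represents.lineBelow_iff (h : Represents K bs rs X Y) (hb : bs.Perm B.toList) {m c : ℝ} :
    LineBelow X Y bs.length m c ↔
      (B : Set (ℝ × ℝ)) ⊆ (Line.nonvertical m (K.sign * c)).side K := by
  have hc : (K.sign : ℝ) * (K.sign * c) = c := by rw [← mul_assoc, K.sign_mul_self, one_mul]
  constructor
  · intro hm p hp
    obtain ⟨i, hi, rfl⟩ := (exists_getD_iff hb).1 hp
    have := hm i hi
    rw [(h.blue i hi).1, (h.blue i hi).2] at this
    rwa [Line.mem_side_nonvertical, hc]
  · intro hm i hi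
    have := hm ((exists_getD_iff hb).2 ⟨i, hi, rfl⟩)
    rw [Line.mem_side_nonvertical, hc] at this
    rwa [(h.blue i hi).1, (h.blue i hi).2]

theorem Represents.outlierCount_eq (h : Represents K bs rs X Y) (hr : rs.Perm R.toList)
    {m₁ c₁ m₂ c₂ : ℝ} {w : Wedge} (hk : w.kind = K)
    (h₁ : w.line₁ = .nonvertical m₁ (K.sign * c₁))
    (h₂ : w.line₂ = .nonvertical m₂ (K.sign * c₂)) :
    outlierCount X Y bs.length rs.length m₁ c₁ m₂ c₂ = w.redOutliers R := by
  have hc : ∀ c : ℝ, (K.sign : ℝ) * (K.sign * c) = c := fun c => by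
    rw [← mul_assoc, K.sign_mul_self, one_mul]
  have hmem : ∀ j < rs.length, rs.getD j (0, 0) ∈ interior w.region ↔
      m₁ * X (bs.length + j) + c₁ < Y (bs.length + j) ∧
        m₂ * X (bs.length + j) + c₂ < Y (bs.length + j) := by
    intro j hj
    rw [Wedge.region_eq, interior_inter, Set.mem_inter_iff, h₁, h₂, hk,
      Line.mem_interior_side_nonvertical, Line.mem_interior_side_nonvertical, hc, hc,
      (h.red j hj).1, (h.red j hj).2]
  rw [Wedge.redOutliers, outlierCount, ← Set.ncard_coe_finset]
  refine Set.ncard_congr (fun j _ => rs.getD j (0, 0)) ?_ ?_ ?_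
  · intro j hj
    rw [Finset.mem_coe, Finset.mem_filter, Finset.mem_range] at hj
    exact ⟨(exists_getD_iff hr).2 ⟨j, hj.1, rfl⟩, (hmem j hj.1).2 hj.2⟩
  · intro i j hi hj hij
    rw [Finset.mem_coe, Finset.mem_filter, Finset.mem_range] at hi hj
    exact getD_inj hr hi.1 hj.1 hij
  · rintro p ⟨hp, hpi⟩
    obtain ⟨j, hj, rfl⟩ := (exists_getD_iff hr).1 hp
    refine ⟨j, ?_, rfl⟩
    rw [Finset.mem_coe, Finset.mem_filter, Finset.mem_range]
    exact ⟨hj, (hmem j hj).1 hpi⟩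

/-- The wedge of a given kind whose reflection is the North wedge of the given lines. -/
noncomputable def reflectedWedge (K : WedgeKind) (m₁ c₁ m₂ c₂ : ℝ) (h : m₁ < m₂) : Wedge :=
  ⟨K, .nonvertical m₁ (K.sign * c₁), .nonvertical m₂ (K.sign * c₂), WithBot.coe_lt_coe.2 h⟩

theorem NorthOptimal.isOptimal (h : Represents K bs rs X Y) (hb : bs.Perm B.toList)
    (hr : rs.Perm R.toList) (hBR : ∀ b ∈ B, ∀ r ∈ R, b.1 ≠ r.1) {m₁ c₁ m₂ c₂ : ℝ}
    (hN : NorthOptimal X Y bs.length rs.length m₁ c₁ m₂ c₂) :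
    (reflectedWedge K m₁ c₁ m₂ c₂ hN.lt).IsOptimal {K} B R := by
  refine ⟨⟨rfl, ?_⟩, fun w' hk hw' => ?_⟩
  · rw [Wedge.region_eq]
    exact Set.subset_inter ((h.lineBelow_iff hb).1 hN.below₁) ((h.lineBelow_iff hb).1 hN.below₂)
  · obtain ⟨w, hwk, hwB, hle, n₁, d₁, n₂, d₂, e₁, e₂⟩ := w'.exists_nonvertical hBR hw'
    have hwK : w.kind = K := hwk.trans hk
    have hc : ∀ c : ℝ, (K.sign : ℝ) * (K.sign * c) = c := fun c => by
      rw [← mul_assoc, K.sign_mul_self, one_mul]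
    refine le_trans ?_ hle
    rw [← hc d₁] at e₁
    rw [← hc d₂] at e₂
    have hlt : n₁ < n₂ := by
      have := w.slope_lt
      rw [e₁, e₂] at this
      exact WithBot.coe_lt_coe.1 this
    rw [Wedge.region_eq, hwK, e₁, e₂, Set.subset_inter_iff] at hwB
    rw [← h.outlierCount_eq hr hwK e₁ e₂,
      ← h.outlierCount_eq hr (w := reflectedWedge K m₁ c₁ m₂ c₂ hN.lt) rfl rfl rfl]
    exact hN.le _ _ _ _ hlt ((h.lineBelow_iff hb).2 hwB.1) ((h.lineBelow_iff hb).2 hwB.2)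

theorem Represents.inj (h : Represents K bs rs X Y) (hb : bs.Perm B.toList)
    (hr : rs.Perm R.toList) (hgen : InGeneralPosition B R) :
    ∀ i < bs.length + rs.length, ∀ j < bs.length + rs.length, X i = X j → i = j := by
  have hX : ∀ i < bs.length + rs.length,
      X i = K.sign * ((bs ++ rs).getD i (0, 0)).1 ∧ (bs ++ rs).getD i (0, 0) ∈ B ∪ R := by
    intro i hi
    rcases Nat.lt_or_ge i bs.length with hlt | hge
    · rw [List.getD_append _ _ _ _ hlt]
      exact ⟨(h.blue i hlt).1, Finset.mem_union_left _ ((exists_getD_iff hb).2 ⟨i, hlt, rfl⟩)⟩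
    · rw [List.getD_append_right _ _ _ _ hge]
      have := (h.red (i - bs.length) (by omega)).1
      rw [Nat.add_sub_cancel' hge] at this
      exact ⟨this, Finset.mem_union_right _
        ((exists_getD_iff hr).2 ⟨i - bs.length, by omega, rfl⟩)⟩
  have hnodup : (bs ++ rs).Nodup := by
    rw [List.nodup_append']
    refine ⟨hb.nodup_iff.2 B.nodup_toList, hr.nodup_iff.2 R.nodup_toList, fun p hp hp' => ?_⟩
    rw [hb.mem_iff, Finset.mem_toList] at hp
    rw [hr.mem_iff, Finset.mem_toList] at hp'
    exact Finset.disjoint_left.1 hgen.1 hp hp'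
  intro i hi j hj hij
  rw [(hX i hi).1, (hX j hj).1] at hij
  have h1 : ((bs ++ rs).getD i (0, 0)).1 = ((bs ++ rs).getD j (0, 0)).1 := by
    have := congrArg ((K.sign : ℝ) * ·) hij
    simpa only [← mul_assoc, K.sign_mul_self, one_mul] using this
  have h2 := hgen.2.1 (by simpa using (hX i hi).2) (by simpa using (hX j hj).2) h1
  rw [List.getD_eq_getElem _ _ (by simpa using hi), List.getD_eq_getElem _ _ (by simpa using hj)]
    at h2
  exact (hnodup.getElem_inj_iff).1 h2

theorem fst_ne_of_generalPosition (hgen : InGeneralPosition B R) :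
    ∀ b ∈ B, ∀ r ∈ R, b.1 ≠ r.1 := by
  intro b hb r hr h
  have := hgen.2.1 (Or.inl hb) (Or.inr hr) h
  subst this
  exact Finset.disjoint_left.1 hgen.1 hb hr

end Lists

/-! ### The program for wedges of both kinds -/

/-- Reflect the blue points if `σ = -1`, and store them before the red points. -/
def loadBlue (σ : ℚ) : Prog :=
  forLoop wI (wat wIn (wc 0)) <|
    .seq (.setReal rX (wvar wI) (rc σ * rat rBlueX (wvar wI))) <|
    .setReal rY (wvar wI) (rc σ * rat rBlueY (wvar wI))

/-- Reflect the red points if `σ = -1`, and store them after the blue points. -/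
def loadRed (σ : ℚ) : Prog :=
  forLoop wI (wat wIn (wc 1)) <|
    .seq (.setReal rX (wat wIn (wc 0) + wvar wI) (rc σ * rat rRedX (wvar wI))) <|
    .setReal rY (wat wIn (wc 0) + wvar wI) (rc σ * rat rRedY (wvar wI))

/-- Store the wedge that has been computed, and the number of its outliers, in the arrays with
number `d`. -/
def saveWedge (d : ℕ) : Prog :=
  .seq (.setReal d (wc 0) (rvar rSlope₁)) <|
  .seq (.setReal d (wc 1) (rvar rCut₁)) <|
  .seq (.setReal d (wc 2) (rvar rSlope₂)) <|
  .seq (.setReal d (wc 3) (rvar rCut₂)) <|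
  .setWord d (wc 0) (wvar wOutliers)

/-- Compute an optimal wedge of one kind; the result is stored in its reflected form. -/
def bestWedge (K : WedgeKind) (d : ℕ) : Prog :=
  .seq (loadBlue K.sign) <| .seq (loadRed K.sign) <| .seq northWedge <| saveWedge d

/-- Output the wedge that is stored in the arrays with number `d`. -/
def outputWedge (K : WedgeKind) (d : ℕ) : Prog :=
  .seq (.setWord wKind (wc 0) (wc (match K with | .north => 0 | .south => 1))) <|
  .seq (.setReal rWedge (wc 0) (rat d (wc 0))) <|
  .seq (.setReal rWedge (wc 1) (rc K.sign * rat d (wc 1))) <|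
  .seq (.setReal rWedge (wc 2) (rat d (wc 2))) <|
  .setReal rWedge (wc 3) (rc K.sign * rat d (wc 3))

/-- Compute an optimal wedge of each kind, and output the North wedge if the test `b` succeeds. -/
def wedgeProgram (b : BExp) : Prog :=
  .seq (bestWedge .north aNorth) <|
  .seq (bestWedge .south aSouth) <|
  .branch b (outputWedge .north aNorth) (outputWedge .south aSouth)

/-- The memory holds the input. -/
structure HoldsInput (bs rs : List (ℝ × ℝ)) (s : State) : Prop where
  blueCount : s.word wIn 0 = bs.length
  redCount : s.word wIn 1 = rs.length
  blueX : ∀ i, s.real rBlueX i = (bs.getD i (0, 0)).1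
  blueY : ∀ i, s.real rBlueY i = (bs.getD i (0, 0)).2
  redX : ∀ i, s.real rRedX i = (rs.getD i (0, 0)).1
  redY : ∀ i, s.real rRedY i = (rs.getD i (0, 0)).2

theorem holdsInput_inputState (bs rs : List (ℝ × ℝ)) : HoldsInput bs rs (inputState bs rs) :=
  ⟨rfl, rfl, fun _ => rfl, fun _ => rfl, fun _ => rfl, fun _ => rfl⟩

theorem HoldsInput.of_frame {bs rs : List (ℝ × ℝ)} {s s' : State} {p : Prog}
    (h : HoldsInput bs rs s) (hf : Frame p s s') (hw : p.setsWord wIn = false)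
    (h0 : p.setsReal rBlueX = false) (h1 : p.setsReal rBlueY = false)
    (h2 : p.setsReal rRedX = false) (h3 : p.setsReal rRedY = false) : HoldsInput bs rs s' := by
  obtain ⟨a1, a2, a3, a4, a5, a6⟩ := h
  rw [← hf.1 wIn hw] at a1 a2
  rw [← hf.2 _ h0] at a3
  rw [← hf.2 _ h1] at a4
  rw [← hf.2 _ h2] at a5
  rw [← hf.2 _ h3] at a6
  exact ⟨a1, a2, a3, a4, a5, a6⟩

section Wedges

variable {W l : ℕ} {bs rs : List (ℝ × ℝ)} {s : State}

theorem loadBlue_spec (h : HoldsInput bs rs s) (σ : ℚ) (hW : bs.length < W) :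
    wp W (loadBlue σ) (fun t s' => t ≤ 50 * bs.length + 50 ∧ ∀ i < bs.length,
      s'.real rX i = σ * (bs.getD i (0, 0)).1 ∧ s'.real rY i = σ * (bs.getD i (0, 0)).2) s := by
  unfold loadBlue
  refine wp_mono (wp_for (n := bs.length) (fun k s' => HoldsInput bs rs s' ∧ ∀ i < k,
    s'.real rX i = σ * (bs.getD i (0, 0)).1 ∧ s'.real rY i = σ * (bs.getD i (0, 0)).2)
    (fun _ => 0) 20 hW rfl ?_ rfl ?_ ?_) ?_
  · exact ⟨⟨h.1, h.2, h.3, h.4, h.5, h.6⟩, by simp⟩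
  · rintro k s hk ⟨h1, h2⟩
    simp [h1.1]
  · rintro k s hk ⟨h1, h2⟩ hi
    simp only [wp_seq, wp_setReal]
    refine ⟨by simp, by simp, by simp, by simp, by simp,
      ⟨h1.1, h1.2, h1.3, h1.4, h1.5, h1.6⟩, ?_⟩
    intro i hik
    simp [hi, h1.blueX, h1.blueY, Function.update_apply]
    split_ifs with h
    · simp [h]
    · simpa using h2 i (by omega)
  · rintro t s' ⟨ht, -, h⟩
    simp at ht
    exact ⟨by omega, h⟩

theorem loadRed_spec (h : HoldsInput bs rs s) (σ : ℚ) (hW : bs.length + rs.length < W) :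
    wp W (loadRed σ) (fun t s' => t ≤ 50 * rs.length + 50 ∧
      (∀ i < bs.length, s'.real rX i = s.real rX i ∧ s'.real rY i = s.real rY i) ∧
      ∀ j < rs.length, s'.real rX (bs.length + j) = σ * (rs.getD j (0, 0)).1 ∧
        s'.real rY (bs.length + j) = σ * (rs.getD j (0, 0)).2) s := by
  unfold loadRed
  refine wp_mono (wp_for (n := rs.length) (fun k s' => HoldsInput bs rs s' ∧
    (∀ i < bs.length, s'.real rX i = s.real rX i ∧ s'.real rY i = s.real rY i) ∧
    ∀ j < k, s'.real rX (bs.length + j) = σ * (rs.getD j (0, 0)).1 ∧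
        s'.real rY (bs.length + j) = σ * (rs.getD j (0, 0)).2)
    (fun _ => 0) 30 (by omega) rfl ?_ rfl ?_ ?_) ?_
  · exact ⟨⟨h.1, h.2, h.3, h.4, h.5, h.6⟩, fun _ _ => ⟨rfl, rfl⟩, by simp⟩
  · rintro k s hk ⟨h1, h2⟩
    simp [h1.2]
    omega
  · rintro k s' hk ⟨h1, h2, h3⟩ hi
    simp only [wp_seq, wp_setReal]
    refine ⟨by simp [h1.1, hi]; omega, by simp, by simp [h1.1, hi]; omega, by simp, by simp,
      ⟨h1.1, h1.2, h1.3, h1.4, h1.5, h1.6⟩, ?_, ?_⟩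
    · intro i hib
      have hne : i ≠ bs.length + k := by omega
      simpa [hi, h1.1, hne] using h2 i hib
    · intro j hjk
      simp [hi, h1.1, h1.redX, h1.redY, Function.update_apply]
      split_ifs with h
      · simp [h]
      · simpa using h3 j (by omega)
  · rintro t s' ⟨ht, -, h⟩
    simp at ht
    exact ⟨by omega, h⟩

theorem saveWedge_spec (d : ℕ) (hd : 25 < d) (hW : 3 ≤ W) :
    wp W (saveWedge d) (fun t s' => t ≤ 50 ∧ s'.word d 0 = s.word wOutliers 0 ∧
      s'.real d 0 = s.real rSlope₁ 0 ∧ s'.real d 1 = s.real rCut₁ 0 ∧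
      s'.real d 2 = s.real rSlope₂ 0 ∧ s'.real d 3 = s.real rCut₂ 0) s := by
  have h1 : 1 ≤ W := by omega
  have h2 : 2 ≤ W := by omega
  have n2 : rSlope₂ ≠ d := by omega
  have n3 : rCut₁ ≠ d := by omega
  have n4 : rCut₂ ≠ d := by omega
  simp [saveWedge, hW, h1, h2, n2, n3, n4]

theorem outputWedge_spec {K : WedgeKind} {d : ℕ} {m₁ c₁ m₂ c₂ : ℝ} (hd : 4 < d) (hW : 3 ≤ W)
    (h₁ : s.real d 0 = m₁) (h₂ : s.real d 1 = c₁) (h₃ : s.real d 2 = m₂) (h₄ : s.real d 3 = c₂)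
    (h : m₁ < m₂) :
    wp W (outputWedge K d) (fun t s' => t ≤ 50 ∧
      Outputs s' (reflectedWedge K m₁ c₁ m₂ c₂ h)) s := by
  have hW1 : 1 ≤ W := by omega
  have hW2 : 2 ≤ W := by omega
  have n : d ≠ rWedge := by omega
  cases K <;>
    simp [outputWedge, Outputs, reflectedWedge, WedgeKind.sign, h₁, h₂, h₃, h₄, hW, hW1, hW2, n]

/-- The arrays with number `d` hold an optimal wedge of the kind `K`. -/
structure HoldsWedge (K : WedgeKind) (B R : Finset (ℝ × ℝ)) (d : ℕ) (s : State) : Prop where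
  lt : s.real d 0 < s.real d 2
  isOptimal : (reflectedWedge K (s.real d 0) (s.real d 1) (s.real d 2) (s.real d 3) lt).IsOptimal
    {K} B R
  count : s.word d 0 =
    (reflectedWedge K (s.real d 0) (s.real d 1) (s.real d 2) (s.real d 3) lt).redOutliers R

theorem bestWedge_spec {B R : Finset (ℝ × ℝ)} (hb : bs.Perm B.toList) (hr : rs.Perm R.toList)
    (hgen : InGeneralPosition B R) (h : HoldsInput bs rs s) (K : WedgeKind) (d : ℕ) (hd : 25 < d)
    (hpos : 0 < bs.length + rs.length) (hW : 8 * (bs.length + rs.length) + 10 < W)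
    (hl : 2 * (2 * (bs.length + rs.length)) + 1 < 2 ^ l) :
    wp W (bestWedge K d) (fun t s' =>
      t ≤ 20500 * ((bs.length + rs.length + 1) * (l + 1)) ∧ HoldsWedge K B R d s') s := by
  unfold bestWedge
  simp only [wp_seq]
  refine wp_use (loadBlue_spec h K.sign (by omega)) ?_
  rintro t1 s1 ⟨ht1, hblue⟩ hf1
  have i1 : HoldsInput bs rs s1 := h.of_frame hf1 rfl rfl rfl rfl rfl
  refine wp_use (loadRed_spec i1 K.sign (by omega)) ?_
  rintro t2 s2 ⟨ht2, hkeep, hred⟩ hf2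
  have i2 : HoldsInput bs rs s2 := i1.of_frame hf2 rfl rfl rfl rfl rfl
  have hrep : Represents K bs rs (s2.real rX) (s2.real rY) := by
    refine ⟨fun i hi => ?_, hred⟩
    rw [(hkeep i hi).1, (hkeep i hi).2]
    exact hblue i hi
  refine wp_mono (northWedge_spec i2.1 i2.2 rfl rfl (hrep.inj hb hr hgen) hpos hW hl) ?_
  rintro t3 s3 ⟨ht3, hcount, hopt⟩
  refine wp_mono (saveWedge_spec d hd (by omega)) ?_
  rintro t4 s4 ⟨ht4, e0, e1, e2, e3, e4⟩
  rw [← e0, ← e1, ← e2, ← e3, ← e4] at hcount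
  rw [← e1, ← e2, ← e3, ← e4] at hopt
  refine ⟨?_, hopt.lt, hopt.isOptimal hrep hb hr (fst_ne_of_generalPosition hgen), ?_⟩
  · have : (bs.length + rs.length + 1) * 1 ≤ (bs.length + rs.length + 1) * (l + 1) := by
      gcongr
      omega
    omega
  · rw [hcount, hrep.outlierCount_eq hr (w := reflectedWedge K _ _ _ _ hopt.lt) rfl rfl rfl]

theorem wedgeProgram_spec {B R : Finset (ℝ × ℝ)} (hb : bs.Perm B.toList) (hr : rs.Perm R.toList)
    (hgen : InGeneralPosition B R) (h : HoldsInput bs rs s)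
    (hpos : 0 < bs.length + rs.length) (hW : 8 * (bs.length + rs.length) + 10 < W)
    (hl : 2 * (2 * (bs.length + rs.length)) + 1 < 2 ^ l) {T : Set WedgeKind} {b : BExp}
    (hok : ∀ s, b.Ok W s) (hcost : b.cost ≤ 10)
    (hnorth : ∀ s, b.Holds s → .north ∈ T ∧ (.south ∈ T → s.word aNorth 0 ≤ s.word aSouth 0))
    (hsouth : ∀ s, ¬ b.Holds s → .south ∈ T ∧ (.north ∈ T → s.word aSouth 0 ≤ s.word aNorth 0)) :
    wp W (wedgeProgram b) (fun t s' =>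
      t ≤ 42000 * ((bs.length + rs.length + 1) * (l + 1)) ∧
        ∃ w, Outputs s' w ∧ w.IsOptimal T B R) s := by
  have hone : 1 * 1 ≤ (bs.length + rs.length + 1) * (l + 1) := by
    gcongr <;> omega
  unfold wedgeProgram
  rw [wp_seq]
  refine wp_use (bestWedge_spec hb hr hgen h .north aNorth (by omega) hpos hW hl) ?_
  rintro t1 s1 ⟨ht1, hN1⟩ hf1
  have i1 : HoldsInput bs rs s1 := h.of_frame hf1 rfl rfl rfl rfl rfl
  rw [wp_seq]
  refine wp_use (bestWedge_spec hb hr hgen i1 .south aSouth (by omega) hpos hW hl) ?_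
  rintro t2 s2 ⟨ht2, hS⟩ hf2
  have hN : HoldsWedge .north B R aNorth s2 := by
    obtain ⟨h1, h2, h3⟩ := hN1
    have e1 : s2.real aNorth = s1.real aNorth := hf2.2 aNorth rfl
    have e2 : s2.word aNorth = s1.word aNorth := hf2.1 aNorth rfl
    simp only [← e1, ← e2] at h1 h2 h3
    exact ⟨h1, h2, h3⟩
  rw [wp_branch]
  refine ⟨hok s2, fun hb => ?_, fun hb => ?_⟩
  · refine wp_mono (outputWedge_spec (by omega) (by omega) rfl rfl rfl rfl hN.lt) ?_
    rintro t3 s3 ⟨ht3, hout⟩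
    refine ⟨by omega, _, hout, ⟨(hnorth s2 hb).1, hN.isOptimal.1.2⟩, fun w' hw' hB' => ?_⟩
    rcases hk : w'.kind with _ | _
    · exact hN.isOptimal.2 w' hk hB'
    · rw [← hN.count]
      refine ((hnorth s2 hb).2 (hk ▸ hw')).trans ?_
      rw [hS.count]
      exact hS.isOptimal.2 w' hk hB'
  · refine wp_mono (outputWedge_spec (by omega) (by omega) rfl rfl rfl rfl hS.lt) ?_
    rintro t3 s3 ⟨ht3, hout⟩
    refine ⟨by omega, _, hout, ⟨(hsouth s2 hb).1, hS.isOptimal.1.2⟩, fun w' hw' hB' => ?_⟩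
    rcases hk : w'.kind with _ | _
    · rw [← hS.count]
      refine ((hsouth s2 hb).2 (hk ▸ hw')).trans ?_
      rw [hN.count]
      exact hN.isOptimal.2 w' hk hB'
    · exact hS.isOptimal.2 w' hk hB'

/-- A test that selects the kind of the output, depending on the kinds that are allowed. -/
theorem exists_selection (T : Set WedgeKind) (hT : T.Nonempty) : ∃ b : BExp,
    b.cost ≤ 10 ∧ (∀ W s, 1 ≤ W → b.Ok W s) ∧
    (∀ s, b.Holds s → .north ∈ T ∧ (.south ∈ T → s.word aNorth 0 ≤ s.word aSouth 0)) ∧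
    ∀ s, ¬ b.Holds s → .south ∈ T ∧ (.north ∈ T → s.word aSouth 0 ≤ s.word aNorth 0) := by
  by_cases hN : .north ∈ T
  · by_cases hS : .south ∈ T
    · refine ⟨.wlt (wvar aNorth) (wvar aSouth), by simp, by simp, fun s h => ⟨hN, fun _ => ?_⟩,
        fun s h => ⟨hS, fun _ => ?_⟩⟩
      · simp at h
        omega
      · simpa using h
    · exact ⟨.wlt (wc 0) (wc 1), by simp, by simp, fun s _ => ⟨hN, fun h => absurd h hS⟩,
        fun s h => absurd (by simp) h⟩
  · refine ⟨.wlt (wc 0) (wc 0), by simp, by simp, fun s h => absurd h (by simp),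
        fun s h => ⟨?_, fun h => absurd h hN⟩⟩
    obtain ⟨K, hK⟩ := hT
    cases K
    · exact absurd hK hN
    · exact hK

end Wedges

end RealRAM

/-! ### The running time in terms of `n` -/

theorem log_add_five_le {n : ℕ} (hn : 2 ≤ n) :
    ((Nat.log 2 n + 4 + 1 : ℕ) : ℝ) ≤ 6 * (Real.log n / Real.log 2) := by
  have h2 : (0 : ℝ) < Real.log 2 := Real.log_pos one_lt_two
  have h1 : (1 : ℝ) ≤ Real.log n / Real.log 2 := by
    rw [le_div_iff₀ h2, one_mul]
    exact Real.log_le_log (by norm_num) (by exact_mod_cast hn)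
  have h3 : (Nat.log 2 n : ℝ) ≤ Real.log n / Real.log 2 := by
    rw [le_div_iff₀ h2, ← Real.log_pow]
    refine Real.log_le_log (by positivity) ?_
    exact_mod_cast Nat.pow_log_le_self 2 (by omega)
  push_cast
  linarith

theorem mainTheorem2 (T : Set WedgeKind) (hT : T.Nonempty) :
    ∃ (P : RealRAM.Prog) (c : ℕ) (C : ℝ),
      ∀ (n : ℕ) (B R : Finset (ℝ × ℝ)),
        B.card ≤ n → R.card ≤ n → 3 ≤ B.card + R.card → InGeneralPosition B R →
        ∀ bs rs : List (ℝ × ℝ), bs.Perm B.toList → rs.Perm R.toList →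
          ∃ (t : ℕ) (s : RealRAM.State) (w : Wedge),
            RealRAM.Exec ((n + 2) ^ c) P (RealRAM.inputState bs rs) t s ∧
            (t : ℝ) ≤ C * (n * Real.log n) ∧
            RealRAM.Outputs s w ∧ w.IsOptimal T B R := by
  obtain ⟨b, hcost, hok, hnorth, hsouth⟩ := RealRAM.exists_selection T hT
  -- With at most `2 * n` points, `2 * n + 1 ≤ 3 * n` and `l = Nat.log 2 n + 4`, the bound
  -- `42000 * ((2 * n + 1) * (l + 1))` is at most `42000 * (3 * n) * (6 * log₂ n)`.
  refine ⟨RealRAM.wedgeProgram b, 4, 42000 * 18 / Real.log 2, ?_⟩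
  intro n B R hB hR h3 hgen bs rs hbs hrs
  have hbl : bs.length = B.card := by rw [hbs.length_eq, Finset.length_toList]
  have hrl : rs.length = R.card := by rw [hrs.length_eq, Finset.length_toList]
  have hn : 2 ≤ n := by omega
  -- There are at most `2 * n` points, and `n + 2 ≥ 4`.
  have hW : 8 * (bs.length + rs.length) + 10 < (n + 2) ^ 4 := by
    have h1 : (n + 2) * 4 ^ 3 ≤ (n + 2) * (n + 2) ^ 3 := by
      gcongr
      omega
    have h2 : (n + 2) ^ 4 = (n + 2) * (n + 2) ^ 3 := pow_succ' _ _
    omega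
  have hl : 2 * (2 * (bs.length + rs.length)) + 1 < 2 ^ (Nat.log 2 n + 4) := by
    have := Nat.lt_pow_succ_log_self one_lt_two n
    have h2 : 2 ^ (Nat.log 2 n + 4) = 8 * 2 ^ (Nat.log 2 n).succ := by
      rw [Nat.succ_eq_add_one, pow_add, pow_add]
      ring
    omega
  obtain ⟨t, s, hex, ht, w, hout, hopt⟩ := RealRAM.wedgeProgram_spec hbs hrs hgen
    (RealRAM.holdsInput_inputState bs rs) (by omega) hW hl (fun s => hok _ s (by omega)) hcost
    hnorth hsouth
  refine ⟨t, s, w, hex, ?_, hout, hopt⟩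
  have ht' : (t : ℝ) ≤ 42000 * ((3 * n) * ((Nat.log 2 n + 4 + 1 : ℕ) : ℝ)) := by
    have h1 : t ≤ 42000 * ((3 * n) * (Nat.log 2 n + 4 + 1)) := by
      refine ht.trans ?_
      gcongr
      omega
    exact_mod_cast h1
  calc (t : ℝ) ≤ 42000 * ((3 * n) * ((Nat.log 2 n + 4 + 1 : ℕ) : ℝ)) := ht'
    _ ≤ 42000 * ((3 * n) * (6 * (Real.log n / Real.log 2))) := by
      gcongr
      exact log_add_five_le hn
    _ = 42000 * 18 / Real.log 2 * (n * Real.log n) := by ring
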